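/- **Setting.** Let $(X_i,B_i(0),B_i(1),W_i)_{i\ge1}$ be i.i.d., with covariates $X_i\in\mathcal X$, potential submissions $B_i(w)\in\mathcal B$ (depending only on the participant's own treatment) and treatment $W_i\in\{0,1\}$; $B_i=B_i(W_i)$. There are $J\ge1$ items, capacities $s^*\in[0,1]^J$, allocations $d:\mathcal B\times\mathbb R^J\to\mathbb R^J$, outcomes $y:\mathcal B\times\mathbb R^J\to\mathbb R$, a set $\mathcal S\subset\mathbb R^J$ of cutoffs, and a mechanism $m$ mapping $n$ submissions, $n$ weights and a capacity vector to a cutoff in $\mathbb R^J$. $\Pi$ is a class of rules $\pi:\mathcal X\to[0,1]$ containing $\pi_1\equiv1$ and $\pi_0\equiv0$. Put $e(x)=P(W_i=1\mid X_i=x)$, $P(W_i=0\mid X_i=x)=1-e(x)$, $\mu^y_w(x,p)=E[y(B_i(w),p)\mid X_i=x]$, $\mu^d_w(x,p)=E[d(B_i(w),p)\mid X_i=x]$, $$y_\pi(p)=E[\pi(X_i)y(B_i(1),p)+(1-\pi(X_i))y(B_i(0),p)],\quad z_\pi(p)=E[\pi(X_i)d(B_i(1),p)+(1-\pi(X_i))d(B_i(0),p)]-s^*,$$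 let $p^*_\pi$ be the zero of $z_\pi$ in $\mathcal S$, $\nu^*_\pi=\nabla_p^\top y_\pi(p^*_\pi)[\nabla_pz_\pi(p^*_\pi)]^{-1}$, and write $p^*_w,\nu^*_w$ for $\pi=\pi_w$. Let $\tau^*_{GTE}=E[y(B_i(1),p^*_1)]-E[y(B_i(0),p^*_0)]$. For $w\in\{0,1\}$ and $a\in\{y,d\}$ let $$\Gamma^{*a}_{wi}(p)=\mu^a_w(X_i,p)+\tfrac{1(W_i=w)}{P(W_i=w\mid X_i)}\bigl(a(B_i(w),p)-\mu^a_w(X_i,p)\bigr),\qquad \Gamma^{*q}_{wi}(p)=\Gamma^{*y}_{wi}(p)-\nu^*_w\bigl(\Gamma^{*d}_{wi}(p)-s^*\bigr).$$ **Estimator.** Independently of the data, $\{1,\dots,n\}$ is split at random into three folds, $k(i)$ being the fold of $i$, and the complement of each fold $k$ is split at random into $H_{-k}$ and $G_{-k}$. For a propensity score $f$ and sample size $N$ let $\gamma_i(f,N)=\pi(X_i)\frac{W_i}{Nf(X_i)}+(1-\pi(X_i))\frac{1-W_i}{N(1-f(X_i))}$. (i) For each $k$, with $\tilde e$ estimated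 from $(W_i,X_i)_{i\in H_{-k}}$, run $m$ on the submissions in $H_{-k}$ with weights $\gamma_i(\tilde e,|H_{-k}|)$ and capacities $s^*$ to get $\tilde P_\pi=\tilde P^k_\pi$. From $G_{-k}$, estimate $\hat e^k$ by regressing $W_i$ on $X_i$, and $\hat\mu^{y,k}_w(x,p)$, $\hat\mu^{d,k}_w(x,p)$ by regressing $y(B_i,p)$, $d(B_i,p)$ on $(X_i,W_i)$ (by any measurable regression algorithms). Write $\hat\mu^{a,k}_w(x)=\hat\mu^{a,k}_w(x,\tilde P^k_\pi)$ for $a\in\{y,d\}$, and let $\hat\Gamma^a_{wi}(p)$ be $\Gamma^{*a}_{wi}(p)$ with $e(X_i)$ and $\mu^a_w(X_i,p)$ replaced by $\hat e^{k(i)}(X_i)$ and $\hat\mu^{a,k(i)}_w(X_i)$. (ii) On the full sample let $\hat P_\pi=m(\mathbf B,(\gamma_i(\hat e^{k(i)},n))_i,\hat s_\pi)$, where $$\hat s_\pi=s^*+\frac1n\sum_{i=1}^n\Bigl[\Bigl(\tfrac{W_i}{\hat e^{k(i)}(X_i)}-1\Bigr)\pi(X_i)\hat\mu^{d,k(i)}_1(X_i)+(1-\pi(X_i))\Bigl(\tfrac{1-W_i}{1-\hat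 e^{k(i)}(X_i)}-1\Bigr)\hat\mu^{d,k(i)}_0(X_i)\Bigr].$$ (iii) $\hat V_n(\pi)=\frac1n\sum_i[\pi(X_i)\hat\Gamma^y_{1i}(\hat P_\pi)+(1-\pi(X_i))\hat\Gamma^y_{0i}(\hat P_\pi)]$ and $\hat\tau_{GTE}=\hat V_n(\pi_1)-\hat V_n(\pi_0)$. **Assumptions.** 1. *Identification.* $\{B_i(1),B_i(0)\}$ and $W_i$ are conditionally independent given $X_i$; $0<e(x)<1$ for all $x$. 2. *Cutoff mechanism.* The finite-market cutoffs $P_n(\mathbf w)=m(\mathbf B(\mathbf w),\frac1n\mathbf 1_n,s^*)$ lie in $\mathcal S$. There are $a_n=o(n^{-1/2})$ and $c>0$ such that for all $n\ge1$ and $\mathbf w\in\{0,1\}^n$ the set $\{p\in\mathcal S:\|\frac1n\sum_id(B_i(w_i),p)-s^*\|\le a_n\}$ is non-empty with probability at least $1-e^{-cn}$, and contains $P_n(\mathbf w)$ when it is non-empty. 3. *Regularity of outcomes.* There are constants $c'>0$, $0<c_3\le c_4$ such that: (a) for some $h_d,h_y,C>0$, the classes $\{d_j(\cdot,p):p\in\mathcal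 S\}$, $j\le J$, and $\{y(\cdot,p):p\in\mathcal S\}$ have uniform covering numbers $\sup_QN(\epsilon,\cdot,L_2(Q))\le C\epsilon^{-h_d}$, respectively $\le C\epsilon^{-h_y}$, for $0<\epsilon<1$, with $Q$ ranging over finitely discrete probability measures; (b) $d$ and $y$ are bounded on $\mathcal B\times\mathcal S$, and for some $L>0$ and all $p,p'\in\mathcal S$, $w$, $j$: $E[(d_j(B_i(w),p)-d_j(B_i(w),p'))^2]\le L\|p-p'\|$ and likewise for $y$; (c) for all $w,x$, the maps $p\mapsto\mu^y_w(x,p)$ and $p\mapsto\mu^d_{w,j}(x,p)$ are $C^2$ on the interior of $\mathcal S$ with first and second partial derivatives bounded by $c'$; (d) for $\pi\in\Pi$ the singular values of $\nabla_pz_\pi(p^*_\pi)$ lie in $[c_3,c_4]$. 4. *Regularity of equilibrium.* $\mathcal S$ is compact; for some $c_1,c_2>0$ and all $\pi\in\Pi$, $\mathcal S$ contains the ball of radius $c_1$ around $p^*_\pi$, $p^*_\pi$ is the only zero of $z_\pi$ in $\mathcal S$, and $2\|z_\pi(p)\|\ge c_2$ for all $p\in\mathcal S$ with $\|p-p^*_\pi\|\ge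 c_3/(2Jc')$. 5. *Nuisance estimation.* Let $X$ be a test observation, distributed as $X_i$ and independent of the training data. (a) For some $\kappa>0$, almost surely $\hat e^k(X)\in(\kappa,1-\kappa)$ for all $n,k$. (b) Almost surely $|\hat\mu^{y,k}_w(x,p)|$ and $|\hat\mu^{d,k}_{w,j}(x,p)|$ are bounded by a constant for all $n,k,w,x,j$ and $p\in\mathcal S$. (c) There are $\rho_{\mu,n},\rho_{e,n},\rho_{\theta,n}\ge0$ with $\rho_{e,n}\to0$, $\rho_{\mu,n}+\rho_{\theta,n}\to0$, $\rho_{e,n}\rho_{\mu,n}=o(n^{-1/2})$ and $\rho_{e,n}\rho_{\theta,n}=o(n^{-1/2})$ such that for all $\pi\in\Pi$ and $k$, with probability tending to one, $\|\hat\mu^k_w(\cdot,\tilde P^k_\pi)-\mu_w(\cdot,\tilde P^k_\pi)\|_{L_2(X)}\le\rho_{\mu,n}$ for $w\in\{0,1\}$ (where $\mu_w=(\mu^y_w,\mu^d_w)$), $\|\hat e^k-e\|_{L_2(X)}\le\rho_{e,n}$ and $\|\tilde P^k_\pi-p^*_\pi\|\le\rho_{\theta,n}$. (d) There is $\rho_{g,n}=o(n^{-1/2})$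 such that for all $\pi\in\Pi$, with probability tending to one, $\hat P_\pi\in\mathcal S$ and $\|\frac1n\sum_i[\pi(X_i)\hat\Gamma^d_{1i}(\hat P_\pi)+(1-\pi(X_i))\hat\Gamma^d_{0i}(\hat P_\pi)]-s^*\|\le\rho_{g,n}$. **Claim.** Under these assumptions, $$\hat\tau_{GTE}-\tau^*_{GTE}=\frac1n\sum_{i=1}^n\bigl(\Gamma^{*q}_{1i}(p^*_1)-\Gamma^{*q}_{0i}(p^*_0)-\tau^*_{GTE}\bigr)+o_p(n^{-1/2}),$$ and $\sqrt n(\hat\tau_{GTE}-\tau^*_{GTE})$ converges in distribution to $N(0,\sigma^2)$, where $\sigma^2=E[(\Gamma^{*q}_{1i}(p^*_1)-\Gamma^{*q}_{0i}(p^*_0)-\tau^*_{GTE})^2]$ is finite and equals the variance of $\Gamma^{*q}_{1i}(p^*_1)-\Gamma^{*q}_{0i}(p^*_0)$. -/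

import Mathlib

open MeasureTheory ProbabilityTheory Filter Topology
open scoped ENNReal NNReal

namespace CutoffMarket

/-- Cutoffs, allocations and capacities of a market with `J` items: `ℝ^J` with the Euclidean norm. -/
abbrev Vec (J : ℕ) : Type := EuclideanSpace ℝ (Fin J)

/-- A centralized cutoff mechanism: individual allocations `d(b, p)` and outcomes `y(b, p)` at a
submission `b` and a cutoff vector `p`, fractional capacities `s*`, the set `S` of cutoffs, and the
algorithm `m` that computes cutoffs from `n` submissions, `n` weights and a capacity vector. -/
structure Mechanism (𝓑 : Type*) (J : ℕ) where
  d : 𝓑 → Vec J → Vec J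
  y : 𝓑 → Vec J → ℝ
  cap : Vec J
  S : Set (Vec J)
  m : (n : ℕ) → (Fin n → 𝓑) → (Fin n → ℝ) → Vec J → Vec J

/-- A realized random split of `n` observations. The first component is the fold `k(i)`; the
second one says, for each fold `k` that does not contain `i`, whether `i` is used for the first
step cutoffs of fold `k` (`true`) or for the nuisance functions of fold `k` (`false`). -/
abbrev Split (n : ℕ) : Type := Fin n → Fin 3 × (Fin 3 → Bool)

/-- The part `H_{-k}` of the complement of fold `k`. -/
def Split.H {n : ℕ} (s : Split n) (k : Fin 3) : Finset (Fin n) :=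
  Finset.univ.filter fun i => (s i).1 ≠ k ∧ (s i).2 k = true

/-- The part `G_{-k}` of the complement of fold `k`. -/
def Split.G {n : ℕ} (s : Split n) (k : Fin 3) : Finset (Fin n) :=
  Finset.univ.filter fun i => (s i).1 ≠ k ∧ (s i).2 k = false

/-- The random variables: covariates, potential submissions `B_i(w)`, treatments, and the random
split of the first `n` observations. That `B_i` depends on the treatment vector through `w_i` only
is SUTVA for submissions. -/
structure Sample (Ω 𝒳 𝓑 : Type*) where
  X : ℕ → Ω → 𝒳
  B : ℕ → Bool → Ω → 𝓑
  W : ℕ → Ω → Bool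
  split : (n : ℕ) → Ω → Split n

/-- The propensity score and the conditional means `μ^y_w(x, p)`, `μ^d_w(x, p)`. -/
structure Regressions (𝒳 : Type*) (J : ℕ) where
  e : 𝒳 → ℝ
  muY : Bool → 𝒳 → Vec J → ℝ
  muD : Bool → 𝒳 → Vec J → Vec J

/-- The regression algorithms. Each one maps a data set, indexed by a set of observations out of
`n`, to a function. `eFirst` and `eHat` regress treatments on covariates, `muY` and `muD` regress a
response (the last component of the data) on covariates and treatments. -/
structure Learners (𝒳 : Type*) (J : ℕ) where
  eFirst : (n : ℕ) → (H : Finset (Fin n)) → (H → 𝒳 × Bool) → 𝒳 → ℝ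
  eHat : (n : ℕ) → (G : Finset (Fin n)) → (G → 𝒳 × Bool) → 𝒳 → ℝ
  muY : (n : ℕ) → (G : Finset (Fin n)) → (G → 𝒳 × Bool × ℝ) → Bool → 𝒳 → ℝ
  muD : (n : ℕ) → (G : Finset (Fin n)) → (G → 𝒳 × Bool × Vec J) → Bool → 𝒳 → Vec J

/-- The rule `π_1` (for `true`) that treats everybody, and `π_0` (for `false`) that treats nobody. -/
def uniformRule (𝒳 : Type*) (w : Bool) : 𝒳 → ℝ := fun _ => if w then 1 else 0

/-- The doubly-robust score `μ + 1(W = w) / P(W = w | X) (v - μ)` with propensity score `e`. -/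
noncomputable def drScore {V : Type*} [AddCommGroup V] [Module ℝ V]
    (w W : Bool) (e : ℝ) (mu v : V) : V :=
  mu + ((if W = w then 1 else 0) / (if w then e else 1 - e)) • (v - mu)

section Population

variable {Ω 𝒳 𝓑 : Type*} {J : ℕ}

/-- The potential-outcome data of participant `i`. -/
def Sample.obs (D : Sample Ω 𝒳 𝓑) (i : ℕ) (ω : Ω) : 𝒳 × 𝓑 × 𝓑 × Bool :=
  (D.X i ω, D.B i false ω, D.B i true ω, D.W i ω)

/-- The observed submission `B_i = B_i(W_i)`. -/
def Sample.bid (D : Sample Ω 𝒳 𝓑) (i : ℕ) (ω : Ω) : 𝓑 := D.B i (D.W i ω) ω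

/-- The finite-market cutoffs `P_n(w) = m(B(w), 1/n, s*)` under the treatment vector `w`. -/
noncomputable def finiteCutoff (D : Sample Ω 𝒳 𝓑) (M : Mechanism 𝓑 J) (n : ℕ) (w : Fin n → Bool)
    (ω : Ω) : Vec J :=
  M.m n (fun i => D.B i (w i) ω) (fun _ => 1 / (n : ℝ)) M.cap

/-- The cutoffs that clear the finite market under the treatment vector `w` up to an error `a`. -/
def clearingSet (D : Sample Ω 𝒳 𝓑) (M : Mechanism 𝓑 J) (a : ℝ) (n : ℕ) (w : Fin n → Bool)
    (ω : Ω) : Set (Vec J) :=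
  {p | p ∈ M.S ∧ ‖(1 / (n : ℝ)) • ∑ i : Fin n, M.d (D.B i (w i) ω) p - M.cap‖ ≤ a}

variable [MeasurableSpace Ω]

/-- Expected continuum-market outcomes `y_π(p)`. -/
noncomputable def yPop (D : Sample Ω 𝒳 𝓑) (M : Mechanism 𝓑 J) (P : Measure Ω)
    (π : 𝒳 → ℝ) (p : Vec J) : ℝ :=
  ∫ ω, (π (D.X 0 ω) * M.y (D.B 0 true ω) p + (1 - π (D.X 0 ω)) * M.y (D.B 0 false ω) p) ∂P

/-- Expected continuum-market excess demand `z_π(p)`. -/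
noncomputable def zPop (D : Sample Ω 𝒳 𝓑) (M : Mechanism 𝓑 J) (P : Measure Ω)
    (π : 𝒳 → ℝ) (p : Vec J) : Vec J :=
  (∫ ω, (π (D.X 0 ω) • M.d (D.B 0 true ω) p + (1 - π (D.X 0 ω)) • M.d (D.B 0 false ω) p) ∂P)
    - M.cap

/-- The row vector `(∇_p y_π(p))ᵀ (∇_p z_π(p))⁻¹`, as a linear functional. -/
noncomputable def nu (D : Sample Ω 𝒳 𝓑) (M : Mechanism 𝓑 J) (P : Measure Ω)
    (π : 𝒳 → ℝ) (p : Vec J) : Vec J →L[ℝ] ℝ :=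
  (fderiv ℝ (yPop D M P π) p).comp (fderiv ℝ (zPop D M P π) p).inverse

/-- The continuum-market global treatment effect; `pstar π` are the market-clearing cutoffs. -/
noncomputable def tauStar (D : Sample Ω 𝒳 𝓑) (M : Mechanism 𝓑 J) (P : Measure Ω)
    (pstar : (𝒳 → ℝ) → Vec J) : ℝ :=
  (∫ ω, M.y (D.B 0 true ω) (pstar (uniformRule 𝒳 true)) ∂P)
    - ∫ ω, M.y (D.B 0 false ω) (pstar (uniformRule 𝒳 false)) ∂P

/-- The score `Γ^{*q}_{w i}(p) = Γ^{*y}_{w i}(p) - ν*_w (Γ^{*d}_{w i}(p) - s*)`. -/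
noncomputable def qScore (D : Sample Ω 𝒳 𝓑) (M : Mechanism 𝓑 J) (R : Regressions 𝒳 J)
    (P : Measure Ω) (pstar : (𝒳 → ℝ) → Vec J) (w : Bool) (i : ℕ) (p : Vec J) (ω : Ω) : ℝ :=
  drScore w (D.W i ω) (R.e (D.X i ω)) (R.muY w (D.X i ω) p) (M.y (D.B i w ω) p)
    - nu D M P (uniformRule 𝒳 w) (pstar (uniformRule 𝒳 w))
        (drScore w (D.W i ω) (R.e (D.X i ω)) (R.muD w (D.X i ω) p) (M.d (D.B i w ω) p) - M.cap)

/-- `Γ^{*q}_{1 i}(p*_1) - Γ^{*q}_{0 i}(p*_0)`. -/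
noncomputable def gteScore (D : Sample Ω 𝒳 𝓑) (M : Mechanism 𝓑 J) (R : Regressions 𝒳 J)
    (P : Measure Ω) (pstar : (𝒳 → ℝ) → Vec J) (i : ℕ) (ω : Ω) : ℝ :=
  qScore D M R P pstar true i (pstar (uniformRule 𝒳 true)) ω
    - qScore D M R P pstar false i (pstar (uniformRule 𝒳 false)) ω

/-- `σ² = E[(Γ^{*q}_1(p*_1) - Γ^{*q}_0(p*_0) - τ*)²]`. -/
noncomputable def sigmaSq (D : Sample Ω 𝒳 𝓑) (M : Mechanism 𝓑 J) (R : Regressions 𝒳 J)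
    (P : Measure Ω) (pstar : (𝒳 → ℝ) → Vec J) : ℝ :=
  ∫ ω, (gteScore D M R P pstar 0 ω - tauStar D M P pstar) ^ 2 ∂P

end Population

section Estimator

variable {Ω 𝒳 𝓑 : Type*} {J : ℕ}
variable (D : Sample Ω 𝒳 𝓑) (M : Mechanism 𝓑 J) (L : Learners 𝒳 J)

/-- The weight `π(X) W / (N e(X)) + (1 - π(X)) (1 - W) / (N (1 - e(X)))`. -/
noncomputable def ipwWeight (π e : 𝒳 → ℝ) (N : ℕ) (x : 𝒳) (W : Bool) : ℝ :=
  π x * ((if W then 1 else 0) / (N * e x)) + (1 - π x) * ((if W then 0 else 1) / (N * (1 - e x)))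

/-- The first step propensity score, estimated on `H_{-k}`. -/
def eFirst (n : ℕ) (k : Fin 3) (ω : Ω) : 𝒳 → ℝ :=
  L.eFirst n ((D.split n ω).H k) fun i => (D.X i.1 ω, D.W i.1 ω)

/-- The first step cutoffs of fold `k`: the mechanism is run on the subsample `H_{-k}`, listed in
increasing order, with estimated inverse propensity weights. -/
noncomputable def pFirst (π : 𝒳 → ℝ) (n : ℕ) (k : Fin 3) (ω : Ω) : Vec J :=
  let H := (D.split n ω).H k
  let i : Fin H.card → Fin n := H.orderEmbOfFin rfl
  M.m H.card (fun j => D.bid (i j) ω)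
    (fun j => ipwWeight π (eFirst D L n k ω) H.card (D.X (i j) ω) (D.W (i j) ω)) M.cap

/-- The propensity score `\hat e^k`, estimated on `G_{-k}`. -/
def eHat (n : ℕ) (k : Fin 3) (ω : Ω) : 𝒳 → ℝ :=
  L.eHat n ((D.split n ω).G k) fun i => (D.X i.1 ω, D.W i.1 ω)

/-- The conditional mean `\hat μ^{y,k}_w(x, p)`: the regression of `y(B_i, p)` on `(X_i, W_i)`
on `G_{-k}`. -/
def muYHat (n : ℕ) (k : Fin 3) (ω : Ω) (w : Bool) (x : 𝒳) (p : Vec J) : ℝ :=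
  L.muY n ((D.split n ω).G k) (fun i => (D.X i.1 ω, D.W i.1 ω, M.y (D.bid i.1 ω) p)) w x

/-- The conditional mean `\hat μ^{d,k}_w(x, p)`: the regression of `d(B_i, p)` on `(X_i, W_i)`
on `G_{-k}`. -/
def muDHat (n : ℕ) (k : Fin 3) (ω : Ω) (w : Bool) (x : 𝒳) (p : Vec J) : Vec J :=
  L.muD n ((D.split n ω).G k) (fun i => (D.X i.1 ω, D.W i.1 ω, M.d (D.bid i.1 ω) p)) w x

/-- `\hat e^{k(i)}(X_i)`. -/
def eHatAt (n : ℕ) (ω : Ω) (i : Fin n) : ℝ := eHat D L n (D.split n ω i).1 ω (D.X i ω)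

/-- `\hat μ_w^{y,k(i)}(X_i)`, localized at the first step cutoffs of fold `k(i)`. -/
noncomputable def muYHatAt (π : 𝒳 → ℝ) (n : ℕ) (ω : Ω) (w : Bool) (i : Fin n) : ℝ :=
  muYHat D M L n (D.split n ω i).1 ω w (D.X i ω) (pFirst D M L π n (D.split n ω i).1 ω)

/-- `\hat μ_w^{d,k(i)}(X_i)`, localized at the first step cutoffs of fold `k(i)`. -/
noncomputable def muDHatAt (π : 𝒳 → ℝ) (n : ℕ) (ω : Ω) (w : Bool) (i : Fin n) : Vec J :=
  muDHat D M L n (D.split n ω i).1 ω w (D.X i ω) (pFirst D M L π n (D.split n ω i).1 ω)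

/-- The perturbed capacities `\hat s_π`. -/
noncomputable def capHat (π : 𝒳 → ℝ) (n : ℕ) (ω : Ω) : Vec J :=
  M.cap + (1 / (n : ℝ)) • ∑ i : Fin n,
    ((((if D.W i ω then 1 else 0) / eHatAt D L n ω i - 1) * π (D.X i ω)) •
        muDHatAt D M L π n ω true i
      + ((1 - π (D.X i ω)) * ((if D.W i ω then 0 else 1) / (1 - eHatAt D L n ω i) - 1)) •
        muDHatAt D M L π n ω false i)

/-- The second step cutoffs `\hat P_π = m(B, \hat γ_π, \hat s_π)`, computed on the full sample. -/
noncomputable def pHat (π : 𝒳 → ℝ) (n : ℕ) (ω : Ω) : Vec J :=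
  M.m n (fun i => D.bid i ω)
    (fun i => ipwWeight π (eHat D L n (D.split n ω i).1 ω) n (D.X i ω) (D.W i ω))
    (capHat D M L π n ω)

/-- The estimated score `\hat Γ^y_{w i}(p)`. -/
noncomputable def scoreYHat (π : 𝒳 → ℝ) (n : ℕ) (ω : Ω) (w : Bool) (i : Fin n) (p : Vec J) : ℝ :=
  drScore w (D.W i ω) (eHatAt D L n ω i) (muYHatAt D M L π n ω w i) (M.y (D.bid i ω) p)

/-- The estimated score `\hat Γ^d_{w i}(p)`. -/
noncomputable def scoreDHat (π : 𝒳 → ℝ) (n : ℕ) (ω : Ω) (w : Bool) (i : Fin n) (p : Vec J) :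
    Vec J :=
  drScore w (D.W i ω) (eHatAt D L n ω i) (muDHatAt D M L π n ω w i) (M.d (D.bid i ω) p)

/-- The estimated value `\hat V_n(π)`. -/
noncomputable def valueHat (π : 𝒳 → ℝ) (n : ℕ) (ω : Ω) : ℝ :=
  (1 / (n : ℝ)) * ∑ i : Fin n,
    (π (D.X i ω) * scoreYHat D M L π n ω true i (pHat D M L π n ω)
      + (1 - π (D.X i ω)) * scoreYHat D M L π n ω false i (pHat D M L π n ω))

/-- The estimator `\hat τ = \hat V_n(π_1) - \hat V_n(π_0)`. -/
noncomputable def tauHat (n : ℕ) (ω : Ω) : ℝ :=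
  valueHat D M L (uniformRule 𝒳 true) n ω - valueHat D M L (uniformRule 𝒳 false) n ω

/-- The cutoffs in `S` that solve the estimated doubly-robust market-clearing condition up to an
error `r`. -/
def clearingSetHat (π : 𝒳 → ℝ) (r : ℝ) (n : ℕ) (ω : Ω) : Set (Vec J) :=
  {p | p ∈ M.S ∧ ‖(1 / (n : ℝ)) • ∑ i : Fin n,
    (π (D.X i ω) • scoreDHat D M L π n ω true i p
      + (1 - π (D.X i ω)) • scoreDHat D M L π n ω false i p) - M.cap‖ ≤ r}

end Estimator

section Assumptions

variable {Ω 𝒳 𝓑 : Type*} {J : ℕ} [MeasurableSpace Ω] [MeasurableSpace 𝒳] [MeasurableSpace 𝓑]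

/-- The participants are an i.i.d. sample and the split is independent of it. -/
structure IIDSample (D : Sample Ω 𝒳 𝓑) (P : Measure Ω) : Prop where
  measurable_X : ∀ i, Measurable (D.X i)
  measurable_B : ∀ i w, Measurable (D.B i w)
  measurable_W : ∀ i, Measurable (D.W i)
  measurable_split : ∀ n, Measurable (D.split n)
  indep : iIndepFun D.obs P
  ident : ∀ i, IdentDistrib (D.obs i) (D.obs 0) P P
  indep_split : ∀ n, IndepFun (fun ω i => D.obs i ω) (D.split n) P

/-- The objects of the mechanism are measurable. -/
structure MeasurableMechanism (M : Mechanism 𝓑 J) : Prop where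
  d : Measurable fun q : 𝓑 × Vec J => M.d q.1 q.2
  y : Measurable fun q : 𝓑 × Vec J => M.y q.1 q.2
  m : ∀ n, Measurable fun q : (Fin n → 𝓑) × (Fin n → ℝ) × Vec J => M.m n q.1 q.2.1 q.2.2

/-- The regression algorithms are measurable in the data and the point of evaluation. -/
structure MeasurableLearners (L : Learners 𝒳 J) : Prop where
  eFirst : ∀ (n : ℕ) (H : Finset (Fin n)),
    Measurable fun q : (H → 𝒳 × Bool) × 𝒳 => L.eFirst n H q.1 q.2
  eHat : ∀ (n : ℕ) (G : Finset (Fin n)), Measurable fun q : (G → 𝒳 × Bool) × 𝒳 => L.eHat n G q.1 q.2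
  muY : ∀ (n : ℕ) (G : Finset (Fin n)) (w : Bool),
    Measurable fun q : (G → 𝒳 × Bool × ℝ) × 𝒳 => L.muY n G q.1 w q.2
  muD : ∀ (n : ℕ) (G : Finset (Fin n)) (w : Bool),
    Measurable fun q : (G → 𝒳 × Bool × Vec J) × 𝒳 => L.muD n G q.1 w q.2

/-- The `σ`-algebra generated by the covariates of a participant. -/
abbrev Sample.sigmaX (D : Sample Ω 𝒳 𝓑) : MeasurableSpace Ω :=
  MeasurableSpace.comap (D.X 0) inferInstance

/-- `R` consists of (versions of) the propensity score and the conditional means given the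
covariates. -/
structure IsRegressions (D : Sample Ω 𝒳 𝓑) (M : Mechanism 𝓑 J) (P : Measure Ω)
    (R : Regressions 𝒳 J) : Prop where
  measurable_e : Measurable R.e
  e : (fun ω => R.e (D.X 0 ω)) =ᵐ[P] P⟦{ω | D.W 0 ω = true} | D.sigmaX⟧
  measurable_muY : ∀ w, ∀ p ∈ M.S, Measurable fun x => R.muY w x p
  muY : ∀ w, ∀ p ∈ M.S,
    (fun ω => R.muY w (D.X 0 ω) p) =ᵐ[P] P[fun ω => M.y (D.B 0 w ω) p | D.sigmaX]
  measurable_muD : ∀ w, ∀ p ∈ M.S, Measurable fun x => R.muD w x p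
  muD : ∀ w, ∀ p ∈ M.S,
    (fun ω => R.muD w (D.X 0 ω) p) =ᵐ[P] P[fun ω => M.d (D.B 0 w ω) p | D.sigmaX]

/-- Unconfoundedness, i.e. conditional independence of `(B(0), B(1))` and `W` given `X`, and
overlap. -/
structure Identification (D : Sample Ω 𝒳 𝓑) (P : Measure Ω) (R : Regressions 𝒳 J) : Prop where
  unconfounded : ∀ (A : Set (𝓑 × 𝓑)) (w : Bool), MeasurableSet A →
    P⟦{ω | (D.B 0 false ω, D.B 0 true ω) ∈ A} ∩ {ω | D.W 0 ω = w} | D.sigmaX⟧ =ᵐ[P]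
      fun ω => (P⟦{ω | (D.B 0 false ω, D.B 0 true ω) ∈ A} | D.sigmaX⟧) ω
        * (P⟦{ω | D.W 0 ω = w} | D.sigmaX⟧) ω
  overlap : ∀ x, 0 < R.e x ∧ R.e x < 1

/-- The finite market is approximately cleared by the cutoffs of the mechanism. -/
structure CutoffAssumption (D : Sample Ω 𝒳 𝓑) (M : Mechanism 𝓑 J) (P : Measure Ω) : Prop where
  cap_mem : ∀ j, M.cap j ∈ Set.Icc (0 : ℝ) 1
  cutoff_mem : ∀ n, 0 < n → ∀ (w : Fin n → Bool) (ω : Ω), finiteCutoff D M n w ω ∈ M.S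
  clears : ∃ (a : ℕ → ℝ) (c : ℝ), Tendsto (fun n : ℕ => a n * √n) atTop (𝓝 0) ∧ 0 < c ∧
    ∀ n, 0 < n → ∀ w : Fin n → Bool,
      P {ω | ¬ (clearingSet D M (a n) n w ω).Nonempty} ≤ ENNReal.ofReal (Real.exp (-c * n)) ∧
      ∀ ω, (clearingSet D M (a n) n w ω).Nonempty →
        finiteCutoff D M n w ω ∈ clearingSet D M (a n) n w ω

/-- `Q` is a finite combination of point masses. -/
def FinitelyDiscrete (Q : Measure 𝓑) : Prop :=
  ∃ (s : Finset 𝓑) (a : 𝓑 → ℝ≥0∞), Q = ∑ b ∈ s, a b • Measure.dirac b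

/-- The uniform covering numbers `sup_Q N(ε, F, L_2(Q))` of the function class
`F = {f(·, p) : p ∈ S}` are at most `C (1/ε)^h` for `0 < ε < 1`, where the supremum is over the
finitely discrete probability measures. -/
def UniformCovering (S : Set (Vec J)) (f : 𝓑 → Vec J → ℝ) (C h : ℝ) : Prop :=
  ∀ (Q : Measure 𝓑) [IsProbabilityMeasure Q], FinitelyDiscrete Q →
    ∀ ε : ℝ≥0, 0 < ε → ε < 1 →
      ((Metric.externalCoveringNumber ε
        {g : Lp ℝ 2 Q | ∃ p ∈ S, g =ᵐ[Q] fun b => f b p} : ℕ∞) : ℝ≥0∞)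
        ≤ ENNReal.ofReal (C * (1 / (ε : ℝ)) ^ h)

/-- `f` is twice continuously differentiable on the interior of `S`, with first and second partial
derivatives bounded by `c`. -/
def TwiceSmooth (S : Set (Vec J)) (c : ℝ) (f : Vec J → ℝ) : Prop :=
  ContDiffOn ℝ 2 f (interior S) ∧ ∀ p ∈ interior S,
    (∀ i : Fin J, |fderiv ℝ f p (EuclideanSpace.single i 1)| ≤ c) ∧
    ∀ i j : Fin J, |iteratedFDeriv ℝ 2 f p
      ![EuclideanSpace.single i 1, EuclideanSpace.single j 1]| ≤ c

/-- Regularity of outcomes; `c'` bounds derivatives, `c₃` and `c₄` bound singular values. -/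
structure RegularOutcomes (D : Sample Ω 𝒳 𝓑) (M : Mechanism 𝓑 J) (P : Measure Ω)
    (R : Regressions 𝒳 J) (Rules : Set (𝒳 → ℝ)) (pstar : (𝒳 → ℝ) → Vec J)
    (c' c₃ c₄ : ℝ) : Prop where
  covering : ∃ hd hy C : ℝ, 0 < hd ∧ 0 < hy ∧ 0 < C ∧
    (∀ j, UniformCovering M.S (fun b p => M.d b p j) C hd) ∧ UniformCovering M.S M.y C hy
  bounded : ∃ K : ℝ, ∀ b, ∀ p ∈ M.S, |M.y b p| ≤ K ∧ ∀ j, |M.d b p j| ≤ K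
  weakly_continuous : ∃ l : ℝ, 0 < l ∧ ∀ p ∈ M.S, ∀ p' ∈ M.S, ∀ w,
    (∀ j, ∫ ω, (M.d (D.B 0 w ω) p j - M.d (D.B 0 w ω) p' j) ^ 2 ∂P ≤ l * ‖p - p'‖) ∧
    ∫ ω, (M.y (D.B 0 w ω) p - M.y (D.B 0 w ω) p') ^ 2 ∂P ≤ l * ‖p - p'‖
  smooth : ∀ w x, TwiceSmooth M.S c' (R.muY w x) ∧
    ∀ j, TwiceSmooth M.S c' fun p => R.muD w x p j
  singular : ∀ π ∈ Rules, ∀ j < J,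
    LinearMap.singularValues
      (fderiv ℝ (zPop D M P π) (pstar π) : Vec J →ₗ[ℝ] Vec J) j ∈ Set.Icc c₃ c₄

/-- Regularity of equilibrium: `pstar π` are the unique, interior and well-separated cutoffs that
clear the continuum market. -/
structure RegularEquilibrium (D : Sample Ω 𝒳 𝓑) (M : Mechanism 𝓑 J) (P : Measure Ω)
    (Rules : Set (𝒳 → ℝ)) (pstar : (𝒳 → ℝ) → Vec J) (c' c₃ : ℝ) : Prop where
  compact : IsCompact M.S
  clears : ∀ π ∈ Rules, zPop D M P π (pstar π) = 0
  unique : ∀ π ∈ Rules, ∀ p ∈ M.S, zPop D M P π p = 0 → p = pstar π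
  ball : ∃ c₁ > 0, ∀ π ∈ Rules, Metric.ball (pstar π) c₁ ⊆ M.S
  separated : ∃ c₂ > 0, ∀ π ∈ Rules, ∀ p ∈ M.S,
    c₃ / (2 * J * c') ≤ ‖p - pstar π‖ → c₂ ≤ 2 * ‖zPop D M P π p‖

/-- The error bounds for the first-stage estimates of fold `k`: `L_2` errors are with respect to
an independent test observation, given the training data. -/
def RatesHold (D : Sample Ω 𝒳 𝓑) (M : Mechanism 𝓑 J) (L : Learners 𝒳 J) (P : Measure Ω)
    (R : Regressions 𝒳 J) (pstar : (𝒳 → ℝ) → Vec J) (rmu re rtheta : ℝ)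
    (π : 𝒳 → ℝ) (n : ℕ) (k : Fin 3) (ω : Ω) : Prop :=
  (∀ w, eLpNorm (fun x =>
      √((muYHat D M L n k ω w x (pFirst D M L π n k ω) - R.muY w x (pFirst D M L π n k ω)) ^ 2
        + ‖muDHat D M L n k ω w x (pFirst D M L π n k ω)
            - R.muD w x (pFirst D M L π n k ω)‖ ^ 2)) 2 (P.map (D.X 0)) ≤ ENNReal.ofReal rmu) ∧
  eLpNorm (fun x => eHat D L n k ω x - R.e x) 2 (P.map (D.X 0)) ≤ ENNReal.ofReal re ∧
  ‖pFirst D M L π n k ω - pstar π‖ ≤ rtheta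

/-- The assumptions on nuisance estimation. -/
structure NuisanceAssumption (D : Sample Ω 𝒳 𝓑) (M : Mechanism 𝓑 J) (L : Learners 𝒳 J)
    (P : Measure Ω) (R : Regressions 𝒳 J) (Rules : Set (𝒳 → ℝ)) (pstar : (𝒳 → ℝ) → Vec J) :
    Prop where
  overlap : ∃ κ > 0, ∀ᵐ ω ∂P, ∀ n k, ∀ᵐ x ∂(P.map (D.X 0)),
    eHat D L n k ω x ∈ Set.Ioo κ (1 - κ)
  bounded : ∃ K : ℝ, ∀ᵐ ω ∂P, ∀ n k w x, ∀ p ∈ M.S,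
    |muYHat D M L n k ω w x p| ≤ K ∧ ∀ j, |muDHat D M L n k ω w x p j| ≤ K
  rates : ∃ rmu re rtheta : ℕ → ℝ,
    (∀ n, 0 ≤ rmu n ∧ 0 ≤ re n ∧ 0 ≤ rtheta n) ∧
    Tendsto re atTop (𝓝 0) ∧ Tendsto (fun n => rmu n + rtheta n) atTop (𝓝 0) ∧
    Tendsto (fun n : ℕ => √n * (re n * rmu n)) atTop (𝓝 0) ∧
    Tendsto (fun n : ℕ => √n * (re n * rtheta n)) atTop (𝓝 0) ∧
    ∀ π ∈ Rules, ∀ k, Tendsto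
      (fun n => P {ω | ¬ RatesHold D M L P R pstar (rmu n) (re n) (rtheta n) π n k ω})
      atTop (𝓝 0)
  clears : ∃ rg : ℕ → ℝ, Tendsto (fun n : ℕ => √n * rg n) atTop (𝓝 0) ∧
    ∀ π ∈ Rules, Tendsto
      (fun n => P {ω | pHat D M L π n ω ∉ clearingSetHat D M L π (rg n) n ω}) atTop (𝓝 0)

end Assumptions

end CutoffMarket

/-! Fix uniform treatment `w`. The second-step cutoff `P̂` solves, up to `o(n^{-1/2})`, an estimated
doubly-robust market-clearing equation, and `valueHat` is the doubly-robust mean outcome at `P̂`.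
Both are averages of scores of a scalar response `a`, either `y` or a coordinate of `d`. The core of
the proof is one expansion (`score_expansion`): the average estimated score at `P̂` minus the
average population score at `p*` equals the population increment `E a(B(w), P̂) - E a(B(w), p*)`
plus a small remainder.

By `drScore_sub` the remainder has three sources. The propensity error multiplies a residual with
conditional mean zero. The regression error multiplies a factor whose conditional mean is of the
order of the propensity error, so its bias is a product of two errors. Both are handled by
cross-fitting: given the training data, the sum over a fold is a sum of i.i.d. terms
(`negl_sum_fold`). The third source is the increment of the response from `p*` to `P̂`. Since `P̂`
depends on the whole sample, this needs empirical process theory.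

Stochastic equicontinuity is proved without suprema over cutoffs. Symmetrization is applied directly
to a measurable selected index, and the resulting random-sign sum, with an index that may depend on
the signs, is bounded by a penalized maximal inequality over a finite net (`sum_penalized_le`). The
argument has two passes. A crude bound, with linear growth of excess demand around `p*`, gives `‖P̂
- p*‖ = o_p(n^{-1/4})`. On a ball of radius `n^{-1/4}` weak continuity makes the second moments of
the increments `O(n^{-1/4})`, and the fine bound then gives an `o_p(n^{-1/2})` fluctuation. The
remaining bias is `o(1)` times `‖P̂ - p*‖` and is absorbed, so `P̂` is root-`n` tight.

The functional `ν` is chosen so that `y - ν z` has derivative zero at `p*`. Hence subtracting `ν`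
times the clearing equation from the outcome expansion removes `P̂` to first order
(`negl_linearization`), and leaves the average of the scores `Γ^{*q}`. The difference of the two
arms is an average of i.i.d. square-integrable variables with mean `τ*`; the central limit theorem
and Slutsky's lemma conclude. -/

namespace CutoffMarket

set_option linter.unusedSectionVars false

/-! ### Random signs: a penalized maximal inequality over a finite net. -/

section Signs

variable {ι Θ : Type*} [Fintype ι] [DecidableEq ι]

/-- The sign `±1` encoded by a Boolean. -/
def boolSign (b : Bool) : ℝ := if b then 1 else -1

/-- Hoeffding's bound for Rademacher sums, written as a sum over sign vectors: the exponential
factorizes over coordinates and each factor is `2 cosh x ≤ 2 exp (x² / 2)`. -/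
lemma sum_exp_boolSign_le (v : ι → ℝ) (t : ℝ) :
    ∑ ε : ι → Bool, Real.exp (t * ∑ i, boolSign (ε i) * v i)
      ≤ Fintype.card (ι → Bool) * Real.exp (t ^ 2 / 2 * ∑ i, v i ^ 2) := by
  have h1 : ∀ ε : ι → Bool, Real.exp (t * ∑ i, boolSign (ε i) * v i)
      = ∏ i, Real.exp (t * (boolSign (ε i) * v i)) := fun ε => by
    rw [Finset.mul_sum, Real.exp_sum]
  simp_rw [h1]
  have h2 := (Finset.prod_univ_sum (fun _ : ι => (Finset.univ : Finset Bool))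
    (fun i b => Real.exp (t * (boolSign b * v i)))).symm
  rw [Fintype.piFinset_univ] at h2
  rw [h2]
  have h3 : ∀ i, ∑ b : Bool, Real.exp (t * (boolSign b * v i)) ≤ 2 * Real.exp (t ^ 2 / 2 * v i ^ 2) := by
    intro i
    have := Real.cosh_le_exp_half_sq (t * v i)
    rw [Real.cosh_eq] at this
    simp only [boolSign, Fintype.sum_bool, if_true, Bool.false_eq_true, if_false]
    have e1 : (t * v i) ^ 2 / 2 = t ^ 2 / 2 * v i ^ 2 := by ring
    rw [e1] at this
    have e2 : t * (-1 * v i) = -(t * v i) := by ring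
    rw [e2, one_mul]
    linarith
  refine (Finset.prod_le_prod (fun i _ => Finset.sum_nonneg fun b _ => (Real.exp_pos _).le)
    fun i _ => h3 i).trans_eq ?_
  rw [Finset.prod_mul_distrib, ← Real.exp_sum, ← Finset.mul_sum]
  simp

/-- A penalized maximal inequality for random signs, for a sign-dependent choice `q` of an index,
by means of a finite net. -/
theorem sum_penalized_le (v : Θ → ι → ℝ) (q : (ι → Bool) → Θ) (F : Finset Θ) {M t K η : ℝ}
    (hM : (F.card : ℝ) ≤ M) (ht : 0 < t) (hK0 : 0 ≤ K) (hK : ∀ θ i, |v θ i| ≤ 2 * K)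
    (hF : ∀ θ, ∃ θ' ∈ F, ∑ i, |v θ i - v θ' i| ≤ η) :
    ∑ ε : ι → Bool, (|∑ i, boolSign (ε i) * v (q ε) i| - t / 2 * ∑ i, v (q ε) i ^ 2)
      ≤ Fintype.card (ι → Bool) * (Real.log (2 * M) / t + (1 + 2 * K * t) * η) := by
  classical
  have hF0 : 0 < (F.card : ℝ) := by
    obtain ⟨θ', h, -⟩ := hF (q fun _ => true)
    exact_mod_cast Finset.card_pos.2 ⟨θ', h⟩
  have hM0 : 0 < M := hF0.trans_le hM
  -- Each of at most `M` net points contributes two exponentials of average at most one, so with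
  -- this normalization the last term of `key` averages to at most one and cancels the `-1`.
  set L := 2 * M with hL
  have hL0 : 0 < L := by positivity
  have key : ∀ ε : ι → Bool,
      t * (|∑ i, boolSign (ε i) * v (q ε) i| - t / 2 * ∑ i, v (q ε) i ^ 2)
      ≤ Real.log L - 1 + t * ((1 + 2 * K * t) * η) + L⁻¹ * ∑ θ ∈ F,
        Real.exp (-(t ^ 2 / 2 * ∑ i, v θ i ^ 2)) *
          (Real.exp (t * ∑ i, boolSign (ε i) * v θ i)
            + Real.exp (-t * ∑ i, boolSign (ε i) * v θ i)) := by
    intro ε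
    obtain ⟨θ, hθ, hd⟩ := hF (q ε)
    have a1 : |∑ i, boolSign (ε i) * v (q ε) i| ≤ |∑ i, boolSign (ε i) * v θ i| + η := by
      have : |∑ i, boolSign (ε i) * v (q ε) i - ∑ i, boolSign (ε i) * v θ i| ≤ η := by
        rw [← Finset.sum_sub_distrib]
        refine (Finset.abs_sum_le_sum_abs _ _).trans (le_trans (Finset.sum_le_sum fun i _ => ?_) hd)
        rw [← mul_sub, abs_mul]
        have : |boolSign (ε i)| = 1 := by unfold boolSign; split_ifs <;> simp
        rw [this, one_mul]
      have := (abs_sub_abs_le_abs_sub _ _).trans this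
      linarith
    -- Entries are at most `2K`, so moving to the net point changes the squares by `4Kη`; the
    -- penalty weight `t / 2` turns this into the `2Ktη` of the bound.
    have a2 : ∑ i, v θ i ^ 2 ≤ ∑ i, v (q ε) i ^ 2 + 4 * K * η := by
      have : ∑ i, v θ i ^ 2 - ∑ i, v (q ε) i ^ 2 ≤ ∑ i, 4 * K * |v (q ε) i - v θ i| := by
        rw [← Finset.sum_sub_distrib]
        refine Finset.sum_le_sum fun i _ => ?_
        have b1 := hK θ i
        have b2 := hK (q ε) i
        calc v θ i ^ 2 - v (q ε) i ^ 2 = (v θ i + v (q ε) i) * (v θ i - v (q ε) i) := by ring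
          _ ≤ |v θ i + v (q ε) i| * |v θ i - v (q ε) i| := by
            rw [← abs_mul]; exact le_abs_self _
          _ ≤ 4 * K * |v (q ε) i - v θ i| := by
            rw [abs_sub_comm (v θ i)]
            gcongr
            have := abs_add_le (v θ i) (v (q ε) i)
            linarith
      rw [← Finset.mul_sum] at this
      nlinarith
    have a3 : ∀ s : ℝ, Real.exp (t * |s|) ≤ Real.exp (t * s) + Real.exp (-t * s) := by
      intro s
      rcases abs_cases s with ⟨h, -⟩ | ⟨h, -⟩ <;> rw [h]
      · linarith [Real.exp_pos (-t * s)]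
      · rw [show t * -s = -t * s by ring]; linarith [Real.exp_pos (t * s)]
    set s := ∑ i, boolSign (ε i) * v θ i
    set V := ∑ i, v θ i ^ 2
    -- The inequality `x + 1 ≤ exp x`, shifted by `log L`. The exponential at the nearby net point
    -- is then dominated by the sum over the net, which no longer involves the sign-dependent choice
    -- `q ε`.
    have a4 : t * |s| - t ^ 2 / 2 * V ≤ Real.log L - 1 + L⁻¹ * (Real.exp (-(t ^ 2 / 2 * V)) *
        (Real.exp (t * s) + Real.exp (-t * s))) := by
      have := Real.add_one_le_exp (t * |s| - t ^ 2 / 2 * V - Real.log L)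
      have e : Real.exp (t * |s| - t ^ 2 / 2 * V - Real.log L)
          = L⁻¹ * (Real.exp (t * |s|) * Real.exp (-(t ^ 2 / 2 * V))) := by
        rw [Real.exp_sub, Real.exp_log hL0, div_eq_inv_mul, ← Real.exp_add, sub_eq_add_neg]
      rw [e] at this
      have h5 : L⁻¹ * (Real.exp (t * |s|) * Real.exp (-(t ^ 2 / 2 * V)))
        ≤ L⁻¹ * ((Real.exp (t * s) + Real.exp (-t * s)) * Real.exp (-(t ^ 2 / 2 * V))) := by
        gcongr; exact a3 s
      rw [mul_comm (Real.exp (-(t ^ 2 / 2 * V)))]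
      linarith
    have a5 := Finset.single_le_sum (f := fun θ => Real.exp (-(t ^ 2 / 2 * ∑ i, v θ i ^ 2)) *
          (Real.exp (t * ∑ i, boolSign (ε i) * v θ i)
            + Real.exp (-t * ∑ i, boolSign (ε i) * v θ i))) (fun θ _ => by positivity) hθ
    have a6 := mul_le_mul_of_nonneg_left a5 (inv_nonneg.2 hL0.le)
    have a7 : t * (|∑ i, boolSign (ε i) * v (q ε) i| - t / 2 * ∑ i, v (q ε) i ^ 2)
        ≤ t * |s| - t ^ 2 / 2 * V + t * ((1 + 2 * K * t) * η) := by
      nlinarith [mul_le_mul_of_nonneg_left a1 ht.le, mul_le_mul_of_nonneg_left a2 (sq_nonneg t)]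
    exact a7.trans (by linarith)
  have hsum := Finset.sum_le_sum fun ε (_ : ε ∈ (Finset.univ : Finset (ι → Bool))) => key ε
  rw [← Finset.mul_sum, Finset.sum_add_distrib, ← Finset.mul_sum, Finset.sum_comm] at hsum
  set N : ℝ := ((Fintype.card (ι → Bool) : ℕ) : ℝ) with hN
  have hexp : ∑ θ ∈ F, ∑ ε : ι → Bool, Real.exp (-(t ^ 2 / 2 * ∑ i, v θ i ^ 2)) *
          (Real.exp (t * ∑ i, boolSign (ε i) * v θ i)
            + Real.exp (-t * ∑ i, boolSign (ε i) * v θ i)) ≤ F.card * (2 * N) := by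
    rw [← nsmul_eq_mul]
    refine Finset.sum_le_card_nsmul _ _ _ fun θ _ => ?_
    rw [← Finset.mul_sum, Finset.sum_add_distrib]
    have b1 := sum_exp_boolSign_le (v θ) t
    have b2 := sum_exp_boolSign_le (v θ) (-t)
    rw [neg_sq] at b2
    have b3 : Real.exp (-(t ^ 2 / 2 * ∑ i, v θ i ^ 2)) * Real.exp (t ^ 2 / 2 * ∑ i, v θ i ^ 2) = 1 := by
      rw [← Real.exp_add]; simp
    calc _ ≤ Real.exp (-(t ^ 2 / 2 * ∑ i, v θ i ^ 2)) *
          (N * Real.exp (t ^ 2 / 2 * ∑ i, v θ i ^ 2) + N * Real.exp (t ^ 2 / 2 * ∑ i, v θ i ^ 2)) := by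
          gcongr
      _ = 2 * N * (Real.exp (-(t ^ 2 / 2 * ∑ i, v θ i ^ 2)) * Real.exp (t ^ 2 / 2 * ∑ i, v θ i ^ 2)) := by
          ring
      _ = 2 * N := by rw [b3, mul_one]
  have hN0 : 0 ≤ N := by positivity
  have h8 : L⁻¹ * (F.card * (2 * N)) ≤ N := by
    rw [inv_mul_le_iff₀ hL0, hL]
    nlinarith
  have h9 := (mul_le_mul_of_nonneg_left hexp (inv_nonneg.2 hL0.le)).trans h8
  simp only [Finset.sum_const, Finset.card_univ, nsmul_eq_mul] at hsum
  have : t * ∑ ε : ι → Bool, (|∑ i, boolSign (ε i) * v (q ε) i| - t / 2 * ∑ i, v (q ε) i ^ 2)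
      ≤ t * (N * (Real.log L / t + (1 + 2 * K * t) * η)) := by
    have : t * (N * (Real.log L / t + (1 + 2 * K * t) * η))
      = N * Real.log L + N * (t * ((1 + 2 * K * t) * η)) := by field_simp
    rw [this]
    rw [← hN] at hsum
    linarith
  exact le_of_mul_le_mul_left this ht

end Signs

/-! ### Exchanging and resampling coordinates of a product measure. -/

section Product

variable {ι 𝒪 : Type*} [Fintype ι] [MeasurableSpace 𝒪] (μ : Measure 𝒪) [IsProbabilityMeasure μ]

/-- Exchange the coordinates with `ε i = false` of two points of a power. -/
def exchange (ε : ι → Bool) (z : (ι → 𝒪) × (ι → 𝒪)) : (ι → 𝒪) × (ι → 𝒪) :=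
  (fun i => if ε i then z.1 i else z.2 i, fun i => if ε i then z.2 i else z.1 i)

/-- Seen as a family of pairs, a point undergoes the identity or a swap in each pair, and both
preserve `μ × μ`. -/
lemma measurePreserving_exchange (ε : ι → Bool) :
    MeasurePreserving (exchange ε) ((Measure.pi fun _ : ι => μ).prod (Measure.pi fun _ : ι => μ))
      ((Measure.pi fun _ : ι => μ).prod (Measure.pi fun _ : ι => μ)) := by
  have he := measurePreserving_arrowProdEquivProdArrow 𝒪 𝒪 ι (fun _ => μ) (fun _ => μ)
  have hs : MeasurePreserving (fun (z : ι → 𝒪 × 𝒪) i => (if ε i then id else Prod.swap) (z i))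
      (Measure.pi fun _ : ι => μ.prod μ) (Measure.pi fun _ : ι => μ.prod μ) := by
    refine measurePreserving_pi _ _ fun i => ?_
    by_cases h : ε i
    · simpa [h] using MeasurePreserving.id _
    · simpa [h] using Measure.measurePreserving_swap
  have := (he.comp hs).comp he.symm
  convert this using 1
  ext z i <;> by_cases h : ε i <;>
    simp [exchange, h, MeasurableEquiv.arrowProdEquivProdArrow, Equiv.arrowProdEquivProdArrow]

/-- The point with coordinates `x` on `I` and `y` elsewhere. -/
def merge [DecidableEq ι] (I : Finset ι) (x y : ι → 𝒪) : ι → 𝒪 := fun i => if i ∈ I then x i else y i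

lemma measurable_merge [DecidableEq ι] (I : Finset ι) :
    Measurable fun z : (ι → 𝒪) × (ι → 𝒪) => merge I z.1 z.2 := by
  refine measurable_pi_lambda _ fun i => ?_
  by_cases h : i ∈ I <;> simp only [merge, h, if_true, if_false] <;> fun_prop

lemma measurePreserving_merge [DecidableEq ι] (I : Finset ι) :
    MeasurePreserving (fun z : (ι → 𝒪) × (ι → 𝒪) => merge I z.1 z.2)
      ((Measure.pi fun _ : ι => μ).prod (Measure.pi fun _ : ι => μ)) (Measure.pi fun _ : ι => μ) := by
  have := measurePreserving_fst.comp (measurePreserving_exchange μ (fun i => decide (i ∈ I)))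
  convert this using 1
  ext z i
  simp [merge, exchange]

/-- Resampling the coordinates in `I` does not change the law. The inner integral on the right
conditions on the coordinates outside `I`; this is the form in which cross-fitting conditions on
training data. -/
lemma lintegral_merge [DecidableEq ι] (I : Finset ι) {f : (ι → 𝒪) → ℝ≥0∞} (hf : Measurable f) :
    ∫⁻ O, f O ∂(Measure.pi fun _ : ι => μ)
      = ∫⁻ O, ∫⁻ O', f (merge I O' O) ∂(Measure.pi fun _ : ι => μ) ∂(Measure.pi fun _ : ι => μ) := by
  rw [← (measurePreserving_merge μ I).lintegral_comp hf]
  exact lintegral_prod_symm (fun z => f (merge I z.1 z.2)) (hf.comp (measurable_merge I)).aemeasurable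

/-- A random variable that depends on the coordinates outside of `I` only. -/
def InvariantOn {β : Type*} (I : Finset ι) (f : (ι → 𝒪) → β) : Prop :=
  ∀ O O', (∀ i ∉ I, O i = O' i) → f O = f O'

lemma InvariantOn.merge_eq [DecidableEq ι] {β : Type*} {I : Finset ι} {f : (ι → 𝒪) → β}
    (hf : InvariantOn I f) (O' O : ι → 𝒪) : f (merge I O' O) = f O :=
  hf _ _ fun i hi => by simp [merge, hi]

/-- Since `F` does not see the coordinate `i`, that coordinate acts as a fresh test observation. -/
lemma lintegral_eval_of_invariantOn {i : ι} {I : Finset ι} (hi : i ∈ I)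
    {F : (ι → 𝒪) → 𝒪 → ℝ≥0∞} (hF : Measurable fun z : (ι → 𝒪) × 𝒪 => F z.1 z.2)
    (hI : InvariantOn I F) :
    ∫⁻ O, F O (O i) ∂(Measure.pi fun _ : ι => μ)
      = ∫⁻ O, ∫⁻ o, F O o ∂μ ∂(Measure.pi fun _ : ι => μ) := by
  classical
  rw [lintegral_merge μ I (f := fun O => F O (O i))
    (hF.comp (measurable_id.prodMk (measurable_pi_apply i)))]
  refine lintegral_congr fun O => ?_
  have h1 : ∀ O', F (merge I O' O) (merge I O' O i) = F O (O' i) := fun O' => by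
    rw [hI.merge_eq]; simp [merge, hi]
  simp_rw [h1]
  exact (measurePreserving_eval (fun _ : ι => μ) i).lintegral_comp
    (f := F O) (hF.comp (measurable_const.prodMk measurable_id))

/-- The second moment of a centred sum of independent copies. -/
lemma lintegral_sq_sum_le (I : Finset ι) {g : 𝒪 → ℝ} (hg : Measurable g) {b : ℝ} (hb : 0 ≤ b)
    (hgb : ∫⁻ o, ENNReal.ofReal (g o ^ 2) ∂μ ≤ ENNReal.ofReal b) :
    ∫⁻ O, ENNReal.ofReal ((∑ i ∈ I, (g (O i) - ∫ o, g o ∂μ)) ^ 2) ∂(Measure.pi fun _ : ι => μ)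
      ≤ ENNReal.ofReal (I.card * b) := by
  have hL : MemLp g 2 μ := by
    refine ⟨hg.aestronglyMeasurable, ?_⟩
    rw [eLpNorm_lt_top_iff_lintegral_rpow_enorm_lt_top (by norm_num) (by norm_num)]
    refine lt_of_le_of_lt ?_ (hgb.trans_lt ENNReal.ofReal_lt_top)
    refine lintegral_mono fun o => le_of_eq ?_
    simp only [ENNReal.toReal_ofNat, ENNReal.rpow_ofNat]
    rw [← enorm_pow, Real.enorm_of_nonneg (sq_nonneg _)]
  have hLi : ∀ i : ι, MemLp (fun O : ι → 𝒪 => g (O i)) 2 (Measure.pi fun _ : ι => μ) := fun i =>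
    hL.comp_measurePreserving (measurePreserving_eval (fun _ : ι => μ) i)
  have hm : ∀ i : ι, ∫ O : ι → 𝒪, g (O i) ∂(Measure.pi fun _ : ι => μ) = ∫ o, g o ∂μ := fun i =>
    (integral_map (measurePreserving_eval (fun _ : ι => μ) i).measurable.aemeasurable
      (by rw [(measurePreserving_eval (fun _ : ι => μ) i).map_eq]; exact hg.aestronglyMeasurable)).symm.trans
      (by rw [(measurePreserving_eval (fun _ : ι => μ) i).map_eq])
  have hmean : ∫ O : ι → 𝒪, ∑ i ∈ I, g (O i) ∂(Measure.pi fun _ : ι => μ) = ∑ i ∈ I, ∫ o, g o ∂μ := by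
    rw [integral_finsetSum _ fun i _ => (hLi i).integrable (by norm_num)]
    simp_rw [hm]
  have hsum : MemLp (fun O : ι → 𝒪 => ∑ i ∈ I, g (O i)) 2 (Measure.pi fun _ : ι => μ) :=
    memLp_finsetSum _ fun i _ => hLi i
  have hev := evariance_eq_lintegral_ofReal (fun O : ι → 𝒪 => ∑ i ∈ I, g (O i)) (Measure.pi fun _ : ι => μ)
  rw [hmean] at hev
  simp_rw [Finset.sum_sub_distrib]
  rw [← hev, ← ofReal_variance hsum]
  refine ENNReal.ofReal_le_ofReal ?_
  have hv : Var[fun O : ι → 𝒪 => ∑ i ∈ I, g (O i); Measure.pi fun _ : ι => μ]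
      = ∑ i ∈ I, Var[fun O : ι → 𝒪 => g (O i); Measure.pi fun _ : ι => μ] := by
    have := IndepFun.variance_sum (μ := Measure.pi fun _ : ι => μ) (s := I)
      (X := fun i (O : ι → 𝒪) => g (O i)) (fun i _ => hLi i) fun i _ j _ hij =>
        (iIndepFun_pi (μ := fun _ : ι => μ) (X := fun _ => g) fun _ => hg.aemeasurable).indepFun hij
    rw [← this]; congr 1; ext O; simp
  rw [hv, ← nsmul_eq_mul]
  refine Finset.sum_le_card_nsmul _ _ _ fun i _ => ?_
  refine (variance_le_expectation_sq (hLi i).1).trans ?_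
  have : ∫ O : ι → 𝒪, (g (O i)) ^ 2 ∂(Measure.pi fun _ : ι => μ) = ∫ o, g o ^ 2 ∂μ :=
    (integral_map (measurePreserving_eval (fun _ : ι => μ) i).measurable.aemeasurable
      (f := fun o => g o ^ 2) (by rw [(measurePreserving_eval (fun _ : ι => μ) i).map_eq]
                                  exact (hg.pow_const 2).aestronglyMeasurable)).symm.trans
      (by rw [(measurePreserving_eval (fun _ : ι => μ) i).map_eq])
  simp only [Pi.pow_apply]
  rw [this, integral_eq_lintegral_of_nonneg_ae (ae_of_all _ fun o => sq_nonneg _)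
    (hg.pow_const 2).aestronglyMeasurable]
  exact ENNReal.toReal_le_of_le_ofReal hb hgb

/-- The second moment of a centred sum over `I` of a function that is fitted outside of `I`. -/
theorem lintegral_sq_sum_invariantOn_le {I : Finset ι}
    {ψ : (ι → 𝒪) → 𝒪 → ℝ} (hψ : Measurable fun z : (ι → 𝒪) × 𝒪 => ψ z.1 z.2)
    (hI : InvariantOn I ψ) {b : ℝ} (hb : 0 ≤ b)
    (hψb : ∀ O, ∫⁻ o, ENNReal.ofReal (ψ O o ^ 2) ∂μ ≤ ENNReal.ofReal b) :
    ∫⁻ O, ENNReal.ofReal ((∑ i ∈ I, (ψ O (O i) - ∫ o, ψ O o ∂μ)) ^ 2) ∂(Measure.pi fun _ : ι => μ)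
      ≤ ENNReal.ofReal (I.card * b) := by
  classical
  have hint : Measurable fun O : ι → 𝒪 => ∫ o, ψ O o ∂μ :=
    (hψ.stronglyMeasurable.integral_prod_right' (ν := μ)).measurable
  rw [lintegral_merge μ I]
  · refine (lintegral_mono (g := fun _ => ENNReal.ofReal (I.card * b)) fun O => ?_).trans (by simp)
    -- With the coordinates outside `I` frozen at `O`, the function `ψ O` is fixed and the summands
    -- are i.i.d. in `O'`.
    have h1 : ∀ O', ∑ i ∈ I, (ψ (merge I O' O) (merge I O' O i) - ∫ o, ψ (merge I O' O) o ∂μ)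
        = ∑ i ∈ I, (ψ O (O' i) - ∫ o, ψ O o ∂μ) := fun O' => by
      refine Finset.sum_congr rfl fun i hi => ?_
      rw [hI.merge_eq]; simp [merge, hi]
    simp_rw [h1]
    exact lintegral_sq_sum_le μ I (hψ.comp (measurable_const.prodMk measurable_id)) hb (hψb O)
  · refine ENNReal.measurable_ofReal.comp (Measurable.pow_const (Finset.measurable_fun_sum _ fun i _ => ?_) 2)
    exact (hψ.comp (measurable_id.prodMk (measurable_pi_apply i))).sub hint

end Product

/-! ### Maximal inequalities for a data-dependent index, by symmetrization. -/

section Selection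

variable {ι 𝒪 Θ : Type*} [Fintype ι] [MeasurableSpace 𝒪] [MeasurableSpace Θ]
  (μ : Measure 𝒪) [IsProbabilityMeasure μ]

/-- On every pair of samples the functions `φ i θ` have a finite net of at most `M` indices with
total error `η`. -/
def HasEmpiricalNet (φ : ι → Θ → 𝒪 → ℝ) (M η : ℝ) : Prop :=
  ∀ x x' : ι → 𝒪, ∃ F : Finset Θ, (F.card : ℝ) ≤ M ∧ ∀ θ, ∃ θ' ∈ F,
    ∑ i, (|φ i θ (x i) - φ i θ' (x i)| + |φ i θ (x' i) - φ i θ' (x' i)|) ≤ η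

/-- Squaring is `2K`-Lipschitz on `[-K, K]`, so the same net serves the squares. They enter through
the empirical second moment in `integral_abs_selSum_le_fine`. -/
lemma HasEmpiricalNet.sq {φ : ι → Θ → 𝒪 → ℝ} {M η K : ℝ} (h : HasEmpiricalNet φ M η) (hK0 : 0 ≤ K)
    (hK : ∀ i θ o, |φ i θ o| ≤ K) : HasEmpiricalNet (fun i θ o => φ i θ o ^ 2) M (2 * K * η) := by
  intro x x'
  obtain ⟨F, hF, h⟩ := h x x'
  refine ⟨F, hF, fun θ => ?_⟩
  obtain ⟨θ', hθ', h⟩ := h θ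
  refine ⟨θ', hθ', le_trans ?_ (mul_le_mul_of_nonneg_left h (by positivity))⟩
  have key : ∀ i o, |φ i θ o ^ 2 - φ i θ' o ^ 2| ≤ 2 * K * |φ i θ o - φ i θ' o| := fun i o => by
    rw [sq_sub_sq, abs_mul]
    gcongr
    exact (abs_add_le _ _).trans (by linarith [hK i θ o, hK i θ' o])
  rw [Finset.mul_sum]
  refine Finset.sum_le_sum fun i _ => ?_
  rw [mul_add]
  exact add_le_add (key _ _) (key _ _)

/-- The difference of a selected function between a sample and an independent copy. -/
def selDiff (φ : ι → Θ → 𝒪 → ℝ) (q : (ι → 𝒪) → Θ) (i : ι) (z : (ι → 𝒪) × (ι → 𝒪)) : ℝ :=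
  φ i (q z.1) (z.1 i) - φ i (q z.1) (z.2 i)

variable {φ : ι → Θ → 𝒪 → ℝ} {q : (ι → 𝒪) → Θ} {M η K t : ℝ}

lemma abs_selDiff_le (hK : ∀ i θ o, |φ i θ o| ≤ K) (i : ι) (z : (ι → 𝒪) × (ι → 𝒪)) :
    |selDiff φ q i z| ≤ 2 * K :=
  (abs_sub _ _).trans (by linarith [hK i (q z.1) (z.1 i), hK i (q z.1) (z.2 i)])

lemma measurable_selDiff (hφ : ∀ i, Measurable fun z : Θ × 𝒪 => φ i z.1 z.2) (hq : Measurable q)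
    (i : ι) : Measurable (selDiff φ q i) := by
  refine Measurable.sub ?_ ?_
  · exact (hφ i).comp ((hq.comp measurable_fst).prodMk
      ((measurable_pi_apply i).comp measurable_fst))
  · exact (hφ i).comp ((hq.comp measurable_fst).prodMk
      ((measurable_pi_apply i).comp measurable_snd))

/-- The law of a pair of samples is invariant under every exchange, so the integrand may be averaged
over all exchanges. For a fixed pair this is an average over signs in which the selected index
varies with the signs, the situation of `sum_penalized_le`. -/
theorem integral_penalized_selDiff_le (hφ : ∀ i, Measurable fun z : Θ × 𝒪 => φ i z.1 z.2)
    (hq : Measurable q) (hK0 : 0 ≤ K) (hK : ∀ i θ o, |φ i θ o| ≤ K) (ht : 0 < t)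
    (hN : HasEmpiricalNet φ M η) :
    ∫ z, (|∑ i, selDiff φ q i z| - t / 2 * ∑ i, selDiff φ q i z ^ 2)
      ∂((Measure.pi fun _ : ι => μ).prod (Measure.pi fun _ : ι => μ))
      ≤ Real.log (2 * M) / t + (1 + 2 * K * t) * η := by
  classical
  set Q := (Measure.pi fun _ : ι => μ).prod (Measure.pi fun _ : ι => μ)
  set f : (ι → 𝒪) × (ι → 𝒪) → ℝ := fun z =>
    |∑ i, selDiff φ q i z| - t / 2 * ∑ i, selDiff φ q i z ^ 2 with hf
  have hfm : Measurable f :=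
    (continuous_abs.measurable.comp (Finset.measurable_fun_sum _ fun i _ =>
      measurable_selDiff hφ hq i)).sub
      ((Finset.measurable_fun_sum _ fun i _ => (measurable_selDiff hφ hq i).pow_const 2).const_mul _)
  have hfb : ∀ z, ‖f z‖ ≤ ∑ _i : ι, 2 * K + t / 2 * ∑ _i : ι, (2 * K) ^ 2 := by
    intro z
    refine (norm_sub_le _ _).trans (add_le_add ?_ ?_)
    · rw [Real.norm_eq_abs, abs_abs]
      exact (Finset.abs_sum_le_sum_abs _ _).trans
        (Finset.sum_le_sum fun i _ => abs_selDiff_le hK i z)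
    · rw [Real.norm_eq_abs, abs_of_nonneg (by positivity)]
      refine mul_le_mul_of_nonneg_left (Finset.sum_le_sum fun i _ => ?_) (by positivity)
      exact sq_le_sq' (neg_le_of_abs_le (abs_selDiff_le hK i z))
        (le_of_abs_le (abs_selDiff_le hK i z))
  have hint : ∀ ε, Integrable (fun z => f (exchange ε z)) Q := fun ε =>
    Integrable.of_bound (hfm.comp (measurePreserving_exchange μ ε).measurable).aestronglyMeasurable _
      (ae_of_all _ fun z => hfb _)
  have hinv : ∀ ε, ∫ z, f (exchange ε z) ∂Q = ∫ z, f z ∂Q := fun ε => by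
    have h : MeasurePreserving (exchange ε) Q Q := measurePreserving_exchange μ ε
    conv_rhs => rw [← h.map_eq]
    exact (integral_map h.measurable.aemeasurable (by rw [h.map_eq]; exact hfm.aestronglyMeasurable)).symm
  have hpt : ∀ z, ∑ ε : ι → Bool, f (exchange ε z)
      ≤ Fintype.card (ι → Bool) * (Real.log (2 * M) / t + (1 + 2 * K * t) * η) := by
    intro z
    obtain ⟨F, hF, hd⟩ := hN z.1 z.2
    have := sum_penalized_le (fun θ i => φ i θ (z.1 i) - φ i θ (z.2 i))
      (fun ε => q (exchange ε z).1) F hF ht hK0 (η := η)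
      (fun θ i => (abs_sub _ _).trans (by linarith [hK i θ (z.1 i), hK i θ (z.2 i)]))
      (fun θ => by
        obtain ⟨θ', hθ', h⟩ := hd θ
        refine ⟨θ', hθ', le_trans (Finset.sum_le_sum fun i _ => ?_) h⟩
        rw [show φ i θ (z.1 i) - φ i θ (z.2 i) - (φ i θ' (z.1 i) - φ i θ' (z.2 i))
          = (φ i θ (z.1 i) - φ i θ' (z.1 i)) - (φ i θ (z.2 i) - φ i θ' (z.2 i)) by ring]
        exact abs_sub _ _)
    refine le_trans (le_of_eq (Finset.sum_congr rfl fun ε _ => ?_)) this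
    -- An exchange flips the sign of the `i`-th difference and also recomputes the index from the
    -- exchanged first sample.
    have hs : ∀ i, selDiff φ q i (exchange ε z) = boolSign (ε i) *
        (φ i (q (exchange ε z).1) (z.1 i) - φ i (q (exchange ε z).1) (z.2 i)) := by
      intro i
      unfold selDiff boolSign
      by_cases h : ε i <;> simp [exchange, h]
    have hs2 : ∀ i, selDiff φ q i (exchange ε z) ^ 2 =
        (φ i (q (exchange ε z).1) (z.1 i) - φ i (q (exchange ε z).1) (z.2 i)) ^ 2 := by
      intro i
      rw [hs, mul_pow]
      have : boolSign (ε i) ^ 2 = 1 := by unfold boolSign; split_ifs <;> norm_num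
      rw [this, one_mul]
    simp only [hf, hs2]
    simp only [hs]
  have h1 : ∫ z, ∑ ε : ι → Bool, f (exchange ε z) ∂Q
      = Fintype.card (ι → Bool) * ∫ z, f z ∂Q := by
    rw [integral_finsetSum _ fun ε _ => hint ε]
    simp_rw [hinv]
    simp
  have h2 : ∫ z, ∑ ε : ι → Bool, f (exchange ε z) ∂Q
      ≤ Fintype.card (ι → Bool) * (Real.log (2 * M) / t + (1 + 2 * K * t) * η) := by
    refine (integral_mono (integrable_finsetSum _ fun ε _ => hint ε) (integrable_const _) hpt).trans ?_
    simp
  rw [h1] at h2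
  exact le_of_mul_le_mul_left h2 (by positivity)

/-- The centred sum of the selected functions. -/
noncomputable def selSum (φ : ι → Θ → 𝒪 → ℝ) (q : (ι → 𝒪) → Θ) (O : ι → 𝒪) : ℝ :=
  ∑ i, (φ i (q O) (O i) - ∫ o, φ i (q O) o ∂μ)

lemma measurable_selSum (hφ : ∀ i, Measurable fun z : Θ × 𝒪 => φ i z.1 z.2) (hq : Measurable q) :
    Measurable (selSum μ φ q) := by
  refine Finset.measurable_fun_sum _ fun i _ => Measurable.sub ?_ ?_
  · exact (hφ i).comp (hq.prodMk (measurable_pi_apply i))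
  · exact ((hφ i).stronglyMeasurable.integral_prod_right' (ν := μ)).measurable.comp hq

lemma integral_pi_eval (i : ι) {g : 𝒪 → ℝ} (hg : Measurable g) :
    ∫ O, g (O i) ∂(Measure.pi fun _ : ι => μ) = ∫ o, g o ∂μ := by
  have h := measurePreserving_eval (fun _ : ι => μ) i
  conv_rhs => rw [← h.map_eq]
  exact (integral_map h.measurable.aemeasurable (by rw [h.map_eq]; exact hg.aestronglyMeasurable)).symm

lemma integrable_selDiff (hφ : ∀ i, Measurable fun z : Θ × 𝒪 => φ i z.1 z.2)
    (hq : Measurable q) (hK : ∀ i θ o, |φ i θ o| ≤ K) (i : ι) :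
    Integrable (selDiff φ q i) ((Measure.pi fun _ : ι => μ).prod (Measure.pi fun _ : ι => μ)) :=
  Integrable.of_bound (measurable_selDiff hφ hq i).aestronglyMeasurable (2 * K)
    (ae_of_all _ fun z => abs_selDiff_le hK i z)

/-- Ghost sample: with the first sample fixed, so is the index, and `selSum` is the mean of the
differences over the second sample. The absolute value of a mean is at most the mean of the absolute
values. -/
lemma integral_abs_selSum_le (hφ : ∀ i, Measurable fun z : Θ × 𝒪 => φ i z.1 z.2)
    (hq : Measurable q) (hK : ∀ i θ o, |φ i θ o| ≤ K) :
    ∫ O, |selSum μ φ q O| ∂(Measure.pi fun _ : ι => μ)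
      ≤ ∫ z, |∑ i, selDiff φ q i z|
        ∂((Measure.pi fun _ : ι => μ).prod (Measure.pi fun _ : ι => μ)) := by
  have hi := integrable_selDiff μ hφ hq hK
  have hs : Integrable (fun z => ∑ i, selDiff φ q i z)
    ((Measure.pi fun _ : ι => μ).prod (Measure.pi fun _ : ι => μ)) := integrable_finsetSum _ fun i _ => hi i
  rw [integral_prod _ hs.abs]
  have hφi : ∀ i θ, Measurable (φ i θ) := fun i θ => (hφ i).comp (measurable_const.prodMk measurable_id)
  have hφint : ∀ i θ j, Integrable (fun O' : ι → 𝒪 => φ i θ (O' j)) (Measure.pi fun _ : ι => μ) :=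
    fun i θ j => Integrable.of_bound ((hφi i θ).comp (measurable_pi_apply j)).aestronglyMeasurable K
      (ae_of_all _ fun o => hK _ _ _)
  have hpt : ∀ O, |selSum μ φ q O| ≤ ∫ O', |∑ i, selDiff φ q i (O, O')| ∂(Measure.pi fun _ : ι => μ) := by
    intro O
    have : selSum μ φ q O = ∫ O', ∑ i, selDiff φ q i (O, O') ∂(Measure.pi fun _ : ι => μ) := by
      have hd : ∀ i, Integrable (fun O' => selDiff φ q i (O, O')) (Measure.pi fun _ : ι => μ) :=
        fun i => (integrable_const (φ i (q O) (O i))).sub (hφint i (q O) i)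
      rw [integral_finsetSum _ fun i _ => hd i]
      refine Finset.sum_congr rfl fun i _ => ?_
      simp only [selDiff]
      rw [integral_sub (integrable_const _) (hφint i _ i), integral_pi_eval μ i (hφi i _)]
      simp
    rw [this]
    exact abs_integral_le_integral_abs
  have hb : ∀ O, |selSum μ φ q O| ≤ ∑ _i : ι, 2 * K := fun O => by
    refine (Finset.abs_sum_le_sum_abs _ _).trans (Finset.sum_le_sum fun i _ => ?_)
    refine (abs_sub _ _).trans ?_
    have h1 := hK i (q O) (O i)
    have h2 : |∫ o, φ i (q O) o ∂μ| ≤ K := by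
      have := norm_integral_le_of_norm_le_const (μ := μ) (f := fun o => φ i (q O) o) (C := K)
        (ae_of_all _ fun o => hK i (q O) o)
      simpa using this
    linarith
  refine integral_mono ?_ hs.abs.integral_prod_left hpt
  exact (Integrable.of_bound (measurable_selSum μ hφ hq).aestronglyMeasurable _
    (ae_of_all _ hb)).abs

/-- A maximal inequality for a selected function, by symmetrization. -/
theorem integral_abs_selSum_le_crude (hφ : ∀ i, Measurable fun z : Θ × 𝒪 => φ i z.1 z.2)
    (hq : Measurable q) (hK0 : 0 ≤ K) (hK : ∀ i θ o, |φ i θ o| ≤ K) (ht : 0 < t)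
    (hN : HasEmpiricalNet φ M η) :
    ∫ O, |selSum μ φ q O| ∂(Measure.pi fun _ : ι => μ)
      ≤ Real.log (2 * M) / t + (1 + 2 * K * t) * η + 2 * t * K ^ 2 * Fintype.card ι := by
  have h1 := integral_abs_selSum_le μ hφ hq hK
  have h2 := integral_penalized_selDiff_le μ hφ hq hK0 hK ht hN
  set Q := (Measure.pi fun _ : ι => μ).prod (Measure.pi fun _ : ι => μ)
  have hi := integrable_selDiff μ hφ hq hK
  have hs : Integrable (fun z => ∑ i, selDiff φ q i z) Q := integrable_finsetSum _ fun i _ => hi i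
  have hsq : Integrable (fun z => ∑ i, selDiff φ q i z ^ 2) Q :=
    integrable_finsetSum _ fun i _ => Integrable.of_bound
      ((measurable_selDiff hφ hq i).pow_const 2).aestronglyMeasurable ((2 * K) ^ 2)
      (ae_of_all _ fun z => by
        rw [norm_pow]; exact pow_le_pow_left₀ (norm_nonneg _) (abs_selDiff_le hK i z) 2)
  rw [integral_sub hs.abs (hsq.const_mul _), integral_const_mul] at h2
  -- The penalty is paid back using only that each difference is at most `2K`.
  have h3 : ∫ z, ∑ i, selDiff φ q i z ^ 2 ∂Q ≤ 4 * K ^ 2 * Fintype.card ι := by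
    refine (integral_mono hsq (integrable_const (4 * K ^ 2 * Fintype.card ι)) fun z => ?_).trans (by simp)
    refine (Finset.sum_le_sum (g := fun _ => (2 * K) ^ 2) fun i _ => ?_).trans ?_
    · rw [← sq_abs]; exact pow_le_pow_left₀ (abs_nonneg _) (abs_selDiff_le hK i z) 2
    · simp; nlinarith
  nlinarith

/-- A maximal inequality for a selected function with small second moment. -/
theorem integral_abs_selSum_le_fine {t' δ : ℝ} (hφ : ∀ i, Measurable fun z : Θ × 𝒪 => φ i z.1 z.2)
    (hq : Measurable q) (hK0 : 0 ≤ K) (hK : ∀ i θ o, |φ i θ o| ≤ K) (ht : 0 < t) (ht' : 0 < t')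
    (hN : HasEmpiricalNet φ M η) (hδ : ∀ i θ, ∫ o, φ i θ o ^ 2 ∂μ ≤ δ) :
    ∫ O, |selSum μ φ q O| ∂(Measure.pi fun _ : ι => μ)
      ≤ Real.log (2 * M) / t + (1 + 2 * K * t) * η
        + t / 2 * (4 * (Fintype.card ι * δ) + 2 * (Real.log (2 * M) / t'
          + (1 + 2 * K ^ 2 * t') * (2 * K * η) + 2 * t' * (K ^ 2) ^ 2 * Fintype.card ι)) := by
  have h1 := integral_abs_selSum_le μ hφ hq hK
  have h2 := integral_penalized_selDiff_le μ hφ hq hK0 hK ht hN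
  have hφ2 : ∀ i, Measurable fun z : Θ × 𝒪 => φ i z.1 z.2 ^ 2 := fun i => (hφ i).pow_const 2
  have hK2 : ∀ i θ o, |φ i θ o ^ 2| ≤ K ^ 2 := fun i θ o => by
    rw [abs_pow]; exact pow_le_pow_left₀ (abs_nonneg _) (hK i θ o) 2
  have h3 := integral_abs_selSum_le_crude μ hφ2 hq (sq_nonneg K) hK2 ht' (hN.sq hK0 hK)
  set R := Real.log (2 * M) / t'
          + (1 + 2 * K ^ 2 * t') * (2 * K * η) + 2 * t' * (K ^ 2) ^ 2 * Fintype.card ι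
  set ν := Measure.pi fun _ : ι => μ
  have hi := integrable_selDiff μ hφ hq hK
  have hs : Integrable (fun z => ∑ i, selDiff φ q i z) (ν.prod ν) := integrable_finsetSum _ fun i _ => hi i
  have hsq : Integrable (fun z => ∑ i, selDiff φ q i z ^ 2) (ν.prod ν) :=
    integrable_finsetSum _ fun i _ => Integrable.of_bound
      ((measurable_selDiff hφ hq i).pow_const 2).aestronglyMeasurable ((2 * K) ^ 2)
      (ae_of_all _ fun z => by
        rw [norm_pow]; exact pow_le_pow_left₀ (norm_nonneg _) (abs_selDiff_le hK i z) 2)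
  rw [integral_sub hs.abs (hsq.const_mul _), integral_const_mul] at h2
  have hA : ∀ i, Integrable (fun z : (ι → 𝒪) × (ι → 𝒪) => φ i (q z.1) (z.1 i) ^ 2) (ν.prod ν) := fun i =>
    Integrable.of_bound ((hφ2 i).comp ((hq.comp measurable_fst).prodMk
      ((measurable_pi_apply i).comp measurable_fst))).aestronglyMeasurable (K ^ 2)
      (ae_of_all _ fun z => hK2 _ _ _)
  have hB : ∀ i, Integrable (fun z : (ι → 𝒪) × (ι → 𝒪) => φ i (q z.1) (z.2 i) ^ 2) (ν.prod ν) := fun i =>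
    Integrable.of_bound ((hφ2 i).comp ((hq.comp measurable_fst).prodMk
      ((measurable_pi_apply i).comp measurable_snd))).aestronglyMeasurable (K ^ 2)
      (ae_of_all _ fun z => hK2 _ _ _)
  have hφi : ∀ i θ, Measurable (fun o => φ i θ o ^ 2) :=
    fun i θ => (hφ2 i).comp (measurable_const.prodMk measurable_id)
  -- On the ghost sample the index is independent of the evaluation points, so the bound `δ` applies
  -- directly.
  have hBv : ∀ i, ∫ z, φ i (q z.1) (z.2 i) ^ 2 ∂(ν.prod ν) ≤ δ := fun i => by
    rw [integral_prod _ (hB i)]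
    refine (integral_mono (hB i).integral_prod_left (integrable_const δ) fun O => ?_).trans (by simp)
    exact (integral_pi_eval μ i (hφi i (q O))).trans_le (hδ i _)
  have hO : ∀ i, Integrable (fun O : ι → 𝒪 => φ i (q O) (O i) ^ 2) ν := fun i =>
    Integrable.of_bound ((hφ2 i).comp (hq.prodMk (measurable_pi_apply i))).aestronglyMeasurable (K ^ 2)
      (ae_of_all _ fun z => hK2 _ _ _)
  -- On the sample that selects the index, the empirical second moment may exceed its mean; the
  -- excess is a `selSum` of squares, to which the crude inequality applies with its own parameter
  -- `t'`.
  have hAv : ∑ i, ∫ z, φ i (q z.1) (z.1 i) ^ 2 ∂(ν.prod ν) ≤ Fintype.card ι * δ + R := by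
    have e : ∀ i, ∫ z, φ i (q z.1) (z.1 i) ^ 2 ∂(ν.prod ν) = ∫ O, φ i (q O) (O i) ^ 2 ∂ν := fun i => by
      rw [integral_prod _ (hA i)]; simp
    simp_rw [e]
    rw [← integral_finsetSum _ fun i _ => hO i]
    have hb : ∀ O, ∑ i, φ i (q O) (O i) ^ 2 ≤ Fintype.card ι * δ + |selSum μ (fun i θ o => φ i θ o ^ 2) q O| := by
      intro O
      have := le_abs_self (selSum μ (fun i θ o => φ i θ o ^ 2) q O)
      unfold selSum at this ⊢
      rw [Finset.sum_sub_distrib] at this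
      have h6 : ∑ i, ∫ o, φ i (q O) o ^ 2 ∂μ ≤ Fintype.card ι * δ := by
        have := Finset.sum_le_card_nsmul Finset.univ (fun i => ∫ o, φ i (q O) o ^ 2 ∂μ) δ fun i _ => hδ i (q O)
        simpa using this
      rw [Finset.sum_sub_distrib]
      linarith
    have hsel : Integrable (fun O => |selSum μ (fun i θ o => φ i θ o ^ 2) q O|) ν := by
      refine (Integrable.of_bound (measurable_selSum μ hφ2 hq).aestronglyMeasurable
        (∑ _i : ι, (K ^ 2 + K ^ 2)) (ae_of_all _ fun O => ?_)).abs
      refine (norm_sum_le _ _).trans (Finset.sum_le_sum fun i _ => ?_)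
      refine (norm_sub_le _ _).trans (add_le_add (hK2 _ _ _) ?_)
      simpa using norm_integral_le_of_norm_le_const (μ := μ) (f := fun o => φ i (q O) o ^ 2) (C := K ^ 2)
        (ae_of_all _ fun o => hK2 i (q O) o)
    have hc : Integrable (fun _ : ι → 𝒪 => (Fintype.card ι * δ : ℝ)) ν := integrable_const _
    refine (integral_mono (integrable_finsetSum _ fun i _ => hO i) (hc.add hsel) hb).trans ?_
    refine (integral_add hc hsel).trans_le ?_
    simpa using h3
  have h4 : ∫ z, ∑ i, selDiff φ q i z ^ 2 ∂(ν.prod ν) ≤ 4 * (Fintype.card ι * δ) + 2 * R := by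
    have hle : ∀ z, ∑ i, selDiff φ q i z ^ 2
        ≤ ∑ i, (2 * φ i (q z.1) (z.1 i) ^ 2 + 2 * φ i (q z.1) (z.2 i) ^ 2) := fun z => by
      refine Finset.sum_le_sum fun i _ => ?_
      unfold selDiff
      nlinarith [sq_nonneg (φ i (q z.1) (z.1 i) + φ i (q z.1) (z.2 i))]
    have hAB : ∀ i, Integrable (fun z : (ι → 𝒪) × (ι → 𝒪) =>
        2 * φ i (q z.1) (z.1 i) ^ 2 + 2 * φ i (q z.1) (z.2 i) ^ 2) (ν.prod ν) := fun i =>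
      ((hA i).const_mul 2).add ((hB i).const_mul 2)
    refine (integral_mono hsq (integrable_finsetSum _ fun i _ => hAB i) hle).trans ?_
    rw [integral_finsetSum _ fun i _ => hAB i]
    have e : ∀ i, ∫ z, (2 * φ i (q z.1) (z.1 i) ^ 2 + 2 * φ i (q z.1) (z.2 i) ^ 2) ∂(ν.prod ν)
        = 2 * ∫ z, φ i (q z.1) (z.1 i) ^ 2 ∂(ν.prod ν)
          + 2 * ∫ z, φ i (q z.1) (z.2 i) ^ 2 ∂(ν.prod ν) := fun i => by
      rw [integral_add ((hA i).const_mul 2) ((hB i).const_mul 2), integral_const_mul, integral_const_mul]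
    simp_rw [e]
    rw [Finset.sum_add_distrib, ← Finset.mul_sum, ← Finset.mul_sum]
    have h6 : ∑ i, ∫ z, φ i (q z.1) (z.2 i) ^ 2 ∂(ν.prod ν) ≤ Fintype.card ι * δ := by
      have := Finset.sum_le_card_nsmul Finset.univ _ δ fun i (_ : i ∈ Finset.univ) => hBv i
      simpa using this
    linarith
  have h5 := mul_le_mul_of_nonneg_left h4 (by positivity : 0 ≤ t / 2)
  linarith

end Selection

/-! ### Calculus of `o_p(1)` and `O_p(1)`, with outer measures so that events need not be
measurable. -/

section Whp

variable {Ω : Type*} [MeasurableSpace Ω] {P : Measure Ω}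

/-- The events `E n` hold with probability tending to one. -/
def Whp (P : Measure Ω) (E : ℕ → Ω → Prop) : Prop :=
  Tendsto (fun n => P {ω | ¬ E n ω}) atTop (𝓝 0)

lemma Whp.mono {E F : ℕ → Ω → Prop} (hE : Whp P E) (h : ∀ᶠ n in atTop, ∀ ω, E n ω → F n ω) :
    Whp P F := by
  refine tendsto_of_tendsto_of_tendsto_of_le_of_le' tendsto_const_nhds hE
    (Eventually.of_forall fun _ => zero_le) ?_
  filter_upwards [h] with n hn
  exact measure_mono fun ω hω hE => hω (hn ω hE)

lemma Whp.mono' {E F : ℕ → Ω → Prop} (hE : Whp P E) (h : ∀ n ω, E n ω → F n ω) : Whp P F :=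
  hE.mono (Eventually.of_forall h)

lemma Whp.and {E F : ℕ → Ω → Prop} (hE : Whp P E) (hF : Whp P F) :
    Whp P fun n ω => E n ω ∧ F n ω := by
  have h := hE.add hF
  rw [add_zero] at h
  refine tendsto_of_tendsto_of_tendsto_of_le_of_le tendsto_const_nhds h (fun _ => zero_le) fun n => ?_
  refine le_trans (measure_mono fun ω hω => ?_) (measure_union_le _ _)
  simp only [Set.mem_ofPred_eq, not_and_or] at hω
  exact hω

lemma Whp.of_forall {E : ℕ → Ω → Prop} (h : ∀ᶠ n in atTop, ∀ ω, E n ω) : Whp P E := by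
  refine tendsto_const_nhds.congr' ?_
  filter_upwards [h] with n hn
  simp [hn]

lemma Whp.of_ae {E : ℕ → Ω → Prop} (h : ∀ n, ∀ᵐ ω ∂P, E n ω) : Whp P E :=
  tendsto_const_nhds.congr fun n => (ae_iff.1 (h n)).symm

lemma Whp.all {ι : Type*} [Finite ι] {E : ι → ℕ → Ω → Prop} (h : ∀ i, Whp P (E i)) :
    Whp P fun n ω => ∀ i, E i n ω := by
  classical
  cases nonempty_fintype ι
  have : ∀ s : Finset ι, Whp P fun n ω => ∀ i ∈ s, E i n ω := fun s => by
    induction s using Finset.induction_on with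
    | empty => exact Whp.of_forall (by simp)
    | insert a s _ ih => exact ((h a).and ih).mono' fun n ω h => by simpa using h
  exact (this Finset.univ).mono' fun n ω h i => h i (Finset.mem_univ i)

/-- The random variables `X n` tend to zero in probability. -/
def Negl (P : Measure Ω) (X : ℕ → Ω → ℝ) : Prop := ∀ ε > 0, Whp P fun n ω => |X n ω| < ε

lemma Negl.of_whp_le {X Y : ℕ → Ω → ℝ} (hY : Negl P Y) (h : Whp P fun n ω => |X n ω| ≤ |Y n ω|) :
    Negl P X := fun ε hε => ((hY ε hε).and h).mono' fun _ _ h => h.2.trans_lt h.1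

lemma Negl.of_le {X Y : ℕ → Ω → ℝ} (hY : Negl P Y) (h : ∀ n ω, |X n ω| ≤ |Y n ω|) : Negl P X :=
  hY.of_whp_le (Whp.of_forall (Eventually.of_forall h))

lemma Negl.congr {X Y : ℕ → Ω → ℝ} (hY : Negl P Y) (h : Whp P fun n ω => X n ω = Y n ω) : Negl P X :=
  hY.of_whp_le (h.mono' fun _ _ h => by rw [h])

lemma Negl.add {X Y : ℕ → Ω → ℝ} (hX : Negl P X) (hY : Negl P Y) :
    Negl P fun n ω => X n ω + Y n ω := fun ε hε =>
  ((hX _ (half_pos hε)).and (hY _ (half_pos hε))).mono' fun _ _ h =>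
    (abs_add_le _ _).trans_lt (by linarith [h.1, h.2])

lemma Negl.const_mul {X : ℕ → Ω → ℝ} (hX : Negl P X) (c : ℝ) : Negl P fun n ω => c * X n ω := by
  intro ε hε
  refine (hX (ε / (|c| + 1)) (by positivity)).mono' fun n ω h => ?_
  rw [abs_mul]
  rw [lt_div_iff₀ (by positivity)] at h
  nlinarith [abs_nonneg (X n ω), abs_nonneg c]

lemma Negl.neg {X : ℕ → Ω → ℝ} (hX : Negl P X) : Negl P fun n ω => - X n ω :=
  hX.of_le fun n ω => by rw [abs_neg]

lemma Negl.sub {X Y : ℕ → Ω → ℝ} (hX : Negl P X) (hY : Negl P Y) :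
    Negl P fun n ω => X n ω - Y n ω := by
  simpa [sub_eq_add_neg] using hX.add hY.neg

lemma Negl.abs {X : ℕ → Ω → ℝ} (hX : Negl P X) : Negl P fun n ω => |X n ω| :=
  hX.of_le fun n ω => by rw [abs_abs]

lemma Negl.sum {ι : Type*} (s : Finset ι) {X : ι → ℕ → Ω → ℝ} (h : ∀ i ∈ s, Negl P (X i)) :
    Negl P fun n ω => ∑ i ∈ s, X i n ω := by
  classical
  induction s using Finset.induction_on with
  | empty => intro ε hε; exact Whp.of_forall (by simp [hε])
  | insert a s ha ih =>
    simp only [Finset.sum_insert ha]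
    exact (h a (by simp)).add (ih fun i hi => h i (by simp [hi]))

lemma Negl.of_tendsto {a : ℕ → ℝ} (h : Tendsto a atTop (𝓝 0)) : Negl P fun n _ => a n := by
  intro ε hε
  refine Whp.of_forall ?_
  filter_upwards [(Metric.tendsto_nhds.1 h) ε hε] with n hn ω
  simpa [Real.dist_eq] using hn

/-- The random variables `X n` are bounded in probability. -/
def Tight (P : Measure Ω) (X : ℕ → Ω → ℝ) : Prop :=
  ∀ δ : ℝ≥0∞, 0 < δ → ∃ C : ℝ, ∀ᶠ n in atTop, P {ω | ¬ |X n ω| ≤ C} ≤ δ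

lemma Negl.mul_tight {X Y : ℕ → Ω → ℝ} (hX : Negl P X) (hY : Tight P Y) :
    Negl P fun n ω => X n ω * Y n ω := by
  intro ε hε
  refine ENNReal.tendsto_nhds_zero.2 fun δ hδ => ?_
  obtain ⟨C, hC⟩ := hY (δ / 2) (ENNReal.half_pos hδ.ne')
  have h1 := ENNReal.tendsto_nhds_zero.1 (hX (ε / (|C| + 1)) (by positivity)) (δ / 2)
    (ENNReal.half_pos hδ.ne')
  filter_upwards [hC, h1] with n h2 h3
  rw [← ENNReal.add_halves δ]
  refine le_trans (measure_mono fun ω hω => ?_) ((measure_union_le _ _).trans (add_le_add h3 h2))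
  by_contra hcon
  simp only [Set.mem_union, Set.mem_ofPred_eq, not_or, not_not] at hcon hω
  apply hω
  rw [abs_mul]
  obtain ⟨h4, h5⟩ := hcon
  rw [lt_div_iff₀ (by positivity)] at h4
  have h6 := h5.trans (le_abs_self C)
  nlinarith [abs_nonneg (X n ω), abs_nonneg (Y n ω)]

lemma Tight.of_whp_le {X Y : ℕ → Ω → ℝ} (hY : Tight P Y) (h : Whp P fun n ω => |X n ω| ≤ |Y n ω|) :
    Tight P X := by
  intro δ hδ
  obtain ⟨C, hC⟩ := hY (δ / 2) (ENNReal.half_pos hδ.ne')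
  have h1 := ENNReal.tendsto_nhds_zero.1 h (δ / 2) (ENNReal.half_pos hδ.ne')
  refine ⟨C, ?_⟩
  filter_upwards [hC, h1] with n h2 h3
  rw [← ENNReal.add_halves δ]
  refine le_trans (measure_mono fun ω hω => ?_) ((measure_union_le _ _).trans (add_le_add h3 h2))
  by_contra hcon
  simp only [Set.mem_union, Set.mem_ofPred_eq, not_or, not_not] at hcon hω
  exact hω (hcon.1.trans hcon.2)

lemma Tight.add {X Y : ℕ → Ω → ℝ} (hX : Tight P X) (hY : Tight P Y) :
    Tight P fun n ω => X n ω + Y n ω := by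
  intro δ hδ
  obtain ⟨C, hC⟩ := hX (δ / 2) (ENNReal.half_pos hδ.ne')
  obtain ⟨C', hC'⟩ := hY (δ / 2) (ENNReal.half_pos hδ.ne')
  refine ⟨C + C', ?_⟩
  filter_upwards [hC, hC'] with n h2 h3
  rw [← ENNReal.add_halves δ]
  refine le_trans (measure_mono fun ω hω => ?_) ((measure_union_le _ _).trans (add_le_add h2 h3))
  by_contra hcon
  simp only [Set.mem_union, Set.mem_ofPred_eq, not_or, not_not] at hcon hω
  exact hω ((abs_add_le _ _).trans (add_le_add hcon.1 hcon.2))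

lemma Negl.tight {X : ℕ → Ω → ℝ} (hX : Negl P X) : Tight P X := by
  intro δ hδ
  refine ⟨1, ?_⟩
  filter_upwards [ENNReal.tendsto_nhds_zero.1 (hX 1 one_pos) δ hδ] with n hn
  refine le_trans (measure_mono fun ω hω => ?_) hn
  simp only [Set.mem_ofPred_eq] at hω ⊢
  exact fun h => hω h.le

lemma Tight.const_mul {X : ℕ → Ω → ℝ} (hX : Tight P X) (c : ℝ) : Tight P fun n ω => c * X n ω := by
  intro δ hδ
  obtain ⟨C, hC⟩ := hX δ hδ
  refine ⟨|c| * C, ?_⟩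
  filter_upwards [hC] with n hn
  refine le_trans (measure_mono fun ω hω => ?_) hn
  simp only [Set.mem_ofPred_eq] at hω ⊢
  intro h
  apply hω
  rw [abs_mul]
  gcongr

lemma Tight.sum {ι : Type*} (s : Finset ι) {X : ι → ℕ → Ω → ℝ} (h : ∀ i ∈ s, Tight P (X i)) :
    Tight P fun n ω => ∑ i ∈ s, X i n ω := by
  classical
  induction s using Finset.induction_on with
  | empty => intro δ hδ; exact ⟨0, by simp⟩
  | insert a s ha ih =>
    simp only [Finset.sum_insert ha]
    exact (h a (by simp)).add (ih fun i hi => h i (by simp [hi]))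

lemma measure_not_abs_lt_le {X : Ω → ℝ} (hX : Measurable X) {ε b : ℝ} (hε : 0 < ε)
    (h : ∫⁻ ω, ENNReal.ofReal |X ω| ∂P ≤ ENNReal.ofReal b) :
    P {ω | ¬ |X ω| < ε} ≤ ENNReal.ofReal (b / ε) := by
  have h1 := meas_ge_le_lintegral_div (μ := P) (f := fun ω => ENNReal.ofReal |X ω|)
    (ENNReal.measurable_ofReal.comp hX.abs).aemeasurable (ε := ENNReal.ofReal ε)
    (by simpa using hε) ENNReal.ofReal_ne_top
  rw [ENNReal.ofReal_div_of_pos hε]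
  refine le_trans (measure_mono fun ω hω => ?_) (h1.trans (ENNReal.div_le_div_right h _))
  simp only [Set.mem_ofPred_eq, not_lt] at hω ⊢
  exact ENNReal.ofReal_le_ofReal hω

lemma Negl.of_lintegral {X : ℕ → Ω → ℝ} (hX : ∀ n, Measurable (X n)) {b : ℕ → ℝ}
    (hb : Tendsto b atTop (𝓝 0))
    (h : ∀ᶠ n in atTop, ∫⁻ ω, ENNReal.ofReal |X n ω| ∂P ≤ ENNReal.ofReal (b n)) : Negl P X := by
  intro ε hε
  have h1 : Tendsto (fun n => ENNReal.ofReal (b n / ε)) atTop (𝓝 0) := by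
    have := ENNReal.tendsto_ofReal (hb.div_const ε)
    simpa using this
  refine tendsto_of_tendsto_of_tendsto_of_le_of_le' tendsto_const_nhds h1
    (Eventually.of_forall fun _ => zero_le) ?_
  filter_upwards [h] with n hn
  exact measure_not_abs_lt_le (hX n) hε hn

lemma Negl.of_lintegral_sq {X : ℕ → Ω → ℝ} (hX : ∀ n, Measurable (X n)) {b : ℕ → ℝ}
    (hb : Tendsto b atTop (𝓝 0))
    (h : ∀ᶠ n in atTop, ∫⁻ ω, ENNReal.ofReal (X n ω ^ 2) ∂P ≤ ENNReal.ofReal (b n)) : Negl P X := by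
  have h1 : Negl P fun n ω => X n ω ^ 2 := by
    refine Negl.of_lintegral (fun n => (hX n).pow_const 2) hb ?_
    filter_upwards [h] with n hn
    simpa using hn
  intro ε hε
  refine (h1 (ε ^ 2) (by positivity)).mono' fun n ω h => ?_
  rw [abs_pow] at h
  exact lt_of_pow_lt_pow_left₀ 2 hε.le h

lemma Tight.of_lintegral_sq {X : ℕ → Ω → ℝ} (hX : ∀ n, Measurable (X n)) {b : ℝ}
    (h : ∀ n, ∫⁻ ω, ENNReal.ofReal (X n ω ^ 2) ∂P ≤ ENNReal.ofReal b) : Tight P X := by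
  intro δ hδ
  have h0 : Tendsto (fun C : ℝ => ENNReal.ofReal (b / C ^ 2)) atTop (𝓝 0) := by
    have : Tendsto (fun C : ℝ => b / C ^ 2) atTop (𝓝 0) :=
      tendsto_const_nhds.div_atTop (tendsto_pow_atTop (by norm_num))
    simpa using ENNReal.tendsto_ofReal this
  obtain ⟨C, hC, hC0⟩ := ((ENNReal.tendsto_nhds_zero.1 h0 δ hδ).and (eventually_gt_atTop 0)).exists
  refine ⟨C, Eventually.of_forall fun n => le_trans ?_ hC⟩
  refine le_trans (measure_mono fun ω hω => ?_)
    (measure_not_abs_lt_le ((hX n).pow_const 2) (pow_pos hC0 2) (b := b) (by simpa using h n))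
  simp only [Set.mem_ofPred_eq, not_le, not_lt] at hω ⊢
  rw [abs_pow]
  exact pow_le_pow_left₀ hC0.le hω.le 2

lemma tendstoInMeasure_of_negl {X : ℕ → Ω → ℝ} (hX : Negl P X) :
    TendstoInMeasure P X atTop fun _ => 0 := by
  rw [tendstoInMeasure_iff_norm]
  intro ε hε
  refine (hX ε hε).congr fun n => ?_
  simp

end Whp

/-! ### Estimators as functions of the split and the data vector. -/

section Observations

variable {Ω 𝒳 𝓑 : Type*} {J : ℕ}

/-- The values of the data of one participant. -/
abbrev Obs (𝒳 𝓑 : Type*) : Type _ := 𝒳 × 𝓑 × 𝓑 × Bool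

/-- The potential submission under treatment `w`. -/
def subOf (w : Bool) (o : Obs 𝒳 𝓑) : 𝓑 := if w then o.2.2.1 else o.2.1

/-- The observed submission. -/
def bidOf (o : Obs 𝒳 𝓑) : 𝓑 := subOf o.2.2.2 o

/-- The data of the first `n` participants. -/
def Sample.vec (D : Sample Ω 𝒳 𝓑) (n : ℕ) (ω : Ω) : Fin n → Obs 𝒳 𝓑 := fun i => D.obs i ω

/-- The members of fold `k`. -/
def Split.fold {n : ℕ} (s : Split n) (k : Fin 3) : Finset (Fin n) :=
  Finset.univ.filter fun i => (s i).1 = k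

lemma subOf_obs (D : Sample Ω 𝒳 𝓑) (i : ℕ) (w : Bool) (ω : Ω) :
    subOf w (D.obs i ω) = D.B i w ω := by
  cases w <;> rfl

lemma bidOf_obs (D : Sample Ω 𝒳 𝓑) (i : ℕ) (ω : Ω) : bidOf (D.obs i ω) = D.bid i ω :=
  subOf_obs D i _ ω

lemma bidOf_eq_subOf {w : Bool} {o : Obs 𝒳 𝓑} (h : o.2.2.2 = w) : bidOf o = subOf w o := by
  rw [bidOf, h]

variable (M : Mechanism 𝓑 J) (L : Learners 𝒳 J) (π : 𝒳 → ℝ) {n : ℕ} (s : Split n) (k : Fin 3)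

/-- The first step propensity score as a function of the data. -/
def eFirstF (O : Fin n → Obs 𝒳 𝓑) : 𝒳 → ℝ :=
  L.eFirst n (s.H k) fun i => ((O i).1, (O i).2.2.2)

/-- The first step cutoffs as a function of the data. -/
noncomputable def pFirstF (O : Fin n → Obs 𝒳 𝓑) : Vec J :=
  M.m (s.H k).card (fun j => bidOf (O ((s.H k).orderEmbOfFin rfl j)))
    (fun j => ipwWeight π (eFirstF L s k O) (s.H k).card (O ((s.H k).orderEmbOfFin rfl j)).1
      (O ((s.H k).orderEmbOfFin rfl j)).2.2.2) M.cap

/-- The estimated propensity score as a function of the data. -/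
def eHatF (O : Fin n → Obs 𝒳 𝓑) : 𝒳 → ℝ :=
  L.eHat n (s.G k) fun i => ((O i).1, (O i).2.2.2)

/-- The localized conditional mean of outcomes as a function of the data. -/
noncomputable def muYHatF (w : Bool) (O : Fin n → Obs 𝒳 𝓑) (x : 𝒳) : ℝ :=
  L.muY n (s.G k) (fun i => ((O i).1, (O i).2.2.2, M.y (bidOf (O i)) (pFirstF M L π s k O))) w x

/-- The localized conditional mean of allocations as a function of the data. -/
noncomputable def muDHatF (w : Bool) (O : Fin n → Obs 𝒳 𝓑) (x : 𝒳) : Vec J :=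
  L.muD n (s.G k) (fun i => ((O i).1, (O i).2.2.2, M.d (bidOf (O i)) (pFirstF M L π s k O))) w x

/-- The perturbed capacities as a function of the data. -/
noncomputable def capHatF (O : Fin n → Obs 𝒳 𝓑) : Vec J :=
  M.cap + (1 / (n : ℝ)) • ∑ i : Fin n,
    ((((if (O i).2.2.2 then 1 else 0) / eHatF L s (s i).1 O (O i).1 - 1) * π (O i).1) •
        muDHatF M L π s (s i).1 true O (O i).1
      + ((1 - π (O i).1) *
        ((if (O i).2.2.2 then 0 else 1) / (1 - eHatF L s (s i).1 O (O i).1) - 1)) •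
        muDHatF M L π s (s i).1 false O (O i).1)

/-- The second step cutoffs as a function of the data. -/
noncomputable def pHatF (O : Fin n → Obs 𝒳 𝓑) : Vec J :=
  M.m n (fun i => bidOf (O i))
    (fun i => ipwWeight π (eHatF L s (s i).1 O) n (O i).1 (O i).2.2.2) (capHatF M L π s O)

/-- The estimated score as a function of the data. -/
noncomputable def scoreYHatF (w : Bool) (i : Fin n) (O : Fin n → Obs 𝒳 𝓑) (p : Vec J) : ℝ :=
  drScore w (O i).2.2.2 (eHatF L s (s i).1 O (O i).1) (muYHatF M L π s (s i).1 w O (O i).1)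
    (M.y (bidOf (O i)) p)

variable (D : Sample Ω 𝒳 𝓑) (ω : Ω)

/-- This identity and the next ones move the estimators from `Ω` to functions of the data, where
measurability, invariance on a fold and product measures are available. -/
lemma eHat_eq : eHat D L n k ω = eHatF L (D.split n ω) k (D.vec n ω) := rfl

lemma pFirst_eq : pFirst D M L π n k ω = pFirstF M L π (D.split n ω) k (D.vec n ω) := by
  simp only [pFirst, pFirstF, Sample.vec, bidOf_obs]; rfl

lemma muYHat_eq (w : Bool) (x : 𝒳) :
    muYHat D M L n k ω w x (pFirst D M L π n k ω)
      = muYHatF M L π (D.split n ω) k w (D.vec n ω) x := by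
  rw [pFirst_eq]; simp only [muYHat, muYHatF, Sample.vec, bidOf_obs]; rfl

lemma muDHat_eq (w : Bool) (x : 𝒳) :
    muDHat D M L n k ω w x (pFirst D M L π n k ω)
      = muDHatF M L π (D.split n ω) k w (D.vec n ω) x := by
  rw [pFirst_eq]; simp only [muDHat, muDHatF, Sample.vec, bidOf_obs]; rfl

lemma capHat_eq : capHat D M L π n ω = capHatF M L π (D.split n ω) (D.vec n ω) := by
  simp only [capHat, capHatF, muDHatAt, muDHat_eq]; rfl

lemma pHat_eq : pHat D M L π n ω = pHatF M L π (D.split n ω) (D.vec n ω) := by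
  simp only [pHat, pHatF, capHat_eq, Sample.vec, bidOf_obs]; rfl

lemma scoreYHat_eq (w : Bool) (i : Fin n) (p : Vec J) : scoreYHat D M L π n ω w i p
    = scoreYHatF M L π (D.split n ω) w i (D.vec n ω) p := by
  simp only [scoreYHat, scoreYHatF, muYHatAt, muYHat_eq, Sample.vec, bidOf_obs]; rfl

section Invariant

lemma Split.not_mem_fold_of_mem_G {s : Split n} {k : Fin 3} {i : Fin n} (h : i ∈ s.G k) :
    i ∉ s.fold k := by
  simp only [Split.G, Split.fold, Finset.mem_filter, Finset.mem_univ, true_and] at *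
  exact h.1

lemma Split.not_mem_fold_of_mem_H {s : Split n} {k : Fin 3} {i : Fin n} (h : i ∈ s.H k) :
    i ∉ s.fold k := by
  simp only [Split.H, Split.fold, Finset.mem_filter, Finset.mem_univ, true_and] at *
  exact h.1

lemma invariantOn_eHatF : InvariantOn (s.fold k) (eHatF L s k : (Fin n → Obs 𝒳 𝓑) → 𝒳 → ℝ) := by
  intro O O' h
  have : ∀ i : s.G k, O i = O' i := fun i => h i (Split.not_mem_fold_of_mem_G i.2)
  simp only [eHatF, this]

/-- Both `H_{-k}` and `G_{-k}` avoid fold `k`, so neither the first-step cutoff nor the regressions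
localized at it see the data of the fold. -/
lemma invariantOn_pFirstF : InvariantOn (s.fold k) (pFirstF M L π s k) := by
  intro O O' h
  have h1 : ∀ i : s.H k, O i = O' i := fun i => h i (Split.not_mem_fold_of_mem_H i.2)
  have h2 : ∀ j, O ((s.H k).orderEmbOfFin rfl j) = O' ((s.H k).orderEmbOfFin rfl j) := fun j =>
    h _ (Split.not_mem_fold_of_mem_H (Finset.orderEmbOfFin_mem _ _ _))
  simp only [pFirstF, eFirstF, h1, h2]

lemma invariantOn_muYHatF (w : Bool) : InvariantOn (s.fold k) (muYHatF M L π s k w) := by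
  intro O O' h
  have h1 : ∀ i : s.G k, O i = O' i := fun i => h i (Split.not_mem_fold_of_mem_G i.2)
  ext x
  simp only [muYHatF, h1, invariantOn_pFirstF M L π s k O O' h]

lemma invariantOn_muDHatF (w : Bool) : InvariantOn (s.fold k) (muDHatF M L π s k w) := by
  intro O O' h
  have h1 : ∀ i : s.G k, O i = O' i := fun i => h i (Split.not_mem_fold_of_mem_G i.2)
  ext x
  simp only [muDHatF, h1, invariantOn_pFirstF M L π s k O O' h]

end Invariant

section Measurable

variable [MeasurableSpace 𝒳] [MeasurableSpace 𝓑] {M L π}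

lemma measurable_subOf (w : Bool) : Measurable (subOf w : Obs 𝒳 𝓑 → 𝓑) := by
  cases w
  · exact measurable_fst.comp measurable_snd
  · exact measurable_fst.comp (measurable_snd.comp measurable_snd)

lemma measurable_bidOf : Measurable (bidOf : Obs 𝒳 𝓑 → 𝓑) := by
  have : (bidOf : Obs 𝒳 𝓑 → 𝓑) = fun o => if o.2.2.2 = true then subOf true o else subOf false o := by
    ext o; cases h : o.2.2.2 <;> simp [bidOf, h]
  rw [this]
  exact Measurable.ite ((measurable_snd.comp (measurable_snd.comp measurable_snd))
    (measurableSet_singleton true)) (measurable_subOf true) (measurable_subOf false)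

lemma measurable_eHatF (hL : MeasurableLearners L) :
    Measurable fun z : (Fin n → Obs 𝒳 𝓑) × 𝒳 => eHatF L s k z.1 z.2 := by
  refine (hL.eHat n (s.G k)).comp (Measurable.prodMk (measurable_pi_lambda _ fun i => ?_) measurable_snd)
  fun_prop

lemma measurable_ipwWeight {α : Type*} [MeasurableSpace α] {e : α → ℝ} {W : α → Bool} {π' : α → ℝ}
    (N : ℕ) (he : Measurable e) (hW : Measurable W) (hπ : Measurable π') :
    Measurable fun a => π' a * ((if W a then 1 else 0) / (N * e a))
      + (1 - π' a) * ((if W a then 0 else 1) / (N * (1 - e a))) := by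
  have h1 : Measurable fun a => (if W a then (1 : ℝ) else 0) :=
    Measurable.ite (hW (measurableSet_singleton true)) measurable_const measurable_const
  have h0 : Measurable fun a => (if W a then (0 : ℝ) else 1) :=
    Measurable.ite (hW (measurableSet_singleton true)) measurable_const measurable_const
  fun_prop

lemma measurable_pFirstF (hM : MeasurableMechanism M) (hL : MeasurableLearners L)
    (hπ : Measurable π) : Measurable (pFirstF M L π s k) := by
  refine (hM.m _).comp (Measurable.prodMk (measurable_pi_lambda _ fun j => ?_)
    (Measurable.prodMk (measurable_pi_lambda _ fun j => ?_) measurable_const))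
  · exact measurable_bidOf.comp (measurable_pi_apply _)
  · refine measurable_ipwWeight _ (e := fun O => eFirstF L s k O _) ?_ (by fun_prop) (hπ.comp (by fun_prop))
    refine (hL.eFirst n (s.H k)).comp (Measurable.prodMk (measurable_pi_lambda _ fun i => ?_) ?_) <;> fun_prop

lemma measurable_muYHatF (hM : MeasurableMechanism M) (hL : MeasurableLearners L)
    (hπ : Measurable π) (w : Bool) :
    Measurable fun z : (Fin n → Obs 𝒳 𝓑) × 𝒳 => muYHatF M L π s k w z.1 z.2 := by
  refine (hL.muY n (s.G k) w).comp
    (Measurable.prodMk (measurable_pi_lambda _ fun i => ?_) measurable_snd)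
  refine Measurable.prodMk (by fun_prop) (Measurable.prodMk (by fun_prop) ?_)
  exact hM.y.comp (Measurable.prodMk (measurable_bidOf.comp (by fun_prop))
    ((measurable_pFirstF s k hM hL hπ).comp measurable_fst))

lemma measurable_muDHatF (hM : MeasurableMechanism M) (hL : MeasurableLearners L)
    (hπ : Measurable π) (w : Bool) :
    Measurable fun z : (Fin n → Obs 𝒳 𝓑) × 𝒳 => muDHatF M L π s k w z.1 z.2 := by
  refine (hL.muD n (s.G k) w).comp
    (Measurable.prodMk (measurable_pi_lambda _ fun i => ?_) measurable_snd)
  refine Measurable.prodMk (by fun_prop) (Measurable.prodMk (by fun_prop) ?_)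
  exact hM.d.comp (Measurable.prodMk (measurable_bidOf.comp (by fun_prop))
    ((measurable_pFirstF s k hM hL hπ).comp measurable_fst))

lemma measurable_eHatF_eval (hL : MeasurableLearners L) (i : Fin n) :
    Measurable fun O : Fin n → Obs 𝒳 𝓑 => eHatF L s k O (O i).1 :=
  (measurable_eHatF s k hL).comp (measurable_id.prodMk (by fun_prop))

lemma measurable_capHatF (hM : MeasurableMechanism M) (hL : MeasurableLearners L)
    (hπ : Measurable π) : Measurable (capHatF M L π s) := by
  have hb : ∀ i (a b : ℝ), Measurable fun O : Fin n → Obs 𝒳 𝓑 => (if (O i).2.2.2 then a else b) :=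
    fun i a b => Measurable.ite ((show Measurable fun O : Fin n → Obs 𝒳 𝓑 => (O i).2.2.2 by fun_prop)
      (measurableSet_singleton true)) measurable_const measurable_const
  have hm : ∀ i w, Measurable fun O : Fin n → Obs 𝒳 𝓑 => muDHatF M L π s (s i).1 w O (O i).1 :=
    fun i w => (measurable_muDHatF s _ hM hL hπ w).comp (measurable_id.prodMk (by fun_prop))
  have he := fun i : Fin n => measurable_eHatF_eval (𝓑 := 𝓑) s (s i).1 hL i
  have hp : ∀ i, Measurable fun O : Fin n → Obs 𝒳 𝓑 => π (O i).1 := fun i => hπ.comp (by fun_prop)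
  have hsum : Measurable fun O : Fin n → Obs 𝒳 𝓑 => ∑ i : Fin n,
    ((((if (O i).2.2.2 then 1 else 0) / eHatF L s (s i).1 O (O i).1 - 1) * π (O i).1) •
        muDHatF M L π s (s i).1 true O (O i).1
      + ((1 - π (O i).1) *
        ((if (O i).2.2.2 then 0 else 1) / (1 - eHatF L s (s i).1 O (O i).1) - 1)) •
        muDHatF M L π s (s i).1 false O (O i).1) := by
    refine Finset.measurable_fun_sum _ fun i _ => ?_
    have h1 := (((hb i 1 0).div (he i)).sub_const 1).mul (hp i)
    have h2 := ((hp i).const_sub 1).mul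
      (((hb i 0 1).div ((he i).const_sub 1)).sub_const 1)
    exact (h1.smul (hm i true)).add (h2.smul (hm i false))
  exact (hsum.const_smul (1 / (n : ℝ))).const_add M.cap

lemma measurable_pHatF (hM : MeasurableMechanism M) (hL : MeasurableLearners L)
    (hπ : Measurable π) : Measurable (pHatF M L π s) := by
  refine (hM.m _).comp (Measurable.prodMk (measurable_pi_lambda _ fun j => ?_)
    (Measurable.prodMk (measurable_pi_lambda _ fun j => ?_) (measurable_capHatF s hM hL hπ)))
  · exact measurable_bidOf.comp (measurable_pi_apply _)
  · exact measurable_ipwWeight _ (e := fun O => eHatF L s _ O _)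
      (measurable_eHatF_eval s _ hL j) (by fun_prop) (hπ.comp (by fun_prop))

lemma measurable_drScore {α : Type*} [MeasurableSpace α] (w : Bool) {W : α → Bool} {e mu v : α → ℝ}
    (hW : Measurable W) (he : Measurable e) (hmu : Measurable mu) (hv : Measurable v) :
    Measurable fun a => drScore w (W a) (e a) (mu a) (v a) := by
  have h1 : Measurable fun a => (if W a = w then (1 : ℝ) else 0) :=
    Measurable.ite (hW (measurableSet_singleton w)) measurable_const measurable_const
  unfold drScore
  cases w <;> simp only [if_true, if_false, Bool.false_eq_true, smul_eq_mul] at * <;> fun_prop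

lemma measurable_scoreYHatF_pHatF (hM : MeasurableMechanism M) (hL : MeasurableLearners L)
    (hπ : Measurable π) (w : Bool) (i : Fin n) :
    Measurable fun O : Fin n → Obs 𝒳 𝓑 => scoreYHatF M L π s w i O (pHatF M L π s O) := by
  refine measurable_drScore w (by fun_prop) (measurable_eHatF_eval s _ hL i)
    ((measurable_muYHatF s _ hM hL hπ w).comp (measurable_id.prodMk (by fun_prop))) ?_
  exact hM.y.comp (Measurable.prodMk (measurable_bidOf.comp (by fun_prop))
    (measurable_pHatF s hM hL hπ))

end Measurable

end Observations

/-! ### From the probability space to product measures, one split at a time. -/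

section Transfer

variable {Ω 𝒳 𝓑 : Type*} [MeasurableSpace Ω] [MeasurableSpace 𝒳] [MeasurableSpace 𝓑]
  {P : Measure Ω} [IsProbabilityMeasure P] {D : Sample Ω 𝒳 𝓑}

/-- The law of the data of one participant. -/
noncomputable abbrev Sample.law (D : Sample Ω 𝒳 𝓑) (P : Measure Ω) : Measure (Obs 𝒳 𝓑) :=
  P.map (D.obs 0)

lemma IIDSample.measurable_obs (hD : IIDSample D P) (i : ℕ) : Measurable (D.obs i) :=
  (hD.measurable_X i).prodMk ((hD.measurable_B i false).prodMk
    ((hD.measurable_B i true).prodMk (hD.measurable_W i)))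

lemma IIDSample.isProbabilityMeasure_law (hD : IIDSample D P) : IsProbabilityMeasure (D.law P) :=
  Measure.isProbabilityMeasure_map (hD.measurable_obs 0).aemeasurable

lemma IIDSample.measurable_vec (hD : IIDSample D P) (n : ℕ) : Measurable (D.vec n) :=
  measurable_pi_lambda _ fun i => hD.measurable_obs i

lemma IIDSample.map_vec (hD : IIDSample D P) (n : ℕ) :
    P.map (D.vec n) = Measure.pi fun _ : Fin n => D.law P := by
  have h := (hD.indep.precomp (g := fun i : Fin n => (i : ℕ)) Fin.val_injective)
  have := (iIndepFun_iff_map_fun_eq_pi_map fun i : Fin n => (hD.measurable_obs i).aemeasurable).1 h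
  refine this.trans ?_
  congr 1
  ext1 i
  exact (hD.ident i).map_eq

lemma IIDSample.measurable_comp (hD : IIDSample D P) {n : ℕ} {β : Type*} [MeasurableSpace β]
    {F : Split n → (Fin n → Obs 𝒳 𝓑) → β} (hF : ∀ s, Measurable (F s)) :
    Measurable fun ω => F (D.split n ω) (D.vec n ω) := by
  have : Measurable fun z : Split n × (Fin n → Obs 𝒳 𝓑) => F z.1 z.2 :=
    measurable_from_prod_countable_right hF
  exact this.comp ((hD.measurable_split n).prodMk (hD.measurable_vec n))

/-- The split is independent of the data, so fixing its value leaves the data i.i.d.; the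
expectation is a mixture over the finitely many splits. -/
lemma IIDSample.lintegral_comp (hD : IIDSample D P) {n : ℕ}
    {F : Split n → (Fin n → Obs 𝒳 𝓑) → ℝ≥0∞} (hF : ∀ s, Measurable (F s)) :
    ∫⁻ ω, F (D.split n ω) (D.vec n ω) ∂P
      = ∑ s, P (D.split n ⁻¹' {s}) * ∫⁻ O, F s O ∂(Measure.pi fun _ : Fin n => D.law P) := by
  classical
  have hind : IndepFun (D.split n) (D.vec n) P := by
    have := (hD.indep_split n).comp (φ := fun (g : ℕ → Obs 𝒳 𝓑) (i : Fin n) => g i) (ψ := id)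
      (measurable_pi_lambda _ fun i => measurable_pi_apply _) measurable_id
    exact this.symm
  have h1 : ∀ ω, F (D.split n ω) (D.vec n ω)
      = ∑ s, (if D.split n ω = s then 1 else 0) * F s (D.vec n ω) := fun ω => by simp
  have hm : ∀ s, Measurable fun t : Split n => (if t = s then (1 : ℝ≥0∞) else 0) := fun s =>
    measurable_of_countable _
  simp_rw [h1]
  have hmul : ∀ s, Measurable fun ω =>
      (if D.split n ω = s then (1 : ℝ≥0∞) else 0) * F s (D.vec n ω) := fun s =>
    ((hm s).comp (hD.measurable_split n)).mul ((hF s).comp (hD.measurable_vec n))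
  rw [lintegral_finsetSum _ fun s _ => hmul s]
  refine Finset.sum_congr rfl fun s _ => ?_
  have := lintegral_mul_eq_lintegral_mul_lintegral_of_indepFun''
    ((hm s).comp (hD.measurable_split n)).aemeasurable
    ((hF s).comp (hD.measurable_vec n)).aemeasurable (hind.comp (hm s) (hF s))
  simp only [Function.comp_apply] at this
  rw [this, ← hD.map_vec, lintegral_map (hF s) (hD.measurable_vec n)]
  congr 1
  have e : (fun ω => if D.split n ω = s then (1 : ℝ≥0∞) else 0)
      = (D.split n ⁻¹' {s}).indicator 1 := by
    ext ω; simp [Set.indicator_apply]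
  rw [e, lintegral_indicator_one (hD.measurable_split n (measurableSet_singleton s))]

/-- A bound valid for each fixed split carries over to the random split, whatever its distribution.
-/
lemma IIDSample.lintegral_comp_le (hD : IIDSample D P) {n : ℕ}
    {F : Split n → (Fin n → Obs 𝒳 𝓑) → ℝ≥0∞} (hF : ∀ s, Measurable (F s)) {c : ℝ≥0∞}
    (h : ∀ s, ∫⁻ O, F s O ∂(Measure.pi fun _ : Fin n => D.law P) ≤ c) :
    ∫⁻ ω, F (D.split n ω) (D.vec n ω) ∂P ≤ c := by
  rw [hD.lintegral_comp hF]
  refine (Finset.sum_le_sum fun s _ => mul_le_mul_right (h s) _).trans ?_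
  rw [← Finset.sum_mul]
  have : ∑ s, P (D.split n ⁻¹' {s}) = 1 := by
    have h := hD.lintegral_comp (n := n) (F := fun _ _ => 1) (fun _ => measurable_const)
    have := hD.isProbabilityMeasure_law
    simpa using h.symm
  rw [this, one_mul]

end Transfer

/-! ### From uniform covering numbers to nets on samples. -/

section Net

variable {𝓑 : Type*} {J : ℕ} [MeasurableSpace 𝓑]

/-- The points `b i` may coincide, so the atoms are collected on the image of `b` with their
multiplicities. -/
lemma finitelyDiscrete_empirical {ι : Type*} [Fintype ι] (b : ι → 𝓑) (c : ℝ≥0∞) :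
    FinitelyDiscrete (∑ i, c • Measure.dirac (b i)) := by
  classical
  refine ⟨Finset.univ.image b, fun y => (Finset.univ.filter fun i => b i = y).card • c, ?_⟩
  rw [Finset.sum_comp (fun y => c • Measure.dirac y) b]
  exact Finset.sum_congr rfl fun y _ => (smul_assoc _ _ _).symm

/-- The covering number is used at the empirical measure `Q` of the points. Moving the centres into
the class doubles the radius, and the `L¹(Q)` distance, which is the average of the absolute
differences, is at most the `L²(Q)` distance. -/
lemma UniformCovering.exists_net {S : Set (Vec J)} {f : 𝓑 → Vec J → ℝ} {C h K : ℝ}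
    (hf : UniformCovering S f C h) (hm : ∀ p, Measurable fun b => f b p)
    (hK : ∀ b, ∀ p ∈ S, |f b p| ≤ K) {ι : Type*} [Fintype ι] [Nonempty ι] (b : ι → 𝓑)
    {ε : ℝ} (hε : 0 < ε) (hε1 : ε < 1) (hC : 0 ≤ C) :
    ∃ F : Finset S, (F.card : ℝ) ≤ C * (1 / ε) ^ h ∧ ∀ p : S, ∃ p' ∈ F,
      ∑ i, |f (b i) p - f (b i) p'| ≤ Fintype.card ι * (2 * ε) := by
  classical
  set N : ℝ≥0∞ := ((Fintype.card ι : ℕ) : ℝ≥0∞) with hN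
  have hN0 : N ≠ 0 := by simp [hN]
  have hNt : N ≠ ∞ := by simp [hN]
  set Q : Measure 𝓑 := ∑ i, N⁻¹ • Measure.dirac (b i) with hQ
  have hQp : IsProbabilityMeasure Q := ⟨by
    simp only [hQ, Measure.coe_finsetSum, Finset.sum_apply, Measure.smul_apply, measure_univ]
    simp only [smul_eq_mul, mul_one, Finset.sum_const, Finset.card_univ, nsmul_eq_mul]
    exact ENNReal.mul_inv_cancel hN0 hNt⟩
  have hcov := hf Q (finitelyDiscrete_empirical b _) ⟨ε, hε.le⟩ (by exact_mod_cast hε)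
    (by exact_mod_cast hε1)
  set A := {g : Lp ℝ 2 Q | ∃ p ∈ S, g =ᵐ[Q] fun b => f b p} with hA
  have hle := Metric.coveringNumber_two_mul_le_externalCoveringNumber (⟨ε, hε.le⟩ : ℝ≥0) A
  have hle' : ((Metric.coveringNumber (2 * ⟨ε, hε.le⟩) A : ℕ∞) : ℝ≥0∞)
      ≤ ENNReal.ofReal (C * (1 / ε) ^ h) :=
    le_trans (by exact_mod_cast hle) hcov
  have hfin : Metric.coveringNumber (2 * ⟨ε, hε.le⟩) A ≠ ⊤ := by
    intro h
    rw [h] at hle'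
    simp at hle'
  obtain ⟨T, hTA, hTf, hTc, hTcard⟩ := Metric.exists_set_encard_eq_coveringNumber hfin
  have hch : ∀ g : T, ∃ p : S, (g : Lp ℝ 2 Q) =ᵐ[Q] fun b => f b p := fun g => by
    obtain ⟨p, hp, h⟩ := hTA g.2
    exact ⟨⟨p, hp⟩, h⟩
  choose pt hpt using hch
  have := hTf.fintype
  refine ⟨Finset.univ.image pt, ?_, fun p => ?_⟩
  · have h1 : ((Finset.univ.image pt).card : ℝ≥0∞) ≤ ENNReal.ofReal (C * (1 / ε) ^ h) := by
      refine le_trans ?_ hle'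
      rw [← hTcard]
      have h2 : (Finset.univ.image pt).card ≤ Fintype.card T := Finset.card_image_le
      have h3 : T.encard = (Fintype.card T : ℕ∞) := by
        rw [Set.encard, ENat.card_eq_coe_fintype_card]
      rw [h3]
      exact_mod_cast h2
    rw [← ENNReal.ofReal_natCast] at h1
    exact (ENNReal.ofReal_le_ofReal_iff (by positivity)).1 h1
  · have hpL : MemLp (fun b => f b p) 2 Q := MemLp.of_bound (hm p).aestronglyMeasurable K
      (ae_of_all _ fun b => hK b p p.2)
    obtain ⟨g, hgT, hg⟩ := hTc (show hpL.toLp ∈ A from ⟨p, p.2, hpL.coeFn_toLp⟩)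
    refine ⟨pt ⟨g, hgT⟩, Finset.mem_image_of_mem _ (Finset.mem_univ _), ?_⟩
    set p' := pt ⟨g, hgT⟩
    have hmd : Measurable fun b => f b p - f b p' := (hm p).sub (hm p')
    have h1 : eLpNorm (fun b => f b p - f b p') 1 Q ≤ ENNReal.ofReal (2 * ε) := by
      refine (eLpNorm_le_eLpNorm_of_exponent_le (by norm_num : (1 : ℝ≥0∞) ≤ 2)
        hmd.aestronglyMeasurable).trans ?_
      have h2 : edist hpL.toLp g ≤ ((2 * ⟨ε, hε.le⟩ : ℝ≥0) : ℝ≥0∞) := hg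
      rw [Lp.edist_def] at h2
      have h3 : (⇑hpL.toLp - ⇑g) =ᵐ[Q] fun b => f b p - f b p' :=
        hpL.coeFn_toLp.sub (hpt ⟨g, hgT⟩)
      rw [eLpNorm_congr_ae h3] at h2
      refine h2.trans_eq ?_
      rw [ENNReal.ofReal]
      congr 1
      ext
      rw [Real.coe_toNNReal _ (by positivity)]
      rfl
    rw [eLpNorm_one_eq_lintegral_enorm, hQ, lintegral_finsetSum_measure] at h1
    simp_rw [lintegral_smul_measure, lintegral_dirac' _ hmd.enorm] at h1
    rw [← Finset.smul_sum, smul_eq_mul, ENNReal.inv_mul_le_iff hN0 hNt] at h1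
    have h4 : ∑ i, ‖f (b i) p - f (b i) p'‖ₑ = ENNReal.ofReal (∑ i, |f (b i) p - f (b i) p'|) := by
      rw [ENNReal.ofReal_sum_of_nonneg fun i _ => abs_nonneg _]
      exact Finset.sum_congr rfl fun i _ => Real.enorm_eq_ofReal_abs _
    rw [h4, hN, ← ENNReal.ofReal_natCast, ← ENNReal.ofReal_mul (by positivity)] at h1
    exact (ENNReal.ofReal_le_ofReal_iff (by positivity)).1 h1

/-- A net for functions that are dominated, pointwise, by a class with small uniform covering
numbers. -/
lemma UniformCovering.hasEmpiricalNet {𝒪 ι : Type*} [Fintype ι] [Nonempty ι] {S : Set (Vec J)}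
    {f : 𝓑 → Vec J → ℝ} {C h K : ℝ} (hf : UniformCovering S f C h)
    (hm : ∀ p, Measurable fun b => f b p) (hK : ∀ b, ∀ p ∈ S, |f b p| ≤ K) (hC : 0 ≤ C)
    {φ : ι → S → 𝒪 → ℝ} {c : ℝ} (hc : 0 ≤ c) (β : 𝒪 → 𝓑)
    (hφ : ∀ i (p p' : S) o, |φ i p o - φ i p' o| ≤ c * |f (β o) p - f (β o) p'|)
    {ε : ℝ} (hε : 0 < ε) (hε1 : ε < 1) :
    HasEmpiricalNet φ (C * (1 / ε) ^ h) (4 * c * (Fintype.card ι * ε)) := by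
  intro x x'
  -- The two samples are pooled into `2 * card ι` points, which together with the doubled radius
  -- accounts for the constant 4.
  obtain ⟨F, hF, h⟩ := hf.exists_net hm hK (Sum.elim (fun i => β (x i)) (fun i => β (x' i))) hε hε1 hC
  refine ⟨F, hF, fun p => ?_⟩
  obtain ⟨p', hp', h⟩ := h p
  refine ⟨p', hp', ?_⟩
  rw [Fintype.sum_sum_type, ← Finset.sum_add_distrib] at h
  simp only [Sum.elim_inl, Sum.elim_inr, Fintype.card_sum] at h
  calc _ ≤ ∑ i, c * (|f (β (x i)) p - f (β (x i)) p'| + |f (β (x' i)) p - f (β (x' i)) p'|) := by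
        refine Finset.sum_le_sum fun i _ => ?_
        rw [mul_add]
        exact add_le_add (hφ _ _ _ _) (hφ _ _ _ _)
    _ ≤ _ := by
        rw [← Finset.mul_sum]
        refine (mul_le_mul_of_nonneg_left h hc).trans_eq ?_
        push_cast; ring

end Net

/-! ### Selected sums over a fold, given the data outside it. -/

section FoldSum

variable {ι 𝒪 Θ : Type*} [Fintype ι] [MeasurableSpace 𝒪] [MeasurableSpace Θ]
  (μ : Measure 𝒪) [IsProbabilityMeasure μ]

/-- The centred sum over `I` of functions that are fitted outside of `I`, at a selected index. -/
noncomputable def foldSum (I : Finset ι) (φ : (ι → 𝒪) → Θ → 𝒪 → ℝ) (q : (ι → 𝒪) → Θ)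
    (O : ι → 𝒪) : ℝ :=
  ∑ i ∈ I, (φ O (q O) (O i) - ∫ o, φ O (q O) o ∂μ)

lemma measurable_foldSum {I : Finset ι} {φ : (ι → 𝒪) → Θ → 𝒪 → ℝ}
    (hφ : Measurable fun z : ((ι → 𝒪) × Θ) × 𝒪 => φ z.1.1 z.1.2 z.2) {q : (ι → 𝒪) → Θ}
    (hq : Measurable q) : Measurable (foldSum μ I φ q) := by
  have hOq : Measurable fun O : ι → 𝒪 => (O, q O) := measurable_id.prodMk hq
  refine Finset.measurable_fun_sum _ fun i _ => Measurable.sub ?_ ?_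
  · exact hφ.comp (hOq.prodMk (measurable_pi_apply i))
  · exact (hφ.stronglyMeasurable.integral_prod_right' (ν := μ)).measurable.comp hOq

/-- With the data outside `I` frozen, the family `φ` is fixed and only the selected index still
depends on the coordinates in `I`, which `selSum` permits. Functions are set to zero outside `I` so
that the sum runs over the whole index type. -/
lemma lintegral_abs_foldSum_le [DecidableEq ι] {I : Finset ι} {φ : (ι → 𝒪) → Θ → 𝒪 → ℝ}
    (hφ : Measurable fun z : ((ι → 𝒪) × Θ) × 𝒪 => φ z.1.1 z.1.2 z.2) (hI : InvariantOn I φ)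
    {K : ℝ} (hK : ∀ O θ o, |φ O θ o| ≤ K) {q : (ι → 𝒪) → Θ} (hq : Measurable q) {B : ℝ}
    (hB : ∀ O q', Measurable q' →
      ∫ O', |selSum μ (fun i θ o => if i ∈ I then φ O θ o else 0) q' O'|
        ∂(Measure.pi fun _ : ι => μ) ≤ B) :
    ∫⁻ O, ENNReal.ofReal |foldSum μ I φ q O| ∂(Measure.pi fun _ : ι => μ) ≤ ENNReal.ofReal B := by
  rw [lintegral_merge μ I (f := fun O => ENNReal.ofReal |foldSum μ I φ q O|)
    (ENNReal.measurable_ofReal.comp (measurable_foldSum μ hφ hq).abs)]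
  refine (lintegral_mono (g := fun _ => ENNReal.ofReal B) fun O => ?_).trans (by simp)
  set q' : (ι → 𝒪) → Θ := fun O' => q (merge I O' O)
  have hq' : Measurable q' := hq.comp ((measurable_merge I).comp (measurable_id.prodMk measurable_const))
  set φ' : ι → Θ → 𝒪 → ℝ := fun i θ o => if i ∈ I then φ O θ o else 0
  have hφ' : ∀ i, Measurable fun z : Θ × 𝒪 => φ' i z.1 z.2 := fun i => by
    by_cases h : i ∈ I
    · simp only [φ', h, if_true]
      exact hφ.comp ((measurable_const.prodMk measurable_fst).prodMk measurable_snd)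
    · simp only [φ', h, if_false]
      exact measurable_const
  have hK' : ∀ i θ o, |φ' i θ o| ≤ |K| := fun i θ o => by
    by_cases h : i ∈ I
    · simpa only [φ', h, if_true] using (hK O θ o).trans (le_abs_self K)
    · simp [φ', h]
  have e : ∀ O', foldSum μ I φ q (merge I O' O) = selSum μ φ' q' O' := fun O' => by
    unfold foldSum selSum
    rw [hI.merge_eq, ← Finset.sum_subset (Finset.subset_univ I)]
    · refine Finset.sum_congr rfl fun i hi => ?_
      simp [φ', hi, q', merge]
    · intro i _ hi
      simp [φ', hi]
  simp_rw [e]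
  have hint : Integrable (fun O' => |selSum μ φ' q' O'|) (Measure.pi fun _ : ι => μ) := by
    refine (Integrable.of_bound (measurable_selSum μ hφ' hq').aestronglyMeasurable
        (∑ _i : ι, (|K| + |K|)) (ae_of_all _ fun O => ?_)).abs
    refine (norm_sum_le _ _).trans (Finset.sum_le_sum fun i _ => ?_)
    refine (norm_sub_le _ _).trans (add_le_add (hK' _ _ _) ?_)
    simpa using norm_integral_le_of_norm_le_const (μ := μ) (f := fun o => φ' i (q' O) o) (C := |K|)
      (ae_of_all _ fun o => hK' i (q' O) o)
  rw [← ofReal_integral_eq_lintegral_ofReal hint (ae_of_all _ fun _ => abs_nonneg _)]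
  exact ENNReal.ofReal_le_ofReal (hB O q' hq')

end FoldSum

/-! ### Tuning of the maximal inequalities, in powers of `n^{1/8}`. -/

section Rates

/-- The eighth root of a natural number. -/
noncomputable def eighthRoot (n : ℕ) : ℝ := (n : ℝ) ^ (1 / 8 : ℝ)

lemma eighthRoot_nonneg (n : ℕ) : 0 ≤ eighthRoot n := by unfold eighthRoot; positivity

lemma eighthRoot_pow (n : ℕ) : eighthRoot n ^ 8 = n := by
  unfold eighthRoot
  rw [← Real.rpow_natCast, ← Real.rpow_mul (by positivity)]
  norm_num

lemma sqrt_eq_eighthRoot (n : ℕ) : √(n : ℝ) = eighthRoot n ^ 4 := by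
  rw [← eighthRoot_pow, show eighthRoot n ^ 8 = (eighthRoot n ^ 4) ^ 2 by ring]
  exact Real.sqrt_sq (by have := eighthRoot_nonneg n; positivity)

lemma eighthRoot_pos {n : ℕ} (hn : 0 < n) : 0 < eighthRoot n := by unfold eighthRoot; positivity

lemma tendsto_eighthRoot : Tendsto eighthRoot atTop atTop :=
  (tendsto_rpow_atTop (by norm_num)).comp tendsto_natCast_atTop_atTop

lemma tendsto_inv_eighthRoot : Tendsto (fun n => (eighthRoot n)⁻¹) atTop (𝓝 0) :=
  tendsto_inv_atTop_zero.comp tendsto_eighthRoot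

/-- A net of polynomial size costs only a logarithm, which any power of `n` beats. -/
lemma tendsto_log_div_eighthRoot {C h : ℝ} (hC : 0 < C) :
    Tendsto (fun n : ℕ => Real.log (2 * (C * (n : ℝ) ^ h)) * (eighthRoot n)⁻¹) atTop (𝓝 0) := by
  have h1 : Tendsto (fun n => Real.log (2 * C) * (eighthRoot n)⁻¹
      + 8 * h * (Real.log (eighthRoot n) / eighthRoot n)) atTop (𝓝 0) := by
    have := (tendsto_inv_eighthRoot.const_mul (Real.log (2 * C))).add
      (((Real.isLittleO_log_id_atTop.tendsto_div_nhds_zero).comp tendsto_eighthRoot).const_mul (8 * h))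
    simpa using this
  refine h1.congr' ?_
  filter_upwards [eventually_gt_atTop 0] with n hn
  have hu := eighthRoot_pos hn
  have e : (2 * (C * (n : ℝ) ^ h)) = 2 * C * (n : ℝ) ^ h := by ring
  have e2 : Real.log (n : ℝ) = 8 * Real.log (eighthRoot n) := by
    conv_lhs => rw [← eighthRoot_pow n]
    rw [Real.log_pow]; norm_num
  rw [e, Real.log_mul (x := 2 * C) (by positivity) (by positivity), Real.log_rpow (by positivity), e2]
  field_simp

variable (C h K η l : ℝ)

/-- The normalized crude bound for the sample size `n`. -/
noncomputable def crudeRate (n : ℕ) : ℝ :=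
  eighthRoot n ^ 2 / n * (Real.log (2 * (C * (n : ℝ) ^ h)) / (eighthRoot n)⁻¹ ^ 4
    + (1 + 2 * K * (eighthRoot n)⁻¹ ^ 4) * η + 2 * (eighthRoot n)⁻¹ ^ 4 * K ^ 2 * n)

/-- The normalized fine bound for the sample size `n`. -/
noncomputable def fineRate (n : ℕ) : ℝ :=
  eighthRoot n ^ 4 / n * (Real.log (2 * (C * (n : ℝ) ^ h)) / (eighthRoot n)⁻¹ ^ 3
    + (1 + 2 * K * (eighthRoot n)⁻¹ ^ 3) * η + (eighthRoot n)⁻¹ ^ 3 / 2 *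
      (4 * (n * (l * (eighthRoot n)⁻¹ ^ 2)) +
        2 * (Real.log (2 * (C * (n : ℝ) ^ h)) / (eighthRoot n)⁻¹ ^ 4
          + (1 + 2 * K ^ 2 * (eighthRoot n)⁻¹ ^ 4) * (2 * K * η)
          + 2 * (eighthRoot n)⁻¹ ^ 4 * (K ^ 2) ^ 2 * n)))

variable {C h K η l}

/-- The choice `t = n^{-1/2}` balances `log n / t` against `t n`. Both are of order `√n` up to the
logarithm, hence `o(n^{3/4})`. -/
lemma tendsto_crudeRate (hC : 0 < C) : Tendsto (crudeRate C h K η) atTop (𝓝 0) := by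
  have hv := tendsto_inv_eighthRoot
  have hl := tendsto_log_div_eighthRoot (h := h) hC
  have hp : Tendsto (fun p : ℝ × ℝ => p.2 * p.1 + (1 + 2 * K * p.1 ^ 4) * η * p.1 ^ 6
      + 2 * K ^ 2 * p.1 ^ 2) (𝓝 (0, 0)) (𝓝 0) :=
    (Continuous.tendsto' (by fun_prop) _ _ (by simp))
  refine (hp.comp (hv.prodMk_nhds hl)).congr' ?_
  filter_upwards [eventually_gt_atTop 0] with n hn
  have hu := eighthRoot_pos hn
  simp only [Function.comp_apply, crudeRate]
  set ℓ := Real.log (2 * (C * (n : ℝ) ^ h))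
  have hn8 := eighthRoot_pow n
  set u := eighthRoot n
  rw [← hn8]
  field_simp

/-- For second moments of order `n^{-1/4}`, the choice `t = n^{-3/8}` makes `log n / t` and `t n δ`
of order `n^{3/8}` up to the logarithm, hence `o(√n)`. With `t' = n^{-1/2}` the correction for the
squares is of order `√n log n`, and its weight `t` reduces it to `n^{1/8} log n`. -/
lemma tendsto_fineRate (hC : 0 < C) : Tendsto (fineRate C h K η l) atTop (𝓝 0) := by
  have hv := tendsto_inv_eighthRoot
  have hl := tendsto_log_div_eighthRoot (h := h) hC
  have hp : Tendsto (fun p : ℝ × ℝ => p.2 + (1 + 2 * K * p.1 ^ 3) * η * p.1 ^ 4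
      + 2 * l * p.1 + p.2 * p.1 ^ 2 + p.1 ^ 7 * (1 + 2 * K ^ 2 * p.1 ^ 4) * (2 * K * η)
      + 2 * K ^ 4 * p.1 ^ 3) (𝓝 (0, 0)) (𝓝 0) :=
    (Continuous.tendsto' (by fun_prop) _ _ (by simp))
  refine (hp.comp (hv.prodMk_nhds hl)).congr' ?_
  filter_upwards [eventually_gt_atTop 0] with n hn
  have hu := eighthRoot_pos hn
  simp only [Function.comp_apply, fineRate]
  set ℓ := Real.log (2 * (C * (n : ℝ) ^ h))
  have hn8 := eighthRoot_pow n
  set u := eighthRoot n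
  rw [← hn8]
  field_simp
  ring

end Rates

/-! ### Stochastic equicontinuity at estimated cutoffs. -/

section Equicontinuity

variable {Ω 𝒳 𝓑 : Type*} {J : ℕ} [MeasurableSpace Ω] [MeasurableSpace 𝒳] [MeasurableSpace 𝓑]
  {P : Measure Ω} [IsProbabilityMeasure P] {D : Sample Ω 𝒳 𝓑}

/-- A scalar response `a(b, p)` to which empirical process theory applies. -/
structure RegularResponse (D : Sample Ω 𝒳 𝓑) (P : Measure Ω) (S : Set (Vec J))
    (a : 𝓑 → Vec J → ℝ) : Prop where
  measurable : Measurable fun q : 𝓑 × Vec J => a q.1 q.2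
  covering : ∃ h C : ℝ, 0 < C ∧ UniformCovering S a C h
  bounded : ∃ K : ℝ, 0 ≤ K ∧ ∀ b, ∀ p ∈ S, |a b p| ≤ K
  weakly_continuous : ∃ l : ℝ, 0 < l ∧ ∀ p ∈ S, ∀ p' ∈ S, ∀ w,
    ∫ ω, (a (D.B 0 w ω) p - a (D.B 0 w ω) p') ^ 2 ∂P ≤ l * ‖p - p'‖

/-- The increment between the cutoffs `pst` and `p` of a response, weighted by `1(W = w) g(X)`. -/
noncomputable def incr (w : Bool) (a : 𝓑 → Vec J → ℝ) (pst : Vec J) (g : 𝒳 → ℝ) (p : Vec J)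
    (o : Obs 𝒳 𝓑) : ℝ :=
  (if o.2.2.2 = w then g o.1 else 0) * (a (subOf w o) p - a (subOf w o) pst)

variable {S : Set (Vec J)} {a : 𝓑 → Vec J → ℝ} {pst : Vec J} {w : Bool} {H : ℝ}

lemma RegularResponse.measurable_sub (ha : RegularResponse D P S a) (p : Vec J) (w : Bool) :
    Measurable fun o : Obs 𝒳 𝓑 => a (subOf w o) p :=
  ha.measurable.comp ((measurable_subOf w).prodMk measurable_const)

lemma measurable_ite_trt {α : Type*} [MeasurableSpace α] (w : Bool) {W : α → Bool} {f g : α → ℝ}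
    (hW : Measurable W) (hf : Measurable f) (hg : Measurable g) :
    Measurable fun a => if W a = w then f a else g a :=
  Measurable.ite (hW (measurableSet_singleton w)) hf hg

lemma RegularResponse.measurable_incr (ha : RegularResponse D P S a) {α : Type*}
    [MeasurableSpace α] {T : Set (Vec J)} {g : α → 𝒳 → ℝ} (hg : Measurable fun z : α × 𝒳 => g z.1 z.2) :
    Measurable fun z : (α × T) × Obs 𝒳 𝓑 => incr w a pst (g z.1.1) z.1.2 z.2 := by
  refine Measurable.mul (measurable_ite_trt w (by fun_prop) ?_ measurable_const)
    (Measurable.sub ?_ ?_)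
  · exact hg.comp (((measurable_fst.comp measurable_fst)).prodMk (measurable_fst.comp measurable_snd))
  · exact ha.measurable.comp (((measurable_subOf w).comp measurable_snd).prodMk (by fun_prop))
  · exact (ha.measurable_sub pst w).comp measurable_snd

lemma abs_incr_sub_le {g : 𝒳 → ℝ} (hg : ∀ x, |g x| ≤ H) (p p' : Vec J) (o : Obs 𝒳 𝓑) :
    |incr w a pst g p o - incr w a pst g p' o| ≤ H * |a (subOf w o) p - a (subOf w o) p'| := by
  unfold incr
  rw [← mul_sub, abs_mul, sub_sub_sub_cancel_right]
  gcongr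
  split_ifs
  · exact hg _
  · simpa using (abs_nonneg _).trans (hg o.1)

lemma abs_incr_le {g : 𝒳 → ℝ} (hg : ∀ x, |g x| ≤ H) (p : Vec J) (o : Obs 𝒳 𝓑) :
    |incr w a pst g p o| ≤ H * |a (subOf w o) p - a (subOf w o) pst| := by
  have := abs_incr_sub_le (w := w) (a := a) (pst := pst) hg p pst o
  simpa [incr] using this

lemma integral_law (hD : IIDSample D P) {f : Obs 𝒳 𝓑 → ℝ} (hf : Measurable f) :
    ∫ o, f o ∂(D.law P) = ∫ ω, f (D.obs 0 ω) ∂P :=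
  integral_map (hD.measurable_obs 0).aemeasurable hf.aestronglyMeasurable

/-- The weight is at most `H`, so weak continuity makes the second moment linear in the distance of
the cutoffs. All of the gain from localization comes from here. -/
lemma RegularResponse.integral_incr_sq_le (ha : RegularResponse D P S a) (hD : IIDSample D P)
    (hpst : pst ∈ S) {l : ℝ} (hl : ∀ p ∈ S, ∀ p' ∈ S, ∀ w,
    ∫ ω, (a (D.B 0 w ω) p - a (D.B 0 w ω) p') ^ 2 ∂P ≤ l * ‖p - p'‖)
    {g : 𝒳 → ℝ} (hg : ∀ x, |g x| ≤ H) {p : Vec J} (hp : p ∈ S) :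
    ∫ o, incr w a pst g p o ^ 2 ∂(D.law P) ≤ H ^ 2 * (l * ‖p - pst‖) := by
  have := hD.isProbabilityMeasure_law
  obtain ⟨K, hK0, hK⟩ := ha.bounded
  have hm : Measurable fun o : Obs 𝒳 𝓑 => (a (subOf w o) p - a (subOf w o) pst) ^ 2 :=
    ((ha.measurable_sub p w).sub (ha.measurable_sub pst w)).pow_const 2
  have hle : ∀ o : Obs 𝒳 𝓑, incr w a pst g p o ^ 2 ≤ H ^ 2 * (a (subOf w o) p - a (subOf w o) pst) ^ 2 := by
    intro o
    rw [← mul_pow, ← sq_abs]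
    have h1 := abs_incr_le (w := w) (a := a) (pst := pst) hg p o
    calc |incr w a pst g p o| ^ 2 ≤ (H * |a (subOf w o) p - a (subOf w o) pst|) ^ 2 :=
          pow_le_pow_left₀ (abs_nonneg _) h1 2
      _ = _ := by rw [mul_pow, sq_abs, mul_pow]
  have hint : Integrable (fun o : Obs 𝒳 𝓑 => H ^ 2 * (a (subOf w o) p - a (subOf w o) pst) ^ 2)
      (D.law P) := by
    refine (Integrable.of_bound hm.aestronglyMeasurable ((K + K) ^ 2) (ae_of_all _ fun o => ?_)).const_mul _
    rw [norm_pow]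
    exact pow_le_pow_left₀ (norm_nonneg _)
      ((norm_sub_le _ _).trans (add_le_add (hK _ _ hp) (hK _ _ hpst))) 2
  refine (integral_mono_of_nonneg (ae_of_all _ fun o => sq_nonneg _) hint (ae_of_all _ hle)).trans ?_
  rw [integral_const_mul]
  gcongr
  rw [integral_law hD hm]
  simp_rw [subOf_obs]
  exact hl p hp pst hpst w

open Classical in
/-- The random vector `r` where it lies in `T`, and `p` elsewhere. -/
noncomputable def clip {α : Type*} {T : Set (Vec J)} {p : Vec J} (hp : p ∈ T) (r : α → Vec J) (x : α) : T :=
  if h : r x ∈ T then ⟨r x, h⟩ else ⟨p, hp⟩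

lemma clip_of_mem {α : Type*} {T : Set (Vec J)} {p : Vec J} (hp : p ∈ T) (r : α → Vec J) {x : α}
    (h : r x ∈ T) : (clip hp r x : Vec J) = r x := by
  simp [clip, h]

lemma measurable_clip {α : Type*} [MeasurableSpace α] {T : Set (Vec J)} {p : Vec J} (hp : p ∈ T)
    {r : α → Vec J} (hr : Measurable r) (hT : MeasurableSet {x | r x ∈ T}) :
    Measurable (clip hp r) := by
  classical
  have : Measurable fun x => (clip hp r x : Vec J) := by
    have e : (fun x => (clip hp r x : Vec J)) = fun x => if r x ∈ T then r x else p := by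
      ext1 x
      by_cases h : r x ∈ T <;> simp [clip, h]
    rw [e]
    exact Measurable.ite hT hr measurable_const
  exact this.subtype_mk (h := fun x => (clip hp r x).2)

variable {k : Fin 3} {g : ∀ n, Split n → (Fin n → Obs 𝒳 𝓑) → 𝒳 → ℝ}

/-- The centred empirical process of the members of fold `k` at selected cutoffs. -/
noncomputable def foldFluct (D : Sample Ω 𝒳 𝓑) (P : Measure Ω) (S : Set (Vec J)) (w : Bool)
    (a : 𝓑 → Vec J → ℝ) (pst : Vec J) (k : Fin 3)
    (g : ∀ n, Split n → (Fin n → Obs 𝒳 𝓑) → 𝒳 → ℝ) (q : ∀ n, Split n → (Fin n → Obs 𝒳 𝓑) → S)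
    (n : ℕ) (s : Split n) : (Fin n → Obs 𝒳 𝓑) → ℝ :=
  foldSum (D.law P) (s.fold k) (fun O (p : S) o => incr w a pst (g n s O) p o) (q n s)

/-- It reduces a bound on the fluctuation to one for a frozen family `φ`. The hypothesis `hB`
receives what the maximal inequalities need of `φ`: measurability, an envelope, domination by the
response (for the net) and second moments. -/
lemma RegularResponse.lintegral_foldFluct_le (ha : RegularResponse D P S a) (hD : IIDSample D P)
    (hpst : pst ∈ S) {K : ℝ} (hK : ∀ b, ∀ p ∈ S, |a b p| ≤ K)
    (hg : ∀ n s, Measurable fun z : (Fin n → Obs 𝒳 𝓑) × 𝒳 => g n s z.1 z.2)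
    (hgI : ∀ n s, InvariantOn (s.fold k) (g n s)) (hgH : ∀ n s O x, |g n s O x| ≤ H)
    {q : ∀ n, Split n → (Fin n → Obs 𝒳 𝓑) → S} (hq : ∀ n s, Measurable (q n s))
    {n : ℕ} {s : Split n} {B : ℝ} (hH : 0 ≤ H)
    (hB : ∀ φ : Fin n → S → Obs 𝒳 𝓑 → ℝ, (∀ i, Measurable fun z : S × Obs 𝒳 𝓑 => φ i z.1 z.2) →
      (∀ i p o, |φ i p o| ≤ 2 * (H * K)) →
      (∀ i (p p' : S) o, |φ i p o - φ i p' o| ≤ H * |a (subOf w o) p - a (subOf w o) p'|) →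
      (∀ i (p : S), ∀ l, (∀ p ∈ S, ∀ p' ∈ S, ∀ w,
        ∫ ω, (a (D.B 0 w ω) p - a (D.B 0 w ω) p') ^ 2 ∂P ≤ l * ‖p - p'‖) → 0 ≤ l →
        ∫ o, φ i p o ^ 2 ∂(D.law P) ≤ H ^ 2 * (l * ‖(p : Vec J) - pst‖)) →
      ∀ q' : (Fin n → Obs 𝒳 𝓑) → S, Measurable q' →
      ∫ O', |selSum (D.law P) φ q' O'| ∂(Measure.pi fun _ : Fin n => D.law P) ≤ B) :
    ∫⁻ O, ENNReal.ofReal |foldFluct D P S w a pst k g q n s O|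
      ∂(Measure.pi fun _ : Fin n => D.law P) ≤ ENNReal.ofReal B := by
  have := hD.isProbabilityMeasure_law
  have hφ : Measurable fun z : ((Fin n → Obs 𝒳 𝓑) × S) × Obs 𝒳 𝓑 =>
      incr w a pst (g n s z.1.1) (z.1.2 : Vec J) z.2 := ha.measurable_incr (hg n s)
  have hbd : ∀ O (p : S) o, |incr w a pst (g n s O) (p : Vec J) o| ≤ 2 * (H * K) := fun O p o => by
    refine (abs_incr_le (hgH n s O) (p : Vec J) o).trans ?_
    have : |a (subOf w o) p - a (subOf w o) pst| ≤ 2 * K :=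
      (abs_sub _ _).trans (by linarith [hK (subOf w o) p p.2, hK (subOf w o) pst hpst])
    nlinarith
  -- The sign of `K` can be read off only if there is a submission to evaluate at; with no
  -- observations there is nothing to prove.
  have hK0 : 0 ≤ H * K ∨ IsEmpty (Obs 𝒳 𝓑) := by
    rcases isEmpty_or_nonempty (Obs 𝒳 𝓑) with h | ⟨⟨o⟩⟩
    · exact Or.inr h
    · exact Or.inl (mul_nonneg hH ((abs_nonneg _).trans (hK (subOf w o) pst hpst)))
  refine lintegral_abs_foldSum_le (D.law P) hφ ?_ hbd (hq n s) fun O q' hq' => hB _ ?_ ?_ ?_ ?_ q' hq'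
  · intro O O' h
    simp only [hgI n s O O' h]
  · intro i
    by_cases h : i ∈ s.fold k
    · simp only [h, if_true]
      exact hφ.comp ((measurable_const.prodMk measurable_fst).prodMk measurable_snd)
    · simp only [h, if_false]
      exact measurable_const
  · intro i p o
    by_cases h : i ∈ s.fold k
    · simpa only [h, if_true] using hbd O p o
    · simp only [h, if_false, abs_zero]
      rcases hK0 with h | h
      · linarith
      · exact h.elim o
  · intro i p p' o
    by_cases h : i ∈ s.fold k
    · simpa only [h, if_true] using abs_incr_sub_le (hgH n s O) _ _ o
    · simp only [h, if_false, sub_zero, abs_zero]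
      positivity
  · intro i p l hl hl0
    by_cases h : i ∈ s.fold k
    · simpa only [h, if_true] using ha.integral_incr_sq_le hD hpst hl (hgH n s O) p.2
    · simp only [h, if_false]
      simp
      positivity

lemma RegularResponse.measurable_foldFluct (ha : RegularResponse D P S a) (hD : IIDSample D P)
    (hg : ∀ n s, Measurable fun z : (Fin n → Obs 𝒳 𝓑) × 𝒳 => g n s z.1 z.2)
    {q : ∀ n, Split n → (Fin n → Obs 𝒳 𝓑) → S} (hq : ∀ n s, Measurable (q n s)) (n : ℕ)
    (s : Split n) : Measurable (foldFluct D P S w a pst k g q n s) := by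
  have := hD.isProbabilityMeasure_law
  exact measurable_foldSum (D.law P) (ha.measurable_incr (hg n s)) (hq n s)

lemma negl_of_lintegral_data (hD : IIDSample D P) {G : ∀ n, Split n → (Fin n → Obs 𝒳 𝓑) → ℝ}
    (hG : ∀ n s, Measurable (G n s)) {c B : ℕ → ℝ} (hc : ∀ n, 0 ≤ c n)
    (hB : ∀ᶠ n in atTop, ∀ s, ∫⁻ O, ENNReal.ofReal |G n s O|
      ∂(Measure.pi fun _ : Fin n => D.law P) ≤ ENNReal.ofReal (B n))
    (hlim : Tendsto (fun n => c n * B n) atTop (𝓝 0)) :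
    Negl P fun n ω => c n * G n (D.split n ω) (D.vec n ω) := by
  refine Negl.of_lintegral (fun n => (hD.measurable_comp (hG n)).const_mul _) hlim ?_
  filter_upwards [hB] with n hn
  have e : ∀ ω, ENNReal.ofReal |c n * G n (D.split n ω) (D.vec n ω)|
      = ENNReal.ofReal (c n) * ENNReal.ofReal |G n (D.split n ω) (D.vec n ω)| := fun ω => by
    rw [abs_mul, abs_of_nonneg (hc n), ENNReal.ofReal_mul (hc n)]
  simp_rw [e]
  rw [lintegral_const_mul' _ _ ENNReal.ofReal_ne_top, ENNReal.ofReal_mul (hc n)]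
  gcongr
  exact hD.lintegral_comp_le (F := fun s O => ENNReal.ofReal |G n s O|)
    (fun s => ENNReal.measurable_ofReal.comp (hG n s).abs) hn

/-- Without any localization of `q`, the fluctuation divided by `n` is `o_p(n^{-1/4})`. -/
theorem RegularResponse.negl_foldFluct_crude (ha : RegularResponse D P S a) (hD : IIDSample D P)
    (hpst : pst ∈ S)
    (hg : ∀ n s, Measurable fun z : (Fin n → Obs 𝒳 𝓑) × 𝒳 => g n s z.1 z.2)
    (hgI : ∀ n s, InvariantOn (s.fold k) (g n s)) (hgH : ∀ n s O x, |g n s O x| ≤ H) (hH : 0 ≤ H)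
    {q : ∀ n, Split n → (Fin n → Obs 𝒳 𝓑) → S} (hq : ∀ n s, Measurable (q n s)) :
    Negl P fun n ω => eighthRoot n ^ 2 / n *
      foldFluct D P S w a pst k g q n (D.split n ω) (D.vec n ω) := by
  have := hD.isProbabilityMeasure_law
  obtain ⟨K, hK0, hK⟩ := ha.bounded
  obtain ⟨h, C, hC, hcov⟩ := ha.covering
  refine negl_of_lintegral_data hD (fun n s => ha.measurable_foldFluct hD hg hq n s)
    (fun n => by have := eighthRoot_nonneg n; positivity) ?_
    (tendsto_crudeRate (C := C) (h := h) (K := 2 * (H * K)) (η := 4 * H) hC)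
  filter_upwards [eventually_gt_atTop 1] with n hn s
  have hn0 : (0 : ℝ) < n := by positivity
  have : Nonempty (Fin n) := ⟨⟨0, by omega⟩⟩
  refine ha.lintegral_foldFluct_le hD hpst hK hg hgI hgH hq hH fun φ h1 h2 h3 h4 q' hq' => ?_
  -- At resolution `1 / n` the total net error is the constant `4H`, and the net has at most `C n^h`
  -- points.
  have hnet := hcov.hasEmpiricalNet (fun p => ha.measurable.comp (measurable_id.prodMk measurable_const))
    hK hC.le hH (subOf w) h3 (ε := 1 / n) (by positivity)
    (by rw [div_lt_one hn0]; exact_mod_cast hn)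
  rw [one_div_one_div, Fintype.card_fin, mul_one_div_cancel hn0.ne', mul_one] at hnet
  have hv : 0 < (eighthRoot n)⁻¹ ^ 4 := by have := eighthRoot_pos (n := n) (by omega); positivity
  have := integral_abs_selSum_le_crude (D.law P) h1 hq' (by positivity) h2 hv hnet
  rwa [Fintype.card_fin] at this

/-- For `q` within `n^{-1/4}` of `pst` the second moments are at most `H² l n^{-1/4}`, and the
fluctuation divided by `n` is `o_p(n^{-1/2})`. -/
theorem RegularResponse.negl_foldFluct_fine (ha : RegularResponse D P S a) (hD : IIDSample D P)
    (hpst : pst ∈ S)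
    (hg : ∀ n s, Measurable fun z : (Fin n → Obs 𝒳 𝓑) × 𝒳 => g n s z.1 z.2)
    (hgI : ∀ n s, InvariantOn (s.fold k) (g n s)) (hgH : ∀ n s O x, |g n s O x| ≤ H) (hH : 0 ≤ H)
    {q : ∀ n, Split n → (Fin n → Obs 𝒳 𝓑) → S} (hq : ∀ n s, Measurable (q n s))
    (hqr : ∀ n s O, ‖(q n s O : Vec J) - pst‖ ≤ (eighthRoot n)⁻¹ ^ 2) :
    Negl P fun n ω => eighthRoot n ^ 4 / n *
      foldFluct D P S w a pst k g q n (D.split n ω) (D.vec n ω) := by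
  have := hD.isProbabilityMeasure_law
  obtain ⟨K, hK0, hK⟩ := ha.bounded
  obtain ⟨h, C, hC, hcov⟩ := ha.covering
  obtain ⟨l, hl0, hl⟩ := ha.weakly_continuous
  refine negl_of_lintegral_data hD (fun n s => ha.measurable_foldFluct hD hg hq n s)
    (fun n => by have := eighthRoot_nonneg n; positivity) ?_
    (tendsto_fineRate (C := C) (h := h) (K := 2 * (H * K)) (η := 4 * H) (l := H ^ 2 * l) hC)
  filter_upwards [eventually_gt_atTop 1] with n hn s
  have hn0 : (0 : ℝ) < n := by positivity
  have : Nonempty (Fin n) := ⟨⟨0, by omega⟩⟩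
  have hv : 0 < (eighthRoot n)⁻¹ := by have := eighthRoot_pos (n := n) (by omega); positivity
  -- The index set is restricted to the ball, so that the second-moment bound is uniform over it.
  -- External covering numbers are monotone in the set, so the restricted class keeps the same `C`
  -- and `h`.
  set T : Set (Vec J) := S ∩ {p | ‖p - pst‖ ≤ (eighthRoot n)⁻¹ ^ 2} with hT
  have hTS : T ⊆ S := Set.inter_subset_left
  have hpT : pst ∈ T := ⟨hpst, by simp; positivity⟩
  have hcovT : UniformCovering T a C h := fun Q _ hQ ε h0 h1 => le_trans (by
      have := Metric.externalCoveringNumber_mono_set (ε := ε)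
        (show {g : Lp ℝ 2 Q | ∃ p ∈ T, g =ᵐ[Q] fun b => a b p} ⊆
          {g : Lp ℝ 2 Q | ∃ p ∈ S, g =ᵐ[Q] fun b => a b p} from
          fun g ⟨p, hp, hg⟩ => ⟨p, hTS hp, hg⟩)
      exact_mod_cast this) (hcov Q hQ ε h0 h1)
  have haT : RegularResponse D P T a := ⟨ha.measurable, ⟨h, C, hC, hcovT⟩,
    ⟨K, hK0, fun b p hp => hK b p (hTS hp)⟩,
    ⟨l, hl0, fun p hp p' hp' => hl p (hTS hp) p' (hTS hp')⟩⟩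
  -- `foldFluct` takes a selection for every sample size, whereas `T` is the ball for the present
  -- `n`. Clipping keeps the other sizes inside `T` and changes nothing at size `n`.
  set qT : ∀ m, Split m → (Fin m → Obs 𝒳 𝓑) → T := fun m s => clip hpT fun O => (q m s O : Vec J)
    with hqT
  have hqTm : ∀ m s, Measurable (qT m s) := fun m s => by
    refine measurable_clip hpT (measurable_subtype_coe.comp (hq m s)) ?_
    have : {O | (q m s O : Vec J) ∈ T} = {O | ‖(q m s O : Vec J) - pst‖ ≤ (eighthRoot n)⁻¹ ^ 2} := by
      ext O; simp [hT]
    rw [this]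
    exact measurableSet_le ((measurable_subtype_coe.comp (hq m s)).sub_const pst).norm measurable_const
  have e : ∀ O, foldFluct D P S w a pst k g q n s O = foldFluct D P T w a pst k g qT n s O := by
    intro O
    have : (qT n s O : Vec J) = q n s O := clip_of_mem hpT _ ⟨(q n s O).2, hqr n s O⟩
    simp only [foldFluct, foldSum, this]
  simp_rw [e]
  refine haT.lintegral_foldFluct_le hD hpT (fun b p hp => hK b p (hTS hp)) hg hgI hgH hqTm hH
    fun φ h1 h2 h3 h4 q' hq' => ?_
  have hnet := hcovT.hasEmpiricalNet
    (fun p => ha.measurable.comp (measurable_id.prodMk measurable_const))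
    (fun b p hp => hK b p (hTS hp)) hC.le hH (subOf w) h3 (ε := 1 / n) (by positivity)
    (by rw [div_lt_one hn0]; exact_mod_cast hn)
  rw [one_div_one_div, Fintype.card_fin, mul_one_div_cancel hn0.ne', mul_one] at hnet
  have := integral_abs_selSum_le_fine (D.law P) (t := (eighthRoot n)⁻¹ ^ 3)
    (t' := (eighthRoot n)⁻¹ ^ 4) (δ := H ^ 2 * l * (eighthRoot n)⁻¹ ^ 2) h1 hq' (by positivity) h2
    (by positivity) (by positivity) hnet fun i p =>
      (h4 i p l (fun p hp p' hp' => hl p (hTS hp) p' (hTS hp')) hl0.le).trans (by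
        rw [mul_assoc]
        gcongr
        exact p.2.2)
  rwa [Fintype.card_fin] at this

end Equicontinuity

/-! ### Unconfoundedness as an identity of integrals, and uniform overlap. -/

section Population

variable {Ω 𝒳 𝓑 : Type*} {J : ℕ} [MeasurableSpace Ω] [MeasurableSpace 𝒳] [MeasurableSpace 𝓑]
  {P : Measure Ω} [IsProbabilityMeasure P] {D : Sample Ω 𝒳 𝓑} {M : Mechanism 𝓑 J}
  {R : Regressions 𝒳 J}

/-- The probability of treatment `w` if treatment has probability `e`. -/
def armProb (w : Bool) (e : ℝ) : ℝ := if w then e else 1 - e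

@[fun_prop]
lemma measurable_armProb (w : Bool) : Measurable (armProb w) := by
  cases w
  · exact measurable_const.sub measurable_id
  · exact measurable_id

lemma armProb_sub (w : Bool) (e e' : ℝ) : |armProb w e - armProb w e'| = |e - e'| := by
  cases w
  · simp only [armProb, Bool.false_eq_true, if_false]
    rw [← abs_neg]; congr 1; ring
  · simp [armProb]

lemma Identification.armProb_pos (hId : Identification D P R) (w : Bool) (x : 𝒳) :
    0 < armProb w (R.e x) := by
  have := hId.overlap x
  cases w <;> simp [armProb] <;> linarith

lemma Identification.armProb_lt_one (hId : Identification D P R) (w : Bool) (x : 𝒳) :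
    armProb w (R.e x) < 1 := by
  have := hId.overlap x
  cases w <;> simp [armProb] <;> linarith

lemma IIDSample.sigmaX_le (hD : IIDSample D P) : D.sigmaX ≤ ‹MeasurableSpace Ω› :=
  (hD.measurable_X 0).comap_le

lemma IIDSample.measurableSet_W (hD : IIDSample D P) (w : Bool) :
    MeasurableSet {ω | D.W 0 ω = w} := hD.measurable_W 0 (measurableSet_singleton w)

lemma IsRegressions.armProb_ae (hD : IIDSample D P) (hR : IsRegressions D M P R) (w : Bool) :
    P⟦{ω | D.W 0 ω = w} | D.sigmaX⟧ =ᵐ[P] fun ω => armProb w (R.e (D.X 0 ω)) := by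
  cases w
  · have h1 : ({ω | D.W 0 ω = false}.indicator fun _ => (1 : ℝ))
        = (fun _ => (1 : ℝ)) - {ω | D.W 0 ω = true}.indicator fun _ => (1 : ℝ) := by
      ext ω
      cases h : D.W 0 ω <;> simp [h]
    have h2 := condExp_sub (μ := P) (integrable_const (1 : ℝ))
      ((integrable_const (1 : ℝ)).indicator (hD.measurableSet_W true)) D.sigmaX
    rw [condExp_const hD.sigmaX_le] at h2
    rw [h1]
    filter_upwards [h2, hR.e] with ω h3 h4
    rw [h3, Pi.sub_apply, ← h4]
    simp [armProb]
  · filter_upwards [hR.e] with ω h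
    rw [← h]; simp [armProb]

/-- The law of `(X, B(0), B(1))` restricted to `W = w` is the full law reweighted by `P(W = w | X)`.
It suffices to compare the two measures on rectangles, where unconfoundedness factorizes the
conditional probability given `X` and the propensity score is pulled out of the conditional
expectation. -/
lemma integral_trt_eq (hD : IIDSample D P) (hR : IsRegressions D M P R)
    (hId : Identification D P R) (w : Bool) {F : 𝒳 × 𝓑 × 𝓑 → ℝ} (hF : Measurable F) :
    ∫ ω, (if D.W 0 ω = w then F (D.X 0 ω, D.B 0 false ω, D.B 0 true ω) else 0) ∂P
      = ∫ ω, armProb w (R.e (D.X 0 ω)) * F (D.X 0 ω, D.B 0 false ω, D.B 0 true ω) ∂P := by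
  set Y : Ω → 𝒳 × 𝓑 × 𝓑 := fun ω => (D.X 0 ω, D.B 0 false ω, D.B 0 true ω) with hY
  have hYm : Measurable Y := (hD.measurable_X 0).prodMk ((hD.measurable_B 0 false).prodMk (hD.measurable_B 0 true))
  set ρ : Ω → ℝ≥0∞ := fun ω => ENNReal.ofReal (armProb w (R.e (D.X 0 ω))) with hρ
  have heX : Measurable[D.sigmaX] fun ω => armProb w (R.e (D.X 0 ω)) :=
    (((measurable_armProb w).comp hR.measurable_e)).comp (comap_measurable (D.X 0))
  have heXm : Measurable fun ω => armProb w (R.e (D.X 0 ω)) := heX.mono hD.sigmaX_le le_rfl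
  have hρm : Measurable ρ := ENNReal.measurable_ofReal.comp heXm
  have hW := hD.measurableSet_W w
  have heb : ∀ ω, |armProb w (R.e (D.X 0 ω))| ≤ 1 := fun ω => by
    rw [abs_of_pos (hId.armProb_pos w _)]; exact (hId.armProb_lt_one w _).le
  have heq : (P.restrict {ω | D.W 0 ω = w}).map Y = (P.withDensity ρ).map Y := by
    refine Measure.ext_prod fun {C A} hC hA => ?_
    rw [Measure.map_apply hYm (hC.prod hA), Measure.map_apply hYm (hC.prod hA),
      Measure.restrict_apply (hYm (hC.prod hA)), withDensity_apply _ (hYm (hC.prod hA))]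
    set E : Set Ω := {ω | (D.B 0 false ω, D.B 0 true ω) ∈ A} with hE
    have hEm : MeasurableSet E := ((hD.measurable_B 0 false).prodMk (hD.measurable_B 0 true)) hA
    set G : Set Ω := D.X 0 ⁻¹' C with hG
    have hGs : MeasurableSet[D.sigmaX] G := ⟨C, hC, rfl⟩
    have hGm : MeasurableSet G := hD.sigmaX_le _ hGs
    have hpre : Y ⁻¹' (C ×ˢ A) = G ∩ E := by ext ω; simp [hY, hG, hE]
    rw [hpre]
    have hEW : MeasurableSet (E ∩ {ω | D.W 0 ω = w}) := hEm.inter hW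
    have hint1 : Integrable (E.indicator fun _ => (1 : ℝ)) P := (integrable_const _).indicator hEm
    have hint2 : Integrable ((E.indicator fun _ => (1 : ℝ)) * fun ω => armProb w (R.e (D.X 0 ω))) P :=
      hint1.mul_bdd (c := 1) heXm.aestronglyMeasurable (ae_of_all _ heb)
    have h1 : ∫ ω in G, (E ∩ {ω | D.W 0 ω = w}).indicator (fun _ => (1 : ℝ)) ω ∂P
        = ∫ ω in G, E.indicator (fun _ => (1 : ℝ)) ω * armProb w (R.e (D.X 0 ω)) ∂P := by
      rw [← setIntegral_condExp hD.sigmaX_le ((integrable_const _).indicator hEW) hGs]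
      have h2 := setIntegral_condExp hD.sigmaX_le hint2 hGs
      simp only [Pi.mul_apply] at h2
      rw [← h2]
      refine setIntegral_congr_ae hGm ?_
      have hpull := condExp_mul_of_stronglyMeasurable_right (m := D.sigmaX) (μ := P)
        heX.stronglyMeasurable hint2 hint1
      filter_upwards [hId.unconfounded A w hA, hpull, hR.armProb_ae hD w] with ω a1 a2 a3 _
      rw [a1, a2, a3]; rfl
    have hL : P (G ∩ E ∩ {ω | D.W 0 ω = w})
        = ENNReal.ofReal (∫ ω in G, (E ∩ {ω | D.W 0 ω = w}).indicator (fun _ => (1 : ℝ)) ω ∂P) := by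
      rw [setIntegral_indicator hEW, setIntegral_const, smul_eq_mul, mul_one, ← Set.inter_assoc]
      simp
    rw [hL, h1]
    have hint3 : Integrable (fun ω => E.indicator (fun _ => (1 : ℝ)) ω * armProb w (R.e (D.X 0 ω)))
        (P.restrict G) := hint2.integrableOn
    rw [ofReal_integral_eq_lintegral_ofReal hint3
      (ae_of_all _ fun ω => mul_nonneg (Set.indicator_nonneg (fun _ _ => zero_le_one) _)
        (hId.armProb_pos w _).le)]
    rw [← lintegral_indicator (hGm.inter hEm), ← lintegral_indicator hGm]
    refine lintegral_congr fun ω => ?_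
    by_cases hg : ω ∈ G <;> by_cases he : ω ∈ E <;> simp [hg, he, hρ]
  have hA : ∫ z, F z ∂((P.restrict {ω | D.W 0 ω = w}).map Y) = ∫ z, F z ∂((P.withDensity ρ).map Y) := by
    rw [heq]
  rw [integral_map hYm.aemeasurable hF.aestronglyMeasurable,
    integral_map hYm.aemeasurable hF.aestronglyMeasurable, ← integral_indicator hW,
    integral_withDensity_eq_integral_toReal_smul hρm (ae_of_all _ fun _ => ENNReal.ofReal_lt_top)] at hA
  refine (integral_congr_ae (ae_of_all _ fun ω => ?_)).trans
    (hA.trans (integral_congr_ae (ae_of_all _ fun ω => ?_)))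
  · simp [Set.indicator_apply, hY]
  · simp [hρ, hY, ENNReal.toReal_ofReal (hId.armProb_pos w _).le]

/-- Unconfoundedness as an identity between integrals. -/
lemma integral_trt_law (hD : IIDSample D P) (hR : IsRegressions D M P R)
    (hId : Identification D P R) (w : Bool) {G : 𝒳 → 𝓑 → ℝ}
    (hG : Measurable fun z : 𝒳 × 𝓑 => G z.1 z.2) :
    ∫ o, (if o.2.2.2 = w then G o.1 (subOf w o) else 0) ∂(D.law P)
      = ∫ o, armProb w (R.e o.1) * G o.1 (subOf w o) ∂(D.law P) := by
  have hGm : Measurable fun o : Obs 𝒳 𝓑 => G o.1 (subOf w o) :=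
    hG.comp (measurable_fst.prodMk (measurable_subOf w))
  have hem : Measurable fun o : Obs 𝒳 𝓑 => armProb w (R.e o.1) * G o.1 (subOf w o) :=
    ((measurable_armProb w).comp (hR.measurable_e.comp measurable_fst)).mul hGm
  rw [integral_law hD (measurable_ite_trt w (by fun_prop) hGm measurable_const),
    integral_law hD hem]
  have := integral_trt_eq hD hR hId w (F := fun z => G z.1 (if w then z.2.2 else z.2.1))
    (hG.comp (measurable_fst.prodMk (by cases w <;> simp <;> fun_prop)))
  exact this

/-- `mu` is the conditional mean of the response `a` under treatment `w`, and is smooth. -/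
structure ResponseRegression (D : Sample Ω 𝒳 𝓑) (P : Measure Ω) (S : Set (Vec J)) (w : Bool)
    (a : 𝓑 → Vec J → ℝ) (mu : 𝒳 → Vec J → ℝ) (c' : ℝ) : Prop where
  measurable : ∀ p ∈ S, Measurable fun x => mu x p
  condExp : ∀ p ∈ S, (fun ω => mu (D.X 0 ω) p) =ᵐ[P] P[fun ω => a (D.B 0 w ω) p | D.sigmaX]
  smooth : ∀ x, TwiceSmooth S c' (mu x)

variable {S : Set (Vec J)} {a : 𝓑 → Vec J → ℝ} {mu : 𝒳 → Vec J → ℝ} {c' : ℝ} {w : Bool}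

lemma RegularResponse.measurable_B (ha : RegularResponse D P S a) (hD : IIDSample D P) (p : Vec J)
    (w : Bool) : Measurable fun ω => a (D.B 0 w ω) p :=
  ha.measurable.comp ((hD.measurable_B 0 w).prodMk measurable_const)

lemma RegularResponse.integrable_B (ha : RegularResponse D P S a) (hD : IIDSample D P) {p : Vec J}
    (hp : p ∈ S) (w : Bool) : Integrable (fun ω => a (D.B 0 w ω) p) P := by
  obtain ⟨K, -, hK⟩ := ha.bounded
  exact Integrable.of_bound (ha.measurable_B hD p w).aestronglyMeasurable K
    (ae_of_all _ fun ω => hK _ _ hp)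

/-- The tower property: `g(X)` is known given `X`, so the response may be replaced by its
conditional mean. -/
lemma integral_mul_response (hD : IIDSample D P) (ha : RegularResponse D P S a)
    (hmu : ResponseRegression D P S w a mu c') {g : 𝒳 → ℝ} (hg : Measurable g) {C : ℝ}
    (hgC : ∀ᵐ ω ∂P, |g (D.X 0 ω)| ≤ C) {p : Vec J} (hp : p ∈ S) :
    ∫ o, g o.1 * a (subOf w o) p ∂(D.law P) = ∫ o, g o.1 * mu o.1 p ∂(D.law P) := by
  have hm1 : Measurable fun o : Obs 𝒳 𝓑 => g o.1 * a (subOf w o) p :=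
    (hg.comp measurable_fst).mul (ha.measurable_sub p w)
  have hm2 : Measurable fun o : Obs 𝒳 𝓑 => g o.1 * mu o.1 p :=
    (hg.comp measurable_fst).mul ((hmu.measurable p hp).comp measurable_fst)
  rw [integral_law hD hm1, integral_law hD hm2]
  simp_rw [subOf_obs]
  have hgX : Measurable[D.sigmaX] fun ω => g (D.X 0 ω) := hg.comp (comap_measurable (D.X 0))
  have hint := ha.integrable_B hD hp w
  have hint2 : Integrable ((fun ω => g (D.X 0 ω)) * fun ω => a (D.B 0 w ω) p) P :=
    hint.bdd_mul (hgX.mono hD.sigmaX_le le_rfl).aestronglyMeasurable hgC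
  have h1 := integral_condExp (μ := P) hD.sigmaX_le (f := (fun ω => g (D.X 0 ω)) * fun ω => a (D.B 0 w ω) p)
  refine (h1.symm.trans ?_)
  refine integral_congr_ae ?_
  filter_upwards [condExp_mul_of_stronglyMeasurable_left hgX.stronglyMeasurable hint2 hint,
    hmu.condExp p hp] with ω a1 a2
  rw [a1, Pi.mul_apply, ← a2]; rfl

lemma ResponseRegression.ae_abs_le (hmu : ResponseRegression D P S w a mu c') {K : ℝ}
    (hK : ∀ b, ∀ p ∈ S, |a b p| ≤ K) {p : Vec J} (hp : p ∈ S) :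
    ∀ᵐ ω ∂P, |mu (D.X 0 ω) p| ≤ K := by
  have h := ae_bdd_abs_condExp_of_ae_bdd_abs (m := D.sigmaX) (R := K)
    (f := fun ω => a (D.B 0 w ω) p) (μ := P) (ae_of_all _ fun ω => hK _ _ hp)
  filter_upwards [h, hmu.condExp p hp] with ω h1 h2
  rw [h2]; exact h1

/-- Propensity scores are bounded away from zero and one if they are consistently estimated by
functions that are. -/
lemma armProb_mem_of_limit (hD : IIDSample D P) {L : Learners 𝒳 J} {Rules : Set (𝒳 → ℝ)}
    {pstar : (𝒳 → ℝ) → Vec J} (hL : MeasurableLearners L) (hR : IsRegressions D M P R)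
    (hNui : NuisanceAssumption D M L P R Rules pstar) (hne : Rules.Nonempty) :
    ∃ κ > 0, κ < 1 ∧ (∀ᵐ x ∂(P.map (D.X 0)), R.e x ∈ Set.Icc κ (1 - κ)) ∧
      ∀ᵐ ω ∂P, ∀ n k, ∀ᵐ x ∂(P.map (D.X 0)), eHat D L n k ω x ∈ Set.Ioo κ (1 - κ) := by
  obtain ⟨κ, hκ, hov⟩ := hNui.overlap
  obtain ⟨rmu, re, rth, -, hre, -, -, -, hrates⟩ := hNui.rates
  obtain ⟨π, hπ⟩ := hne
  have hPX : IsProbabilityMeasure (P.map (D.X 0)) :=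
    Measure.isProbabilityMeasure_map (hD.measurable_X 0).aemeasurable
  have h1 : ∀ᶠ n in atTop, ∃ f : 𝒳 → ℝ, Measurable f ∧
      (∀ᵐ x ∂(P.map (D.X 0)), f x ∈ Set.Ioo κ (1 - κ)) ∧
      eLpNorm (fun x => f x - R.e x) 2 (P.map (D.X 0)) ≤ ENNReal.ofReal (re n) := by
    have h2 : ∀ᶠ n in atTop, P {ω | ¬ RatesHold D M L P R pstar (rmu n) (re n) (rth n) π n 0 ω} < 1 :=
      (hrates π hπ 0).eventually_lt_const one_pos
    filter_upwards [h2] with n hn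
    -- The score `R.e` is not random, so one good outcome for each large `n` is enough. It exists
    -- since the rates fail with probability less than one and overlap of the estimates holds almost
    -- surely.
    have hex : ∃ ω, RatesHold D M L P R pstar (rmu n) (re n) (rth n) π n 0 ω ∧
        ∀ n k, ∀ᵐ x ∂(P.map (D.X 0)), eHat D L n k ω x ∈ Set.Ioo κ (1 - κ) := by
      by_contra hcon
      push Not at hcon
      have h3 : P {ω | ¬ RatesHold D M L P R pstar (rmu n) (re n) (rth n) π n 0 ω} = 1 := by
        refine le_antisymm prob_le_one ?_
        rw [← measure_univ (μ := P)]
        refine measure_mono_ae ?_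
        filter_upwards [hov] with ω hω _
        intro hr
        obtain ⟨n, k, h⟩ := hcon ω hr
        exact h ((hω n k).mono fun x hx => not_not.2 hx)
      exact hn.ne h3
    obtain ⟨ω, h3, h4⟩ := hex
    refine ⟨eHat D L n 0 ω, ?_, h4 n 0, h3.2.1⟩
    exact (hL.eHat n _).comp (measurable_const.prodMk measurable_id)
  obtain ⟨N, hN⟩ := eventually_atTop.1 h1
  choose! f hfm hfo hfe using hN
  refine ⟨κ, hκ, ?_, ?_, hov⟩
  · obtain ⟨x, hx⟩ := (hfo N le_rfl).exists
    have := hx.1.trans hx.2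
    linarith
  -- Convergence in `L²` gives an almost everywhere convergent subsequence, along which the closed
  -- interval passes to the limit. Pointwise positivity of the propensity score is thereby upgraded
  -- to a uniform bound.
  have htm : TendstoInMeasure (P.map (D.X 0)) (fun n => f (n + N)) atTop R.e := by
    refine tendstoInMeasure_of_tendsto_eLpNorm (p := 2) (by norm_num)
      (fun n => (hfm _ (by omega)).aestronglyMeasurable) hR.measurable_e.aestronglyMeasurable ?_
    refine tendsto_of_tendsto_of_tendsto_of_le_of_le tendsto_const_nhds
      (h := fun n => ENNReal.ofReal (re (n + N))) ?_ (fun _ => zero_le) fun n => hfe _ (by omega)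
    simpa using ENNReal.tendsto_ofReal (hre.comp (tendsto_add_atTop_nat N))
  obtain ⟨ns, -, hns⟩ := htm.exists_seq_tendsto_ae
  have hall : ∀ᵐ x ∂(P.map (D.X 0)), ∀ n, f (n + N) x ∈ Set.Ioo κ (1 - κ) :=
    ae_all_iff.2 fun n => hfo _ (by omega)
  filter_upwards [hns, hall] with x h3 h4
  exact isClosed_Icc.mem_of_tendsto h3 (Eventually.of_forall fun n => Set.Ioo_subset_Icc_self (h4 _))

end Population

/-! ### Consequences of bounded partial derivatives. -/

section Smoothness

variable {J : ℕ} {S : Set (Vec J)} {c : ℝ} {f : Vec J → ℝ} {pst : Vec J} {r : ℝ}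

lemma ball_subset_interior (hball : Metric.ball pst r ⊆ S) : Metric.ball pst r ⊆ interior S :=
  interior_maximal hball Metric.isOpen_ball

lemma TwiceSmooth.differentiableAt (hf : TwiceSmooth S c f) {p : Vec J} (hp : p ∈ interior S) :
    DifferentiableAt ℝ f p :=
  (hf.1.differentiableOn (by norm_num)).differentiableAt (isOpen_interior.mem_nhds hp)

lemma TwiceSmooth.norm_fderiv_le (hf : TwiceSmooth S c f) (hc : 0 ≤ c) {p : Vec J}
    (hp : p ∈ interior S) : ‖fderiv ℝ f p‖ ≤ J * c := by
  refine ContinuousLinearMap.opNorm_le_bound _ (by positivity) fun v => ?_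
  have hv : v = ∑ j, v j • EuclideanSpace.single j (1 : ℝ) := by
    have := (EuclideanSpace.basisFun (Fin J) ℝ).sum_repr v
    simpa using this.symm
  conv_lhs => rw [hv]
  rw [map_sum]
  refine (norm_sum_le _ _).trans ?_
  have : ∀ j ∈ Finset.univ, ‖fderiv ℝ f p (v j • EuclideanSpace.single j (1 : ℝ))‖ ≤ c * ‖v‖ := fun j _ => by
    rw [map_smul, norm_smul, mul_comm]
    exact mul_le_mul ((hf.2 p hp).1 j) (PiLp.norm_apply_le v j) (norm_nonneg _) hc
  refine (Finset.sum_le_card_nsmul _ _ _ this).trans (le_of_eq ?_)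
  simp; ring

lemma TwiceSmooth.lipschitzOnWith (hf : TwiceSmooth S c f) (hc : 0 ≤ c)
    (hball : Metric.ball pst r ⊆ S) :
    LipschitzOnWith (Real.nnabs (J * c)) f (Metric.ball pst r) := by
  have h := ball_subset_interior hball
  refine Convex.lipschitzOnWith_of_nnnorm_fderiv_le (𝕜 := ℝ) (fun x hx => hf.differentiableAt (h hx))
    (fun x hx => ?_) (convex_ball _ _)
  rw [← NNReal.coe_le_coe, coe_nnnorm, Real.coe_nnabs, abs_of_nonneg (by positivity)]
  exact hf.norm_fderiv_le hc (h hx)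

lemma TwiceSmooth.abs_sub_le (hf : TwiceSmooth S c f) (hc : 0 ≤ c)
    (hball : Metric.ball pst r ⊆ S) {p : Vec J} (hp : p ∈ Metric.ball pst r) :
    |f p - f pst| ≤ J * c * ‖p - pst‖ := by
  have hr : 0 < r := dist_nonneg.trans_lt hp
  have := (hf.lipschitzOnWith hc hball).dist_le_mul p hp pst (Metric.mem_ball_self hr)
  rw [Real.coe_nnabs, abs_of_nonneg (by positivity)] at this
  simpa [Real.dist_eq, dist_eq_norm] using this

/-- The derivative at a point depends measurably on a parameter if the values do. -/
lemma measurable_fderiv_of_measurable {α : Type*} [MeasurableSpace α] {f : α → Vec J → ℝ}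
    (hd : ∀ x, DifferentiableAt ℝ (f x) pst)
    (hm : ∀ᶠ p in 𝓝 pst, Measurable fun x => f x p) :
    Measurable fun x => fderiv ℝ (f x) pst := by
  have hco : ∀ v : Vec J, Measurable fun x => fderiv ℝ (f x) pst v := by
    intro v
    -- Directional derivatives are limits of difference quotients along these points, which
    -- eventually lie where evaluation is measurable in the parameter.
    have ht : Tendsto (fun n : ℕ => pst + ((n : ℝ) + 1)⁻¹ • v) atTop (𝓝 pst) := by
      have h0 : Tendsto (fun n : ℕ => ((n : ℝ) + 1)⁻¹) atTop (𝓝 0) := by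
        simpa using tendsto_one_div_add_atTop_nhds_zero_nat (𝕜 := ℝ)
      have := (h0.smul_const v).const_add pst
      simpa using this
    obtain ⟨N, hN⟩ := eventually_atTop.1 (ht.eventually hm)
    have hmp : Measurable fun x => f x pst := hm.self_of_nhds
    refine measurable_of_tendsto_metrizable
      (f := fun (n : ℕ) x => (((n + N : ℕ) : ℝ) + 1) * (f x (pst + (((n + N : ℕ) : ℝ) + 1)⁻¹ • v) - f x pst))
      (fun n => ((hN (n + N) (by omega)).sub hmp).const_mul _) ?_
    rw [tendsto_pi_nhds]
    intro x
    have hs := ((hd x).hasFDerivAt.hasLineDerivAt v).tendsto_slope_zero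
    have h0 : Tendsto (fun n : ℕ => ((n : ℝ) + 1)⁻¹) atTop (𝓝[≠] 0) := by
      refine tendsto_nhdsWithin_iff.2 ⟨by simpa using tendsto_one_div_add_atTop_nhds_zero_nat (𝕜 := ℝ),
        Eventually.of_forall fun n => ?_⟩
      simp only [Set.mem_compl_iff, Set.mem_singleton_iff]
      positivity
    have := (hs.comp h0).comp (tendsto_add_atTop_nat N)
    refine this.congr fun n => ?_
    simp
  have e : (fun x => fderiv ℝ (f x) pst) = fun x => ∑ j,
      fderiv ℝ (f x) pst (EuclideanSpace.single j (1 : ℝ)) •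
        (EuclideanSpace.proj j : Vec J →L[ℝ] ℝ) := by
    ext x v
    have hv : v = ∑ j, v j • EuclideanSpace.single j (1 : ℝ) := by
      have := (EuclideanSpace.basisFun (Fin J) ℝ).sum_repr v
      simpa using this.symm
    conv_lhs => rw [hv]
    simp [mul_comm]
  rw [e]
  exact Finset.measurable_fun_sum _ fun j _ => (hco _).smul_const _

end Smoothness

/-! ### Differentiability and continuity of population means in the cutoff. -/

section Means

variable {Ω 𝒳 𝓑 : Type*} {J : ℕ} [MeasurableSpace Ω] [MeasurableSpace 𝒳] [MeasurableSpace 𝓑]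
  {P : Measure Ω} [IsProbabilityMeasure P] {D : Sample Ω 𝒳 𝓑}
  {S : Set (Vec J)} {a : 𝓑 → Vec J → ℝ} {mu : 𝒳 → Vec J → ℝ} {c' : ℝ} {w : Bool} {pst : Vec J} {r : ℝ}

lemma ResponseRegression.integral_eq (hmu : ResponseRegression D P S w a mu c') (hD : IIDSample D P)
    {p : Vec J} (hp : p ∈ S) : ∫ ω, a (D.B 0 w ω) p ∂P = ∫ ω, mu (D.X 0 ω) p ∂P := by
  rw [integral_congr_ae (hmu.condExp p hp), integral_condExp hD.sigmaX_le]

/-- The response itself may jump in `p`. Its mean agrees near `pst` with the mean of the smooth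
conditional mean, which is differentiated under the integral with the uniform Lipschitz constant `J
c'`. -/
lemma ResponseRegression.differentiableAt_integral (hmu : ResponseRegression D P S w a mu c')
    (ha : RegularResponse D P S a) (hD : IIDSample D P) (hc : 0 ≤ c') (hr : 0 < r)
    (hball : Metric.ball pst r ⊆ S) :
    DifferentiableAt ℝ (fun p => ∫ ω, a (D.B 0 w ω) p ∂P) pst := by
  obtain ⟨K, hK0, hK⟩ := ha.bounded
  have hnhds : Metric.ball pst r ∈ 𝓝 pst := Metric.ball_mem_nhds _ hr
  have hmem := mem_of_mem_nhds hnhds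
  have e : (fun p => ∫ ω, a (D.B 0 w ω) p ∂P) =ᶠ[𝓝 pst] fun p => ∫ ω, mu (D.X 0 ω) p ∂P := by
    filter_upwards [hnhds] with p hp using hmu.integral_eq hD (hball hp)
  refine DifferentiableAt.congr_of_eventuallyEq ?_ e
  have hd : ∀ x, DifferentiableAt ℝ (mu x) pst := fun x =>
    (hmu.smooth x).differentiableAt (ball_subset_interior hball hmem)
  have hm : ∀ᶠ p in 𝓝 pst, Measurable fun x => mu x p := by
    filter_upwards [hnhds] with p hp using hmu.measurable p (hball hp)
  refine (hasFDerivAt_integral_of_dominated_loc_of_lip (F := fun p ω => mu (D.X 0 ω) p)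
    (F' := fun ω => fderiv ℝ (mu (D.X 0 ω)) pst) (bound := fun _ => J * c')
    hnhds ?_ ?_ ?_ ?_ (integrable_const _) ?_).2.differentiableAt
  · filter_upwards [hm] with p hp using (hp.comp (hD.measurable_X 0)).aestronglyMeasurable
  · exact Integrable.of_bound ((hmu.measurable _ (hball hmem)).comp (hD.measurable_X 0)).aestronglyMeasurable
      K (hmu.ae_abs_le hK (hball hmem))
  · exact ((measurable_fderiv_of_measurable hd hm).comp (hD.measurable_X 0)).aestronglyMeasurable
  · exact ae_of_all _ fun ω => (hmu.smooth _).lipschitzOnWith hc hball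
  · exact ae_of_all _ fun ω => (hd _).hasFDerivAt

/-- Conditional means are Lipschitz continuous at an interior point. -/
lemma ResponseRegression.exists_lipschitz (hmu : ResponseRegression D P S w a mu c')
    (ha : RegularResponse D P S a) (hc : 0 ≤ c') (hr : 0 < r) (hball : Metric.ball pst r ⊆ S) :
    ∃ C, 0 ≤ C ∧ ∀ p ∈ S, ∀ᵐ ω ∂P, |mu (D.X 0 ω) p - mu (D.X 0 ω) pst| ≤ C * ‖p - pst‖ := by
  obtain ⟨K, hK0, hK⟩ := ha.bounded
  have hpst : pst ∈ S := hball (Metric.mem_ball_self hr)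
  -- Inside the ball the derivative bound applies; outside it the distance is at least `r`, so
  -- boundedness by `K` is enough.
  refine ⟨max (J * c') (2 * K / r), by positivity, fun p hp => ?_⟩
  by_cases h : p ∈ Metric.ball pst r
  · refine ae_of_all _ fun ω => ((hmu.smooth _).abs_sub_le hc hball h).trans ?_
    gcongr
    exact le_max_left _ _
  · filter_upwards [hmu.ae_abs_le hK hp, hmu.ae_abs_le hK hpst] with ω h1 h2
    rw [Metric.mem_ball, dist_eq_norm, not_lt] at h
    calc |mu (D.X 0 ω) p - mu (D.X 0 ω) pst| ≤ 2 * K := (abs_sub _ _).trans (by linarith)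
      _ = 2 * K / r * r := by field_simp
      _ ≤ 2 * K / r * ‖p - pst‖ := by gcongr
      _ ≤ _ := by gcongr; exact le_max_right _ _

/-- The square of a mean increment is at most its second moment, as the variance is nonnegative, and
weak continuity bounds the latter. -/
lemma RegularResponse.continuousOn_integral (ha : RegularResponse D P S a) (hD : IIDSample D P) (w : Bool) :
    ContinuousOn (fun p => ∫ ω, a (D.B 0 w ω) p ∂P) S := by
  obtain ⟨l, hl0, hl⟩ := ha.weakly_continuous
  obtain ⟨K, hK0, hK⟩ := ha.bounded
  intro p hp
  rw [ContinuousWithinAt, tendsto_iff_norm_sub_tendsto_zero]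
  have h0 : Tendsto (fun p' : Vec J => √(l * ‖p' - p‖)) (𝓝[S] p) (𝓝 0) := by
    have : ContinuousAt (fun p' : Vec J => √(l * ‖p' - p‖)) p := by fun_prop
    have := this.tendsto.mono_left (nhdsWithin_le_nhds (s := S))
    simpa using this
  refine squeeze_zero' (Eventually.of_forall fun _ => norm_nonneg _) ?_ h0
  filter_upwards [self_mem_nhdsWithin] with p' hp'
  rw [← integral_sub (ha.integrable_B hD hp' w) (ha.integrable_B hD hp w)]
  have hm : Measurable fun ω => a (D.B 0 w ω) p' - a (D.B 0 w ω) p :=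
    (ha.measurable_B hD p' w).sub (ha.measurable_B hD p w)
  have hL : MemLp (fun ω => a (D.B 0 w ω) p' - a (D.B 0 w ω) p) 2 P :=
    MemLp.of_bound hm.aestronglyMeasurable (K + K) (ae_of_all _ fun ω =>
      (norm_sub_le _ _).trans (add_le_add (hK _ _ hp') (hK _ _ hp)))
  have hv := variance_nonneg (fun ω => a (D.B 0 w ω) p' - a (D.B 0 w ω) p) P
  rw [variance_eq_sub hL] at hv
  refine Real.le_sqrt_of_sq_le (le_trans ?_ (hl p' hp' p hp w))
  rw [Real.norm_eq_abs, sq_abs]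
  simpa using hv

end Means

/-! ### The population market near and away from its equilibrium. -/

section Equilibrium

variable {Ω 𝒳 𝓑 : Type*} {J : ℕ} [MeasurableSpace Ω] [MeasurableSpace 𝒳] [MeasurableSpace 𝓑]
  {P : Measure Ω} [IsProbabilityMeasure P] {D : Sample Ω 𝒳 𝓑} {M : Mechanism 𝓑 J}
  {R : Regressions 𝒳 J} {Rules : Set (𝒳 → ℝ)} {pstar : (𝒳 → ℝ) → Vec J} {c' c₃ c₄ : ℝ} {w : Bool}

lemma yPop_uniformRule (w : Bool) (p : Vec J) :
    yPop D M P (uniformRule 𝒳 w) p = ∫ ω, M.y (D.B 0 w ω) p ∂P := by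
  cases w <;> simp [yPop, uniformRule]

lemma zPop_uniformRule (w : Bool) (p : Vec J) :
    zPop D M P (uniformRule 𝒳 w) p = (∫ ω, M.d (D.B 0 w ω) p ∂P) - M.cap := by
  cases w <;> simp [zPop, uniformRule]

lemma RegularOutcomes.response_y (hOut : RegularOutcomes D M P R Rules pstar c' c₃ c₄)
    (hM : MeasurableMechanism M) : RegularResponse D P M.S M.y where
  measurable := hM.y
  covering := by
    obtain ⟨hd, hy, C, -, -, hC, -, h⟩ := hOut.covering
    exact ⟨hy, C, hC, h⟩
  bounded := by
    obtain ⟨K, hK⟩ := hOut.bounded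
    exact ⟨max K 0, le_max_right _ _, fun b p hp => (hK b p hp).1.trans (le_max_left _ _)⟩
  weakly_continuous := by
    obtain ⟨l, hl, h⟩ := hOut.weakly_continuous
    exact ⟨l, hl, fun p hp p' hp' w => (h p hp p' hp' w).2⟩

lemma RegularOutcomes.response_d (hOut : RegularOutcomes D M P R Rules pstar c' c₃ c₄)
    (hM : MeasurableMechanism M) (j : Fin J) : RegularResponse D P M.S fun b p => M.d b p j where
  measurable := by
    have := hM.d
    exact (EuclideanSpace.proj (𝕜 := ℝ) j).continuous.measurable.comp this
  covering := by
    obtain ⟨hd, hy, C, -, -, hC, h, -⟩ := hOut.covering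
    exact ⟨hd, C, hC, h j⟩
  bounded := by
    obtain ⟨K, hK⟩ := hOut.bounded
    exact ⟨max K 0, le_max_right _ _, fun b p hp => ((hK b p hp).2 j).trans (le_max_left _ _)⟩
  weakly_continuous := by
    obtain ⟨l, hl, h⟩ := hOut.weakly_continuous
    exact ⟨l, hl, fun p hp p' hp' w => (h p hp p' hp' w).1 j⟩

lemma RegularOutcomes.integrable_d (hOut : RegularOutcomes D M P R Rules pstar c' c₃ c₄)
    (hM : MeasurableMechanism M) (hD : IIDSample D P) {p : Vec J} (hp : p ∈ M.S) (w : Bool) :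
    Integrable (fun ω => M.d (D.B 0 w ω) p) P := by
  have hm : Measurable fun ω => M.d (D.B 0 w ω) p :=
    hM.d.comp ((hD.measurable_B 0 w).prodMk measurable_const)
  obtain ⟨K, hK⟩ := hOut.bounded
  refine Integrable.of_bound hm.aestronglyMeasurable (∑ _ : Fin J, K) (ae_of_all _ fun ω => ?_)
  refine (EuclideanSpace.norm_eq _).trans_le ?_
  refine (Real.sqrt_le_sqrt (Finset.sum_sq_le_sq_sum_of_nonneg fun j _ => norm_nonneg _)).trans ?_
  rw [Real.sqrt_sq (Finset.sum_nonneg fun j _ => norm_nonneg _)]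
  exact Finset.sum_le_sum fun j _ => (hK _ _ hp).2 j

lemma zPop_uniformRule_apply (hOut : RegularOutcomes D M P R Rules pstar c' c₃ c₄)
    (hM : MeasurableMechanism M) (hD : IIDSample D P) {p : Vec J} (hp : p ∈ M.S) (w : Bool)
    (j : Fin J) :
    zPop D M P (uniformRule 𝒳 w) p j = (∫ ω, M.d (D.B 0 w ω) p j ∂P) - M.cap j := by
  rw [zPop_uniformRule, PiLp.sub_apply]
  congr 1
  exact ((EuclideanSpace.proj (𝕜 := ℝ) j).integral_comp_comm (hOut.integrable_d hM hD hp w)).symm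

lemma RegularOutcomes.regression_y (hOut : RegularOutcomes D M P R Rules pstar c' c₃ c₄)
    (hR : IsRegressions D M P R) (w : Bool) :
    ResponseRegression D P M.S w M.y (R.muY w) c' where
  measurable := hR.measurable_muY w
  condExp := hR.muY w
  smooth x := (hOut.smooth w x).1

lemma RegularOutcomes.regression_d (hOut : RegularOutcomes D M P R Rules pstar c' c₃ c₄)
    (hR : IsRegressions D M P R) (hM : MeasurableMechanism M) (hD : IIDSample D P) (w : Bool)
    (j : Fin J) :
    ResponseRegression D P M.S w (fun b p => M.d b p j) (fun x p => R.muD w x p j) c' where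
  measurable p hp := (EuclideanSpace.proj (𝕜 := ℝ) j).continuous.measurable.comp
    (hR.measurable_muD w p hp)
  condExp p hp := by
    have h := (EuclideanSpace.proj (𝕜 := ℝ) j : Vec J →L[ℝ] ℝ).comp_condExp_comm (m := D.sigmaX)
      (hOut.integrable_d hM hD hp w)
    filter_upwards [h, hR.muD w p hp] with ω h1 h2
    rw [h2]
    exact h1
  smooth x := (hOut.smooth w x).2 j

/-- The facts on the population market under uniform treatment `w` that the expansion of the
estimator uses: differentiability at the equilibrium, and linear growth of excess demand. -/
structure RegularArm (D : Sample Ω 𝒳 𝓑) (M : Mechanism 𝓑 J) (P : Measure Ω) (w : Bool)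
    (pst : Vec J) : Prop where
  mem : pst ∈ M.S
  clears : zPop D M P (uniformRule 𝒳 w) pst = 0
  score : HasFDerivAt (fun p => yPop D M P (uniformRule 𝒳 w) p
    - nu D M P (uniformRule 𝒳 w) pst (zPop D M P (uniformRule 𝒳 w) p)) (0 : Vec J →L[ℝ] ℝ) pst
  growth : ∃ c > 0, ∀ p ∈ M.S, c * ‖p - pst‖ ≤ ‖zPop D M P (uniformRule 𝒳 w) p‖

/-- Near `pst` the invertible derivative dominates the Taylor remainder. On the rest of `S`,
compactness and uniqueness of the zero bound `‖f‖` away from zero, while distances to `pst` are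
bounded. -/
lemma exists_linear_growth {S : Set (Vec J)} (hS : IsCompact S) {f : Vec J → Vec J}
    (hf : ContinuousOn f S) {pst : Vec J} (h0 : f pst = 0) (huniq : ∀ p ∈ S, f p = 0 → p = pst)
    {A : Vec J ≃L[ℝ] Vec J} (hA : HasFDerivAt f (A : Vec J →L[ℝ] Vec J) pst) :
    ∃ c > 0, ∀ p ∈ S, c * ‖p - pst‖ ≤ ‖f p‖ := by
  obtain ⟨K, hK, hanti⟩ : ∃ K > 0, ∀ v, ‖v‖ ≤ K * ‖A v‖ := by
    refine ⟨‖(A.symm : Vec J →L[ℝ] Vec J)‖ + 1, by positivity, fun v => ?_⟩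
    have := (A.symm : Vec J →L[ℝ] Vec J).le_opNorm (A v)
    simp only [ContinuousLinearEquiv.coe_coe, ContinuousLinearEquiv.symm_apply_apply] at this
    nlinarith [norm_nonneg (A v)]
  have hloc := hA.isLittleO.def (c := (2 * K)⁻¹) (by positivity)
  obtain ⟨δ, hδ, hδl⟩ := Metric.eventually_nhds_iff.1 hloc
  have hnear : ∀ p, ‖p - pst‖ < δ → (2 * K)⁻¹ * ‖p - pst‖ ≤ ‖f p‖ := by
    intro p hp
    have h1 := hδl (by rwa [dist_eq_norm] : dist p pst < δ)
    rw [h0, sub_zero] at h1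
    have h2 := hanti (p - pst)
    have h3 : ‖A (p - pst)‖ ≤ ‖f p‖ + ‖f p - A (p - pst)‖ := by
      have := norm_sub_norm_le (A (p - pst)) (f p)
      rw [norm_sub_rev] at this
      linarith
    have h1' : ‖f p - A (p - pst)‖ ≤ (2 * K)⁻¹ * ‖p - pst‖ := h1
    have h4 : K⁻¹ * ‖p - pst‖ ≤ ‖A (p - pst)‖ := by
      rw [inv_mul_le_iff₀ hK]; exact h2
    have h5 : K⁻¹ * ‖p - pst‖ = 2 * ((2 * K)⁻¹ * ‖p - pst‖) := by field_simp
    linarith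
  have hT : IsCompact (S ∩ {p | δ ≤ ‖p - pst‖}) :=
    hS.inter_right (isClosed_le continuous_const (by fun_prop))
  obtain ⟨B, hB⟩ := hS.isBounded.subset_closedBall pst
  rcases (S ∩ {p | δ ≤ ‖p - pst‖}).eq_empty_or_nonempty with he | hne
  · refine ⟨(2 * K)⁻¹, by positivity, fun p hp => hnear p ?_⟩
    by_contra h
    exact (he ▸ (⟨hp, not_lt.1 h⟩ : p ∈ S ∩ {p | δ ≤ ‖p - pst‖}) : p ∈ (∅ : Set (Vec J)))
  · obtain ⟨q, hq, hmin⟩ := hT.exists_isMinOn hne ((hf.mono Set.inter_subset_left).norm)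
    have hq0 : 0 < ‖f q‖ := norm_pos_iff.2 fun h => by
      have := huniq q hq.1 h
      have h2 : δ ≤ ‖q - pst‖ := hq.2
      rw [this, sub_self, norm_zero] at h2
      linarith
    have hB0 : 0 < B := by
      have := hB hq.1
      rw [Metric.mem_closedBall, dist_eq_norm] at this
      exact hδ.trans_le (le_trans hq.2 this)
    refine ⟨min (2 * K)⁻¹ (‖f q‖ / B), by positivity, fun p hp => ?_⟩
    by_cases h : ‖p - pst‖ < δ
    · refine le_trans ?_ (hnear p h)
      gcongr
      exact min_le_left _ _
    · have h1 : ‖f q‖ ≤ ‖f p‖ := hmin ⟨hp, not_lt.1 h⟩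
      have h2 := hB hp
      rw [Metric.mem_closedBall, dist_eq_norm] at h2
      calc min (2 * K)⁻¹ (‖f q‖ / B) * ‖p - pst‖ ≤ ‖f q‖ / B * B := by
            gcongr
            exact min_le_right _ _
        _ = ‖f q‖ := by field_simp
        _ ≤ _ := h1

/-- Positive singular values make the derivative of `z` injective, hence invertible in finite
dimension. Then `ν` composed with it is the derivative of `y`, so `y - ν z` is stationary at the
equilibrium. -/
lemma regularArm (hD : IIDSample D P) (hM : MeasurableMechanism M)
    (hR : IsRegressions D M P R) (hc' : 0 < c') (hc₃ : 0 < c₃)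
    (hOut : RegularOutcomes D M P R Rules pstar c' c₃ c₄)
    (hEq : RegularEquilibrium D M P Rules pstar c' c₃) {w : Bool}
    (hw : uniformRule 𝒳 w ∈ Rules) : RegularArm D M P w (pstar (uniformRule 𝒳 w)) := by
  obtain ⟨c₁, hc₁, hball⟩ := hEq.ball
  set pst := pstar (uniformRule 𝒳 w) with hpst
  have hb := hball _ hw
  rw [← hpst] at hb
  have hmem : pst ∈ M.S := hb (Metric.mem_ball_self hc₁)
  have h0 := hEq.clears _ hw
  rw [← hpst] at h0
  have hyd : DifferentiableAt ℝ (yPop D M P (uniformRule 𝒳 w)) pst := by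
    have e : yPop D M P (uniformRule 𝒳 w) = fun p => ∫ ω, M.y (D.B 0 w ω) p ∂P := by
      ext p; exact yPop_uniformRule w p
    rw [e]
    exact (hOut.regression_y hR w).differentiableAt_integral (hOut.response_y hM) hD hc'.le hc₁ hb
  have hzd : DifferentiableAt ℝ (zPop D M P (uniformRule 𝒳 w)) pst := by
    rw [differentiableAt_euclidean]
    intro j
    have e : (fun p => zPop D M P (uniformRule 𝒳 w) p j)
        =ᶠ[𝓝 pst] fun p => (∫ ω, M.d (D.B 0 w ω) p j ∂P) - M.cap j := by
      filter_upwards [Metric.ball_mem_nhds pst hc₁] with p hp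
      exact zPop_uniformRule_apply hOut hM hD (hb hp) w j
    refine DifferentiableAt.congr_of_eventuallyEq ?_ e
    exact ((hOut.regression_d hR hM hD w j).differentiableAt_integral (hOut.response_d hM j) hD
      hc'.le hc₁ hb).sub_const _
  have hinj : Function.Injective (fderiv ℝ (zPop D M P (uniformRule 𝒳 w)) pst : Vec J →ₗ[ℝ] Vec J) := by
    rw [LinearMap.injective_iff_forall_lt_finrank_singularValues_pos]
    intro j hj
    rw [finrank_euclideanSpace_fin] at hj
    have := (hOut.singular _ hw j hj).1
    exact_mod_cast hc₃.trans_le this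
  set A : Vec J ≃L[ℝ] Vec J := (LinearEquiv.ofInjectiveEndo _ hinj).toContinuousLinearEquiv with hA
  have hAe : (A : Vec J →L[ℝ] Vec J) = fderiv ℝ (zPop D M P (uniformRule 𝒳 w)) pst := by
    ext1 v; rfl
  have hzA : HasFDerivAt (zPop D M P (uniformRule 𝒳 w)) (A : Vec J →L[ℝ] Vec J) pst := by
    rw [hAe]; exact hzd.hasFDerivAt
  refine ⟨hmem, h0, ?_, ?_⟩
  · have h1 := hyd.hasFDerivAt.sub ((nu D M P (uniformRule 𝒳 w) pst).hasFDerivAt.comp pst hzA)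
    refine h1.congr_fderiv ?_
    rw [nu, ← hAe, ContinuousLinearMap.inverse_equiv]
    ext v
    simp
  · refine exists_linear_growth hEq.compact ?_ h0 (hEq.unique _ hw) hzA
    rw [show zPop D M P (uniformRule 𝒳 w) = fun p => zPop D M P (uniformRule 𝒳 w) p from rfl]
    have : ContinuousOn (fun p => WithLp.ofLp (zPop D M P (uniformRule 𝒳 w) p)) M.S := by
      rw [continuousOn_pi]
      intro j
      refine ContinuousOn.congr (f := fun p => (∫ ω, M.d (D.B 0 w ω) p j ∂P) - M.cap j) ?_
        fun p hp => zPop_uniformRule_apply hOut hM hD hp w j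
      exact ((hOut.response_d hM j).continuousOn_integral hD w).sub continuousOn_const
    exact (PiLp.continuous_toLp 2 _).comp_continuousOn this

end Equilibrium

/-! ### Second moments and the Cauchy–Schwarz inequality. -/

section SecondMoments

variable {α : Type*} [MeasurableSpace α] {μ : Measure α}

lemma lintegral_sq_eq_eLpNorm (f : α → ℝ) :
    ∫⁻ x, ENNReal.ofReal (f x ^ 2) ∂μ = eLpNorm f 2 μ ^ 2 := by
  have h := eLpNorm_nnreal_pow_eq_lintegral (f := f) (μ := μ) (p := 2) (by norm_num)
  have h2 : eLpNorm f 2 μ ^ 2 = ∫⁻ x, ‖f x‖ₑ ^ 2 ∂μ := by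
    have e : ((2 : ℝ≥0) : ℝ≥0∞) = 2 := rfl
    rw [e] at h
    simpa using h
  rw [h2]
  refine lintegral_congr fun x => ?_
  rw [← sq_abs, ENNReal.ofReal_pow (abs_nonneg _), ← Real.enorm_eq_ofReal_abs]

lemma lintegral_sq_le_of_eLpNorm_le {f : α → ℝ} {r : ℝ} (hr : 0 ≤ r)
    (h : eLpNorm f 2 μ ≤ ENNReal.ofReal r) :
    ∫⁻ x, ENNReal.ofReal (f x ^ 2) ∂μ ≤ ENNReal.ofReal (r ^ 2) := by
  rw [lintegral_sq_eq_eLpNorm, ENNReal.ofReal_pow hr]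
  gcongr

/-- The Cauchy–Schwarz inequality. -/
lemma abs_integral_mul_le {f g : α → ℝ} (hf : AEStronglyMeasurable f μ)
    (hg : AEStronglyMeasurable g μ) {r s : ℝ} (hr : 0 ≤ r) (hs : 0 ≤ s)
    (h1 : eLpNorm f 2 μ ≤ ENNReal.ofReal r) (h2 : eLpNorm g 2 μ ≤ ENNReal.ofReal s) :
    |∫ x, f x * g x ∂μ| ≤ r * s := by
  have h3 : eLpNorm (f • g) 1 μ ≤ eLpNorm f 2 μ * eLpNorm g 2 μ :=
    eLpNorm_smul_le_mul_eLpNorm (p := 2) (q := 2) (r := 1) hg hf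
  have h4 : ‖∫ x, f x * g x ∂μ‖ₑ ≤ ENNReal.ofReal (r * s) := by
    refine (enorm_integral_le_lintegral_enorm _).trans ?_
    rw [ENNReal.ofReal_mul hr]
    refine le_trans ?_ (h3.trans (mul_le_mul' h1 h2))
    rw [eLpNorm_one_eq_lintegral_enorm]
    rfl
  rw [Real.enorm_eq_ofReal_abs] at h4
  exact (ENNReal.ofReal_le_ofReal_iff (by positivity)).1 h4

end SecondMoments

/-! ### Sums over a fold of functions fitted outside of it. -/

section CrossFitting

variable {Ω 𝒳 𝓑 : Type*} [MeasurableSpace Ω] [MeasurableSpace 𝒳] [MeasurableSpace 𝓑]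
  {P : Measure Ω} [IsProbabilityMeasure P] {D : Sample Ω 𝒳 𝓑} {k : Fin 3}

-- Given the training data, the fold sum has a centred part of variance at most `n r²` and a mean of
-- size at most `n b`. After division by `√n` these become `r` and `√n b`, both vanishing.
open Classical in
lemma negl_sum_fold (hD : IIDSample D P) {ψ : ∀ n, Split n → (Fin n → Obs 𝒳 𝓑) → Obs 𝒳 𝓑 → ℝ}
    (hψ : ∀ n s, Measurable fun z : (Fin n → Obs 𝒳 𝓑) × Obs 𝒳 𝓑 => ψ n s z.1 z.2)
    (hI : ∀ n s, InvariantOn (s.fold k) (ψ n s)) {r b : ℕ → ℝ} (hr0 : ∀ n, 0 ≤ r n)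
    (hr : Tendsto r atTop (𝓝 0)) (hb : Tendsto (fun n : ℕ => √n * b n) atTop (𝓝 0))
    (h : Whp P fun n ω => eLpNorm (ψ n (D.split n ω) (D.vec n ω)) 2 (D.law P) ≤ ENNReal.ofReal (r n)
      ∧ |∫ o, ψ n (D.split n ω) (D.vec n ω) o ∂(D.law P)| ≤ b n) :
    Negl P fun n ω => √n / n * ∑ i ∈ (D.split n ω).fold k,
      ψ n (D.split n ω) (D.vec n ω) (D.obs i ω) := by
  have := hD.isProbabilityMeasure_law
  -- The moment bound holds only with high probability, so `ψ` is replaced by zero where it fails.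
  -- The event depends on the data only through `ψ`, so the truncated function is still fitted
  -- outside the fold.
  set A : ∀ n, Split n → (Fin n → Obs 𝒳 𝓑) → Prop := fun n s O =>
    ∫⁻ o, ENNReal.ofReal (ψ n s O o ^ 2) ∂(D.law P) ≤ ENNReal.ofReal (r n ^ 2) with hA
  have hAm : ∀ n s, MeasurableSet {O | A n s O} := fun n s => by
    refine measurableSet_le ?_ measurable_const
    exact Measurable.lintegral_prod_right'
      (f := fun z : (Fin n → Obs 𝒳 𝓑) × Obs 𝒳 𝓑 => ENNReal.ofReal (ψ n s z.1 z.2 ^ 2))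
      (ENNReal.measurable_ofReal.comp ((hψ n s).pow_const 2))
  set φ : ∀ n, Split n → (Fin n → Obs 𝒳 𝓑) → Obs 𝒳 𝓑 → ℝ := fun n s O o =>
    if A n s O then ψ n s O o else 0 with hφ
  have hφm : ∀ n s, Measurable fun z : (Fin n → Obs 𝒳 𝓑) × Obs 𝒳 𝓑 => φ n s z.1 z.2 := fun n s =>
    Measurable.ite (measurable_fst (hAm n s)) (hψ n s) measurable_const
  have hφI : ∀ n s, InvariantOn (s.fold k) (φ n s) := fun n s O O' hO => by
    simp only [hφ, hA, hI n s O O' hO]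
  have hφb : ∀ n s O, ∫⁻ o, ENNReal.ofReal (φ n s O o ^ 2) ∂(D.law P) ≤ ENNReal.ofReal (r n ^ 2) := by
    intro n s O
    by_cases hO : A n s O
    · simp only [hφ, hO, if_true]; exact hO
    · simp [hφ, hO]
  set G : ∀ n, Split n → (Fin n → Obs 𝒳 𝓑) → ℝ := fun n s O =>
    √n / n * ∑ i ∈ s.fold k, (φ n s O (O i) - ∫ o, φ n s O o ∂(D.law P)) with hG
  have hGm : ∀ n s, Measurable (G n s) := fun n s => by
    refine (Finset.measurable_fun_sum _ fun i _ => Measurable.sub ?_ ?_).const_mul _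
    · exact (hφm n s).comp (measurable_id.prodMk (measurable_pi_apply i))
    · exact ((hφm n s).stronglyMeasurable.integral_prod_right' (ν := D.law P)).measurable
  have h1 : Negl P fun n ω => G n (D.split n ω) (D.vec n ω) := by
    refine Negl.of_lintegral_sq (fun n => hD.measurable_comp (hGm n)) (b := fun n => r n ^ 2)
      (by simpa using hr.pow 2) ?_
    filter_upwards [eventually_gt_atTop 0] with n hn
    have hn0 : (0 : ℝ) < n := by exact_mod_cast hn
    refine hD.lintegral_comp_le (F := fun s O => ENNReal.ofReal (G n s O ^ 2))
      (fun s => ENNReal.measurable_ofReal.comp ((hGm n s).pow_const 2)) fun s => ?_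
    have h2 := lintegral_sq_sum_invariantOn_le (D.law P) (hφm n s) (hφI n s) (sq_nonneg (r n)) (hφb n s)
    have e : ∀ O, ENNReal.ofReal (G n s O ^ 2) = ENNReal.ofReal (n : ℝ)⁻¹ *
        ENNReal.ofReal ((∑ i ∈ s.fold k, (φ n s O (O i) - ∫ o, φ n s O o ∂(D.law P))) ^ 2) := fun O => by
      rw [← ENNReal.ofReal_mul (by positivity), hG]
      congr 1
      rw [mul_pow, div_pow, Real.sq_sqrt hn0.le]
      field_simp
    simp_rw [e]
    rw [lintegral_const_mul' _ _ ENNReal.ofReal_ne_top]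
    refine (mul_le_mul_right h2 _).trans ?_
    rw [← ENNReal.ofReal_mul (by positivity)]
    refine ENNReal.ofReal_le_ofReal ?_
    have hc : ((s.fold k).card : ℝ) ≤ n := by
      have := (s.fold k).card_le_univ
      rw [Fintype.card_fin] at this
      exact_mod_cast this
    rw [← mul_assoc]
    refine mul_le_of_le_one_left (sq_nonneg _) ?_
    rw [inv_mul_le_iff₀ hn0]; linarith
  have h2 : Negl P fun n _ => √n * b n := Negl.of_tendsto hb
  refine (h1.abs.add h2.abs).of_whp_le (h.mono' fun n ω hω => ?_)
  have hAω : A n (D.split n ω) (D.vec n ω) := lintegral_sq_le_of_eLpNorm_le (hr0 n) hω.1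
  have hφψ : ∀ o, φ n (D.split n ω) (D.vec n ω) o = ψ n (D.split n ω) (D.vec n ω) o := fun o => by
    simp only [hφ, hAω, if_true]
  have hc : (((D.split n ω).fold k).card : ℝ) ≤ n := by
    have := ((D.split n ω).fold k).card_le_univ
    rw [Fintype.card_fin] at this
    exact_mod_cast this
  have hb0 : 0 ≤ b n := (abs_nonneg _).trans hω.2
  have e : √n / n * ∑ i ∈ (D.split n ω).fold k, ψ n (D.split n ω) (D.vec n ω) (D.obs i ω)
      = G n (D.split n ω) (D.vec n ω) + √n * ((((D.split n ω).fold k).card / n) *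
        ∫ o, ψ n (D.split n ω) (D.vec n ω) o ∂(D.law P)) := by
    simp only [hG, hφψ, Finset.sum_sub_distrib, Finset.sum_const, nsmul_eq_mul, Sample.vec]
    ring
  rw [e]
  refine (abs_add_le _ _).trans (le_trans ?_ (le_abs_self _))
  refine add_le_add le_rfl ?_
  rw [abs_mul, abs_mul, abs_mul, abs_of_nonneg (Real.sqrt_nonneg _), abs_of_nonneg hb0]
  gcongr
  refine (mul_le_of_le_one_left (abs_nonneg _) ?_).trans hω.2
  rw [abs_of_nonneg (by positivity)]
  exact div_le_one_of_le₀ hc (by positivity)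

end CrossFitting

/-! ### Truncated inverse propensity weights. -/

section InverseProbability

variable {κ e e' : ℝ} {w : Bool}

/-- The inverse of the probability of treatment `w`, truncated at `1 / κ`. -/
noncomputable def invProb (κ : ℝ) (w : Bool) (e : ℝ) : ℝ := (max κ (armProb w e))⁻¹

@[fun_prop]
lemma measurable_invProb (κ : ℝ) (w : Bool) : Measurable (invProb κ w) :=
  (measurable_const.max (measurable_armProb w)).inv

lemma invProb_nonneg (hκ : 0 < κ) : 0 ≤ invProb κ w e :=
  inv_nonneg.2 (hκ.le.trans (le_max_left _ _))

lemma invProb_le (hκ : 0 < κ) : invProb κ w e ≤ κ⁻¹ :=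
  inv_anti₀ hκ (le_max_left _ _)

/-- Truncation gives this bound at every point, as the maximal inequalities require; the estimated
scores themselves are bounded away from zero only almost everywhere. -/
lemma abs_invProb_le (hκ : 0 < κ) : |invProb κ w e| ≤ κ⁻¹ := by
  rw [abs_of_nonneg (invProb_nonneg hκ)]; exact invProb_le hκ

lemma invProb_of_le (h : κ ≤ armProb w e) : invProb κ w e = (armProb w e)⁻¹ := by
  rw [invProb, max_eq_right h]

/-- For `e` above the threshold, the left side is a difference of two truncated probabilities times
the weight, and truncation is 1-Lipschitz. -/
lemma abs_one_sub_mul_invProb_le (hκ : 0 < κ) (h : κ ≤ armProb w e) :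
    |1 - armProb w e * invProb κ w e'| ≤ κ⁻¹ * |e' - e| := by
  have hm : 0 < max κ (armProb w e') := hκ.trans_le (le_max_left _ _)
  have h1 : 1 - armProb w e * invProb κ w e'
      = (max κ (armProb w e') - max κ (armProb w e)) * invProb κ w e' := by
    rw [max_eq_right h, sub_mul, invProb, mul_inv_cancel₀ hm.ne']
  rw [h1, abs_mul, mul_comm, ← armProb_sub w e' e]
  exact mul_le_mul (abs_invProb_le hκ) ((abs_max_sub_max_le_abs _ _ κ).trans_eq' (by
    rw [max_comm, max_comm (armProb w e)])) (abs_nonneg _) (by positivity)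

lemma abs_invProb_sub_le (hκ : 0 < κ) (h : κ ≤ armProb w e) :
    |invProb κ w e' - invProb κ w e| ≤ κ⁻¹ ^ 2 * |e' - e| := by
  have h0 : 0 < armProb w e := hκ.trans_le h
  have h1 : invProb κ w e' - invProb κ w e
      = invProb κ w e * -(1 - armProb w e * invProb κ w e') := by
    rw [invProb_of_le h]; field_simp; ring
  rw [h1, abs_mul, abs_neg, sq, mul_assoc]
  exact mul_le_mul (abs_invProb_le hκ) (abs_one_sub_mul_invProb_le hκ h) (abs_nonneg _) (by positivity)

end InverseProbability

/-! ### The three error terms of the doubly-robust score and their moments. -/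

section Terms

variable {Ω 𝒳 𝓑 : Type*} {J : ℕ} [MeasurableSpace Ω] [MeasurableSpace 𝒳] [MeasurableSpace 𝓑]
  {P : Measure Ω} [IsProbabilityMeasure P] {D : Sample Ω 𝒳 𝓑} {M : Mechanism 𝓑 J}
  {R : Regressions 𝒳 J} {S : Set (Vec J)} {a : 𝓑 → Vec J → ℝ} {mu : 𝒳 → Vec J → ℝ} {c' κ : ℝ}
  {w : Bool} {pst : Vec J} {k : Fin 3}

lemma IIDSample.map_fst_law (hD : IIDSample D P) : (D.law P).map Prod.fst = P.map (D.X 0) := by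
  rw [Measure.map_map measurable_fst (hD.measurable_obs 0)]; rfl

lemma IIDSample.ae_law_fst (hD : IIDSample D P) {p : 𝒳 → Prop} (h : ∀ᵐ x ∂(P.map (D.X 0)), p x) :
    ∀ᵐ o ∂(D.law P), p o.1 := by
  rw [← hD.map_fst_law] at h
  exact ae_of_ae_map measurable_fst.aemeasurable h

lemma IIDSample.ae_law_fst' (hD : IIDSample D P) {p : 𝒳 → Prop} (hp : MeasurableSet {x | p x})
    (h : ∀ᵐ ω ∂P, p (D.X 0 ω)) : ∀ᵐ o ∂(D.law P), p o.1 :=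
  hD.ae_law_fst ((ae_map_iff (hD.measurable_X 0).aemeasurable hp).2 h)

lemma IIDSample.eLpNorm_law_fst (hD : IIDSample D P) {f : 𝒳 → ℝ} (hf : Measurable f) :
    eLpNorm (fun o => f o.1) 2 (D.law P) = eLpNorm f 2 (P.map (D.X 0)) := by
  rw [← hD.map_fst_law, eLpNorm_map_measure hf.aestronglyMeasurable measurable_fst.aemeasurable]
  rfl

/-- The weighted residual of the response with respect to its conditional mean. -/
noncomputable def propensityTerm (κ : ℝ) (w : Bool) (e η mu0 : 𝒳 → ℝ) (v : 𝓑 → ℝ) (o : Obs 𝒳 𝓑) : ℝ :=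
  if o.2.2.2 = w then (invProb κ w (η o.1) - invProb κ w (e o.1)) * (v (subOf w o) - mu0 o.1) else 0

/-- The error of the estimated conditional mean, weighted by `1 - 1(W = w) / P(W = w | X)`. -/
noncomputable def regressionTerm (κ : ℝ) (w : Bool) (η m mu0 : 𝒳 → ℝ) (o : Obs 𝒳 𝓑) : ℝ :=
  (m o.1 - mu0 o.1) - if o.2.2.2 = w then invProb κ w (η o.1) * (m o.1 - mu0 o.1) else 0

/-- The error splits by source: the cutoff, the propensity score, the regression. The regression
error carries the factor `1 - 1(W = w) / P̂(W = w | X)`, whose conditional mean is small; this makes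
the score insensitive to it to first order. -/
lemma drScore_sub {η m mu0 : 𝒳 → ℝ} {p : Vec J} {o : Obs 𝒳 𝓑}
    (h1 : κ ≤ armProb w (η o.1)) (h2 : κ ≤ armProb w (R.e o.1)) :
    drScore w o.2.2.2 (η o.1) (m o.1) (a (bidOf o) p)
        - drScore w o.2.2.2 (R.e o.1) (mu0 o.1) (a (subOf w o) pst)
      = incr w a pst (fun x => invProb κ w (η x)) p o
        + propensityTerm κ w R.e η mu0 (fun b => a b pst) o + regressionTerm κ w η m mu0 o := by
  simp only [drScore, incr, propensityTerm, regressionTerm]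
  rw [invProb_of_le h1, invProb_of_le h2]
  change _ + (_ / armProb w (η o.1)) • _ - (_ + (_ / armProb w (R.e o.1)) • _) = _
  by_cases h : o.2.2.2 = w
  · rw [bidOf_eq_subOf h]
    simp only [h, if_true, smul_eq_mul, one_div]
    ring
  · simp only [h, if_false, zero_div, zero_smul]
    ring

/-- An unconfounded i.i.d. sample in which the probability of treatment `w` is at least `κ`. -/
structure BoundedDesign (D : Sample Ω 𝒳 𝓑) (M : Mechanism 𝓑 J) (P : Measure Ω) (R : Regressions 𝒳 J)
    (κ : ℝ) (w : Bool) : Prop where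
  iid : IIDSample D P
  regr : IsRegressions D M P R
  ident : Identification D P R
  pos : 0 < κ
  overlap : ∀ᵐ x ∂(P.map (D.X 0)), κ ≤ armProb w (R.e x)

/-- Given `X`, the residual is centred in arm `w` by unconfoundedness, and the weight error is a
function of `X` alone. The mean is therefore exactly zero, however poor `η` is. -/
lemma integral_propensityTerm (hB : BoundedDesign D M P R κ w) (ha : RegularResponse D P S a)
    (hmu : ResponseRegression D P S w a mu c') (hp : pst ∈ S) {η : 𝒳 → ℝ} (hη : Measurable η) :
    ∫ o, propensityTerm κ w R.e η (fun x => mu x pst) (fun b => a b pst) o ∂(D.law P) = 0 := by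
  obtain ⟨hD, hR, hId, hκ, hov⟩ := hB
  have := hD.isProbabilityMeasure_law
  obtain ⟨K, hK0, hK⟩ := ha.bounded
  have hmm := hmu.measurable pst hp
  set g : 𝒳 → ℝ := fun x => armProb w (R.e x) * (invProb κ w (η x) - invProb κ w (R.e x)) with hg
  have hgm : Measurable g := by
    have := hR.measurable_e
    fun_prop
  have hgb : ∀ x, |g x| ≤ 1 * (κ⁻¹ + κ⁻¹) := fun x => by
    rw [abs_mul]
    refine mul_le_mul ?_ ((abs_sub _ _).trans (add_le_add (abs_invProb_le hκ) (abs_invProb_le hκ)))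
      (abs_nonneg _) zero_le_one
    rw [abs_of_pos (hId.armProb_pos w x)]
    exact (hId.armProb_lt_one w x).le
  have e1 := integral_trt_law hD hR hId w (G := fun x b =>
    (invProb κ w (η x) - invProb κ w (R.e x)) * (a b pst - mu x pst)) (by
      have h1 : Measurable fun z : 𝒳 × 𝓑 => a z.2 pst :=
        ha.measurable.comp (measurable_snd.prodMk measurable_const)
      have := hR.measurable_e
      have h2 : Measurable fun z : 𝒳 × 𝓑 => invProb κ w (η z.1) - invProb κ w (R.e z.1) := by fun_prop
      exact h2.mul (h1.sub (hmm.comp measurable_fst)))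
  refine e1.trans ?_
  have i1 : Integrable (fun o : Obs 𝒳 𝓑 => g o.1 * a (subOf w o) pst) (D.law P) :=
    Integrable.of_bound ((hgm.comp measurable_fst).mul (ha.measurable_sub pst w)).aestronglyMeasurable
      (1 * (κ⁻¹ + κ⁻¹) * K) (ae_of_all _ fun o => by
        rw [norm_mul]
        exact mul_le_mul (hgb _) (hK _ _ hp) (norm_nonneg _) (by positivity))
  have i2 : Integrable (fun o : Obs 𝒳 𝓑 => g o.1 * mu o.1 pst) (D.law P) := by
    refine Integrable.of_bound ((hgm.comp measurable_fst).mul (hmm.comp measurable_fst)).aestronglyMeasurable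
      (1 * (κ⁻¹ + κ⁻¹) * K) ?_
    filter_upwards [hD.ae_law_fst' (measurableSet_le hmm.abs measurable_const)
      (hmu.ae_abs_le hK hp)] with o ho
    rw [norm_mul]
    exact mul_le_mul (hgb _) ho (norm_nonneg _) (by positivity)
  have e2 : ∀ o : Obs 𝒳 𝓑, armProb w (R.e o.1) *
      ((invProb κ w (η o.1) - invProb κ w (R.e o.1)) * (a (subOf w o) pst - mu o.1 pst))
      = g o.1 * a (subOf w o) pst - g o.1 * mu o.1 pst := fun o => by simp only [hg]; ring
  simp_rw [e2]
  rw [integral_sub i1 i2, integral_mul_response hD ha hmu hgm (ae_of_all _ fun ω => hgb _) hp, sub_self]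

lemma eLpNorm_propensityTerm_le (hB : BoundedDesign D M P R κ w)
    (hmu : ResponseRegression D P S w a mu c') (hp : pst ∈ S) {K : ℝ}
    (hK : ∀ b, ∀ p ∈ S, |a b p| ≤ K) (hK0 : 0 ≤ K) {η : 𝒳 → ℝ} (hη : Measurable η) {re : ℝ}
    (hre : eLpNorm (fun x => η x - R.e x) 2 (P.map (D.X 0)) ≤ ENNReal.ofReal re) :
    eLpNorm (propensityTerm κ w R.e η (fun x => mu x pst) (fun b => a b pst)) 2 (D.law P)
      ≤ ENNReal.ofReal (κ⁻¹ ^ 2 * (2 * K) * re) := by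
  obtain ⟨hD, hR, hId, hκ, hov⟩ := hB
  have hmm := hmu.measurable pst hp
  have hem := hR.measurable_e
  rw [ENNReal.ofReal_mul (by positivity)]
  refine le_trans ?_ (mul_le_mul_right hre _)
  rw [← hD.eLpNorm_law_fst (by fun_prop)]
  refine eLpNorm_le_mul_eLpNorm_of_ae_le_mul ?_ _
  filter_upwards [hD.ae_law_fst hov, hD.ae_law_fst' (measurableSet_le hmm.abs measurable_const)
    (hmu.ae_abs_le hK hp)] with o h1 h2
  simp only [propensityTerm]
  split_ifs
  · rw [norm_mul]
    have h3 : ‖a (subOf w o) pst - mu o.1 pst‖ ≤ 2 * K :=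
      (norm_sub_le _ _).trans (by
        have := hK (subOf w o) pst hp
        simp only [Real.norm_eq_abs]; linarith)
    calc _ ≤ (κ⁻¹ ^ 2 * |η o.1 - R.e o.1|) * (2 * K) :=
          mul_le_mul (abs_invProb_sub_le hκ h1) h3 (norm_nonneg _) (by positivity)
      _ = _ := by rw [Real.norm_eq_abs]; ring
  · simp; positivity

lemma eLpNorm_regressionTerm_le (hB : BoundedDesign D M P R κ w) {η m mu0 : 𝒳 → ℝ} (hm : Measurable m) (hmu0 : Measurable mu0) {rm : ℝ}
    (hrm : eLpNorm (fun x => m x - mu0 x) 2 (P.map (D.X 0)) ≤ ENNReal.ofReal rm) :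
    eLpNorm (regressionTerm κ w η m mu0 : Obs 𝒳 𝓑 → ℝ) 2 (D.law P)
      ≤ ENNReal.ofReal ((1 + κ⁻¹) * rm) := by
  obtain ⟨hD, hR, hId, hκ, hov⟩ := hB
  rw [ENNReal.ofReal_mul (by positivity)]
  refine le_trans ?_ (mul_le_mul_right hrm _)
  rw [← hD.eLpNorm_law_fst (by fun_prop)]
  refine eLpNorm_le_mul_eLpNorm_of_ae_le_mul (ae_of_all _ fun o => ?_) _
  simp only [regressionTerm]
  refine (norm_sub_le _ _).trans ?_
  rw [add_mul, one_mul]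
  gcongr
  split_ifs
  · rw [norm_mul]
    gcongr
    exact abs_invProb_le hκ
  · simp; positivity

lemma eLpNorm_one_sub_le (hB : BoundedDesign D M P R κ w) {η : 𝒳 → ℝ} {re : ℝ}
    (hre : eLpNorm (fun x => η x - R.e x) 2 (P.map (D.X 0)) ≤ ENNReal.ofReal re) :
    eLpNorm (fun x => 1 - armProb w (R.e x) * invProb κ w (η x)) 2 (P.map (D.X 0))
      ≤ ENNReal.ofReal (κ⁻¹ * re) := by
  obtain ⟨hD, hR, hId, hκ, hov⟩ := hB
  rw [ENNReal.ofReal_mul (by positivity)]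
  refine le_trans ?_ (mul_le_mul_right hre _)
  refine eLpNorm_le_mul_eLpNorm_of_ae_le_mul ?_ _
  filter_upwards [hov] with x hx using abs_one_sub_mul_invProb_le hκ hx

/-- Integrating out the treatment turns the weight into `1 - e / ê` (truncated), which has `L²` norm
of order `re`; Cauchy–Schwarz against the regression error gives the product of the rates. -/
lemma abs_integral_regressionTerm_le (hB : BoundedDesign D M P R κ w) {η m mu0 : 𝒳 → ℝ} (hη : Measurable η) (hm : Measurable m)
    (hmu0 : Measurable mu0) {re rm : ℝ} (hre0 : 0 ≤ re) (hrm0 : 0 ≤ rm)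
    (hre : eLpNorm (fun x => η x - R.e x) 2 (P.map (D.X 0)) ≤ ENNReal.ofReal re)
    (hrm : eLpNorm (fun x => m x - mu0 x) 2 (P.map (D.X 0)) ≤ ENNReal.ofReal rm) :
    |∫ o, regressionTerm κ w η m mu0 o ∂(D.law P)| ≤ κ⁻¹ * re * rm := by
  obtain ⟨hD, hR, hId, hκ, hov⟩ := hB
  have := hD.isProbabilityMeasure_law
  have hem := hR.measurable_e
  have hd : Measurable fun o : Obs 𝒳 𝓑 => m o.1 - mu0 o.1 := by fun_prop
  have hL : MemLp (fun o : Obs 𝒳 𝓑 => m o.1 - mu0 o.1) 2 (D.law P) := by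
    refine ⟨hd.aestronglyMeasurable, ?_⟩
    have := hD.eLpNorm_law_fst (f := fun x => m x - mu0 x) (by fun_prop)
    exact (this.trans_le hrm).trans_lt ENNReal.ofReal_lt_top
  have i1 : Integrable (fun o : Obs 𝒳 𝓑 => m o.1 - mu0 o.1) (D.law P) := hL.integrable (by norm_num)
  have i2 : Integrable (fun o : Obs 𝒳 𝓑 =>
      if o.2.2.2 = w then invProb κ w (η o.1) * (m o.1 - mu0 o.1) else 0) (D.law P) := by
    refine (i1.norm.const_mul κ⁻¹).mono' (measurable_ite_trt w (by fun_prop) (by fun_prop)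
      measurable_const).aestronglyMeasurable (ae_of_all _ fun o => ?_)
    split_ifs
    · rw [norm_mul]
      gcongr
      exact abs_invProb_le hκ
    · simp; positivity
  have i3 : Integrable (fun o : Obs 𝒳 𝓑 =>
      armProb w (R.e o.1) * (invProb κ w (η o.1) * (m o.1 - mu0 o.1))) (D.law P) := by
    refine (i1.norm.const_mul κ⁻¹).mono' (Measurable.aestronglyMeasurable (by fun_prop))
      (ae_of_all _ fun o => ?_)
    rw [norm_mul, norm_mul]
    refine (mul_le_of_le_one_left (by positivity) ?_).trans (mul_le_mul_of_nonneg_right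
      (abs_invProb_le hκ) (norm_nonneg _))
    rw [Real.norm_eq_abs, abs_of_pos (hId.armProb_pos w _)]
    exact (hId.armProb_lt_one w _).le
  have e1 := integral_trt_law hD hR hId w (G := fun x _ => invProb κ w (η x) * (m x - mu0 x))
    (by fun_prop)
  have e2 : ∫ o, regressionTerm κ w η m mu0 o ∂(D.law P)
      = ∫ o, (1 - armProb w (R.e o.1) * invProb κ w (η o.1)) * (m o.1 - mu0 o.1) ∂(D.law P) := by
    simp only [regressionTerm]
    rw [integral_sub i1 i2, e1, ← integral_sub i1 i3]
    refine integral_congr_ae (ae_of_all _ fun o => ?_)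
    ring
  rw [e2]
  refine abs_integral_mul_le (Measurable.aestronglyMeasurable (by fun_prop)) hd.aestronglyMeasurable
    (by positivity) hrm0 ?_ ?_
  · exact (hD.eLpNorm_law_fst (f := fun x => 1 - armProb w (R.e x) * invProb κ w (η x))
      (by fun_prop)).trans_le (eLpNorm_one_sub_le ⟨hD, hR, hId, hκ, hov⟩ hre)
  · exact (hD.eLpNorm_law_fst (f := fun x => m x - mu0 x) (by fun_prop)).trans_le hrm

/-- Conditionally on the estimated propensity score, the weighted increment has mean equal to the
increment of the population mean, up to a bias of second order. -/
lemma abs_integral_incr_sub_le (hB : BoundedDesign D M P R κ w) (ha : RegularResponse D P S a)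
    (hmu : ResponseRegression D P S w a mu c') {C : ℝ} (hC : 0 ≤ C)
    (hlip : ∀ p ∈ S, ∀ᵐ ω ∂P, |mu (D.X 0 ω) p - mu (D.X 0 ω) pst| ≤ C * ‖p - pst‖)
    (hpst : pst ∈ S) {p : Vec J} (hp : p ∈ S) {η : 𝒳 → ℝ} (hη : Measurable η) {re : ℝ} (hre0 : 0 ≤ re)
    (hre : eLpNorm (fun x => η x - R.e x) 2 (P.map (D.X 0)) ≤ ENNReal.ofReal re) :
    |∫ o, incr w a pst (fun x => invProb κ w (η x)) p o ∂(D.law P)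
      - (∫ ω, a (D.B 0 w ω) p ∂P - ∫ ω, a (D.B 0 w ω) pst ∂P)| ≤ κ⁻¹ * re * (C * ‖p - pst‖) := by
  obtain ⟨hD, hR, hId, hκ, hov⟩ := hB
  have := hD.isProbabilityMeasure_law
  obtain ⟨K, hK0, hK⟩ := ha.bounded
  have hem := hR.measurable_e
  have hmm := hmu.measurable pst hpst
  have hmp := hmu.measurable p hp
  -- The relative error of the weight. By the tower property the mean of the increment misses the
  -- population increment by `-E[g(X) (mu(X, p) - mu(X, pst))]`, where `g` is of order `re` in `L²`
  -- and the other factor is at most `C ‖p - pst‖`.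
  set g : 𝒳 → ℝ := fun x => 1 - armProb w (R.e x) * invProb κ w (η x) with hg
  have hgm : Measurable g := by fun_prop
  have hgb : ∀ x, |g x| ≤ 1 + 1 * κ⁻¹ := fun x => by
    refine (abs_sub _ _).trans ?_
    rw [abs_one, abs_mul]
    gcongr
    · rw [abs_of_pos (hId.armProb_pos w x)]
      exact (hId.armProb_lt_one w x).le
    · exact abs_invProb_le hκ
  have ia : ∀ q ∈ S, Integrable (fun o : Obs 𝒳 𝓑 => a (subOf w o) q) (D.law P) := fun q hq =>
    Integrable.of_bound (ha.measurable_sub q w).aestronglyMeasurable K (ae_of_all _ fun o => hK _ _ hq)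
  have im : ∀ q ∈ S, Integrable (fun o : Obs 𝒳 𝓑 => mu o.1 q) (D.law P) := fun q hq => by
    have hq' := hmu.measurable q hq
    exact Integrable.of_bound (hq'.comp measurable_fst).aestronglyMeasurable K
      (hD.ae_law_fst' (measurableSet_le hq'.abs measurable_const) (hmu.ae_abs_le hK hq))
  have hgL : ∀ᵐ o ∂(D.law P), ‖g o.1‖ ≤ 1 + 1 * κ⁻¹ := ae_of_all _ fun o => hgb _
  have hgs : AEStronglyMeasurable (fun o : Obs 𝒳 𝓑 => g o.1) (D.law P) :=
    (hgm.comp measurable_fst).aestronglyMeasurable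
  have iga : ∀ q ∈ S, Integrable (fun o : Obs 𝒳 𝓑 => g o.1 * a (subOf w o) q) (D.law P) := fun q hq =>
    (ia q hq).bdd_mul hgs hgL
  have igm : ∀ q ∈ S, Integrable (fun o : Obs 𝒳 𝓑 => g o.1 * mu o.1 q) (D.law P) := fun q hq =>
    (im q hq).bdd_mul hgs hgL
  have e0 : ∀ q, ∫ o, a (subOf w o) q ∂(D.law P) = ∫ ω, a (D.B 0 w ω) q ∂P := fun q => by
    rw [integral_law hD (ha.measurable_sub q w)]; simp_rw [subOf_obs]
  have e1 : ∫ o, incr w a pst (fun x => invProb κ w (η x)) p o ∂(D.law P)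
      = ∫ o, armProb w (R.e o.1) * (invProb κ w (η o.1) * (a (subOf w o) p - a (subOf w o) pst))
        ∂(D.law P) := by
    rw [← integral_trt_law hD hR hId w (G := fun x b => invProb κ w (η x) * (a b p - a b pst)) (by
      have h1 : ∀ q, Measurable fun z : 𝒳 × 𝓑 => a z.2 q := fun q =>
        ha.measurable.comp (measurable_snd.prodMk measurable_const)
      have h2 : Measurable fun z : 𝒳 × 𝓑 => invProb κ w (η z.1) := by fun_prop
      exact h2.mul ((h1 p).sub (h1 pst)))]
    refine integral_congr_ae (ae_of_all _ fun o => ?_)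
    simp only [incr, ite_mul, zero_mul]
  have e2 : ∀ o : Obs 𝒳 𝓑,
      armProb w (R.e o.1) * (invProb κ w (η o.1) * (a (subOf w o) p - a (subOf w o) pst))
      = (a (subOf w o) p - a (subOf w o) pst) - (g o.1 * a (subOf w o) p - g o.1 * a (subOf w o) pst) :=
    fun o => by simp only [hg]; ring
  have e3 : ∀ q ∈ S, ∫ o, g o.1 * a (subOf w o) q ∂(D.law P) = ∫ o, g o.1 * mu o.1 q ∂(D.law P) :=
    fun q hq => integral_mul_response hD ha hmu hgm (ae_of_all _ fun ω => hgb _) hq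
  have i1 : Integrable (fun o : Obs 𝒳 𝓑 => a (subOf w o) p - a (subOf w o) pst) (D.law P) :=
    (ia p hp).sub (ia pst hpst)
  have i2 : Integrable (fun o : Obs 𝒳 𝓑 => g o.1 * a (subOf w o) p - g o.1 * a (subOf w o) pst)
      (D.law P) := (iga p hp).sub (iga pst hpst)
  have e4 : ∫ o, incr w a pst (fun x => invProb κ w (η x)) p o ∂(D.law P)
      - (∫ ω, a (D.B 0 w ω) p ∂P - ∫ ω, a (D.B 0 w ω) pst ∂P)
      = - ∫ o, g o.1 * (mu o.1 p - mu o.1 pst) ∂(D.law P) := by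
    rw [e1]
    simp_rw [e2, mul_sub]
    rw [integral_sub i1 i2, integral_sub (ia p hp) (ia pst hpst), integral_sub (iga p hp) (iga pst hpst),
      integral_sub (igm p hp) (igm pst hpst), e3 p hp, e3 pst hpst, e0, e0]
    ring
  rw [e4, abs_neg]
  refine abs_integral_mul_le hgs (Measurable.aestronglyMeasurable (by fun_prop))
    (by positivity) (by positivity) ?_ ?_
  · exact (hD.eLpNorm_law_fst hgm).trans_le (eLpNorm_one_sub_le ⟨hD, hR, hId, hκ, hov⟩ hre)
  · refine (eLpNorm_le_of_ae_bound (C := C * ‖p - pst‖) ?_).trans (by simp)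
    exact hD.ae_law_fst' (measurableSet_le (hmp.sub hmm).abs measurable_const) (hlip p hp)

end Terms

/-! ### Expansion of the estimated scores over one fold. -/

section FoldExpansion

variable {Ω 𝒳 𝓑 : Type*} {J : ℕ} [MeasurableSpace Ω] [MeasurableSpace 𝒳] [MeasurableSpace 𝓑]
  {P : Measure Ω} [IsProbabilityMeasure P] {D : Sample Ω 𝒳 𝓑} {M : Mechanism 𝓑 J}
  {R : Regressions 𝒳 J} {S : Set (Vec J)} {a : 𝓑 → Vec J → ℝ} {mu : 𝒳 → Vec J → ℝ} {c' κ : ℝ}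
  {w : Bool} {pst : Vec J} {k : Fin 3} {η m : ∀ n, Split n → (Fin n → Obs 𝒳 𝓑) → 𝒳 → ℝ}
  {re rm : ℕ → ℝ}

/-- Error rates of the propensity score and of the regressions whose product is `o(n^{-1/2})`. -/
structure VanishingRates (re rm : ℕ → ℝ) : Prop where
  nonneg_e : ∀ n, 0 ≤ re n
  nonneg_mu : ∀ n, 0 ≤ rm n
  tendsto_e : Tendsto re atTop (𝓝 0)
  tendsto_mu : Tendsto rm atTop (𝓝 0)
  tendsto_mul : Tendsto (fun n : ℕ => √n * (re n * rm n)) atTop (𝓝 0)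

/-- Estimates `η` of the propensity score and `m` of `mu0` that are fitted outside of fold `k`. -/
structure CrossFit (D : Sample Ω 𝒳 𝓑) (P : Measure Ω) (e mu0 : 𝒳 → ℝ) (k : Fin 3)
    (η m : ∀ n, Split n → (Fin n → Obs 𝒳 𝓑) → 𝒳 → ℝ) (re rm : ℕ → ℝ) : Prop where
  measurable_e : ∀ n s, Measurable fun z : (Fin n → Obs 𝒳 𝓑) × 𝒳 => η n s z.1 z.2
  measurable_mu : ∀ n s, Measurable fun z : (Fin n → Obs 𝒳 𝓑) × 𝒳 => m n s z.1 z.2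
  invariant_e : ∀ n (s : Split n), InvariantOn (s.fold k) (η n s)
  invariant_mu : ∀ n (s : Split n), InvariantOn (s.fold k) (m n s)
  rates : Whp P fun n ω =>
    eLpNorm (fun x => η n (D.split n ω) (D.vec n ω) x - e x) 2 (P.map (D.X 0)) ≤ ENNReal.ofReal (re n) ∧
    eLpNorm (fun x => m n (D.split n ω) (D.vec n ω) x - mu0 x) 2 (P.map (D.X 0)) ≤ ENNReal.ofReal (rm n)

lemma CrossFit.measurable_e_apply {e mu0 : 𝒳 → ℝ} (hF : CrossFit D P e mu0 k η m re rm) (n : ℕ)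
    (s : Split n) (O : Fin n → Obs 𝒳 𝓑) : Measurable (η n s O) :=
  (hF.measurable_e n s).comp (measurable_const.prodMk measurable_id)

lemma CrossFit.measurable_mu_apply {e mu0 : 𝒳 → ℝ} (hF : CrossFit D P e mu0 k η m re rm) (n : ℕ)
    (s : Split n) (O : Fin n → Obs 𝒳 𝓑) : Measurable (m n s O) :=
  (hF.measurable_mu n s).comp (measurable_const.prodMk measurable_id)

/-- There is no bias, so consistency of the propensity score is enough. -/
lemma negl_propensityTerm (hB : BoundedDesign D M P R κ w) (ha : RegularResponse D P S a)
    (hmu : ResponseRegression D P S w a mu c') (hp : pst ∈ S)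
    (hF : CrossFit D P R.e (fun x => mu x pst) k η m re rm) (hr : VanishingRates re rm) :
    Negl P fun n ω => √n / n * ∑ i ∈ (D.split n ω).fold k,
      propensityTerm κ w R.e (η n (D.split n ω) (D.vec n ω)) (fun x => mu x pst) (fun b => a b pst)
        (D.obs i ω) := by
  obtain ⟨K, hK0, hK⟩ := ha.bounded
  have hκ := hB.pos
  refine negl_sum_fold hB.iid (ψ := fun n s O => propensityTerm κ w R.e (η n s O) (fun x => mu x pst)
    (fun b => a b pst)) (r := fun n => κ⁻¹ ^ 2 * (2 * K) * re n) (b := fun _ => 0) ?_ ?_ ?_ ?_ ?_ ?_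
  · intro n s
    have h1 : Measurable fun z : (Fin n → Obs 𝒳 𝓑) × Obs 𝒳 𝓑 => η n s z.1 z.2.1 :=
      (hF.measurable_e n s).comp (measurable_fst.prodMk (measurable_fst.comp measurable_snd))
    have h2 : Measurable fun z : (Fin n → Obs 𝒳 𝓑) × Obs 𝒳 𝓑 => R.e z.2.1 :=
      hB.regr.measurable_e.comp (measurable_fst.comp measurable_snd)
    have h3 : Measurable fun z : (Fin n → Obs 𝒳 𝓑) × Obs 𝒳 𝓑 => a (subOf w z.2) pst :=
      (ha.measurable_sub pst w).comp measurable_snd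
    have h4 : Measurable fun z : (Fin n → Obs 𝒳 𝓑) × Obs 𝒳 𝓑 => mu z.2.1 pst :=
      (hmu.measurable pst hp).comp (measurable_fst.comp measurable_snd)
    exact measurable_ite_trt w (by fun_prop) ((((measurable_invProb κ w).comp h1).sub
      ((measurable_invProb κ w).comp h2)).mul (h3.sub h4)) measurable_const
  · intro n s O O' h
    simp only [hF.invariant_e n s O O' h]
  · intro n
    have := hr.nonneg_e n
    positivity
  · have := hr.tendsto_e.const_mul (κ⁻¹ ^ 2 * (2 * K))
    rwa [mul_zero] at this
  · simp
  · refine hF.rates.mono' fun n ω h => ⟨?_, ?_⟩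
    · exact eLpNorm_propensityTerm_le hB hmu hp hK hK0 (hF.measurable_e_apply _ _ _) h.1
    · rw [integral_propensityTerm hB ha hmu hp (hF.measurable_e_apply _ _ _), abs_zero]

/-- Consistency of the regression controls the variance; the product rate controls the bias. -/
lemma negl_regressionTerm (hB : BoundedDesign D M P R κ w) {mu0 : 𝒳 → ℝ} (hmu0 : Measurable mu0)
    (hF : CrossFit D P R.e mu0 k η m re rm) (hr : VanishingRates re rm) :
    Negl P fun n ω => √n / n * ∑ i ∈ (D.split n ω).fold k,
      regressionTerm κ w (η n (D.split n ω) (D.vec n ω)) (m n (D.split n ω) (D.vec n ω)) mu0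
        (D.obs i ω) := by
  have hκ := hB.pos
  refine negl_sum_fold hB.iid (ψ := fun n s O => regressionTerm κ w (η n s O) (m n s O) mu0)
    (r := fun n => (1 + κ⁻¹) * rm n) (b := fun n => κ⁻¹ * re n * rm n) ?_ ?_ ?_ ?_ ?_ ?_
  · intro n s
    have h1 : Measurable fun z : (Fin n → Obs 𝒳 𝓑) × Obs 𝒳 𝓑 => η n s z.1 z.2.1 :=
      (hF.measurable_e n s).comp (measurable_fst.prodMk (measurable_fst.comp measurable_snd))
    have h2 : Measurable fun z : (Fin n → Obs 𝒳 𝓑) × Obs 𝒳 𝓑 => m n s z.1 z.2.1 - mu0 z.2.1 :=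
      ((hF.measurable_mu n s).comp (measurable_fst.prodMk (measurable_fst.comp measurable_snd))).sub
        (hmu0.comp (measurable_fst.comp measurable_snd))
    exact h2.sub (measurable_ite_trt w (by fun_prop) (((measurable_invProb κ w).comp h1).mul h2)
      measurable_const)
  · intro n s O O' h
    simp only [hF.invariant_e n s O O' h, hF.invariant_mu n s O O' h]
  · intro n
    have := hr.nonneg_mu n
    positivity
  · have := hr.tendsto_mu.const_mul (1 + κ⁻¹)
    rwa [mul_zero] at this
  · have := hr.tendsto_mul.const_mul κ⁻¹
    rw [mul_zero] at this
    refine this.congr fun n => ?_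
    ring
  · refine hF.rates.mono' fun n ω h => ⟨?_, ?_⟩
    · exact eLpNorm_regressionTerm_le hB (hF.measurable_mu_apply _ _ _) hmu0 h.2
    · exact abs_integral_regressionTerm_le hB (hF.measurable_e_apply _ _ _)
        (hF.measurable_mu_apply _ _ _) hmu0 (hr.nonneg_e n) (hr.nonneg_mu n) h.1 h.2

lemma BoundedDesign.whp_overlap (hB : BoundedDesign D M P R κ w) :
    Whp P fun n ω => ∀ i : Fin n, κ ≤ armProb w (R.e (D.X i ω)) := by
  refine Whp.of_ae fun n => ae_all_iff.2 fun i => ?_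
  have hm : MeasurableSet {x | κ ≤ armProb w (R.e x)} := by
    have := hB.regr.measurable_e
    exact measurableSet_le measurable_const (by fun_prop)
  have hid : IdentDistrib (D.X i) (D.X 0) P P := (hB.iid.ident i).comp measurable_fst
  have h := hB.overlap
  rw [← hid.map_eq] at h
  exact (ae_map_iff (hB.iid.measurable_X i).aemeasurable hm).1 h

lemma one_le_eighthRoot {n : ℕ} (hn : 0 < n) : 1 ≤ eighthRoot n :=
  Real.one_le_rpow (by exact_mod_cast hn) (by norm_num)

lemma Negl.eighthRoot_of_sqrt {X : ℕ → Ω → ℝ} (h : Negl P fun n ω => √n / n * X n ω) {j : ℕ}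
    (hj : j ≤ 4) : Negl P fun n ω => eighthRoot n ^ j / n * X n ω := by
  refine h.of_whp_le (Whp.of_forall ?_)
  filter_upwards [eventually_gt_atTop 0] with n hn ω
  have h0 := eighthRoot_pos hn
  have h1 : eighthRoot n ^ j ≤ eighthRoot n ^ 4 := pow_le_pow_right₀ (one_le_eighthRoot hn) hj
  rw [abs_mul, abs_mul, sqrt_eq_eighthRoot]
  refine mul_le_mul_of_nonneg_right ?_ (abs_nonneg _)
  rw [abs_of_nonneg (by positivity : 0 ≤ eighthRoot n ^ j / n),
    abs_of_nonneg (by positivity : 0 ≤ eighthRoot n ^ 4 / n)]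
  gcongr

/-- The expansion of the doubly-robust score over fold `k`, up to a remainder that consists of a
negligible part and of a bias of second order. -/
theorem fold_expansion (hB : BoundedDesign D M P R κ w) (ha : RegularResponse D P S a)
    (hmu : ResponseRegression D P S w a mu c') {C : ℝ} (hC : 0 ≤ C)
    (hlip : ∀ p ∈ S, ∀ᵐ ω ∂P, |mu (D.X 0 ω) p - mu (D.X 0 ω) pst| ≤ C * ‖p - pst‖)
    (hpst : pst ∈ S) (hF : CrossFit D P R.e (fun x => mu x pst) k η m re rm)
    (hr : VanishingRates re rm)
    (hη : Whp P fun n ω => ∀ i ∈ (D.split n ω).fold k,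
      κ ≤ armProb w (η n (D.split n ω) (D.vec n ω) (D.X i ω)))
    {ph : ℕ → Ω → Vec J} {q : ∀ n, Split n → (Fin n → Obs 𝒳 𝓑) → S}
    (hq : Whp P fun n ω => (q n (D.split n ω) (D.vec n ω) : Vec J) = ph n ω) {j : ℕ} (hj : j ≤ 4)
    (hN : Negl P fun n ω => eighthRoot n ^ j / n * foldFluct D P S w a pst k
      (fun n s O x => invProb κ w (η n s O x)) q n (D.split n ω) (D.vec n ω)) :
    ∃ U, Negl P U ∧ Whp P fun n ω => |eighthRoot n ^ j / n *
      (∑ i ∈ (D.split n ω).fold k,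
        (drScore w (D.W i ω) (η n (D.split n ω) (D.vec n ω) (D.X i ω))
            (m n (D.split n ω) (D.vec n ω) (D.X i ω)) (a (D.bid i ω) (ph n ω))
          - drScore w (D.W i ω) (R.e (D.X i ω)) (mu (D.X i ω) pst) (a (D.B i w ω) pst))
        - ((D.split n ω).fold k).card *
          (∫ ω', a (D.B 0 w ω') (ph n ω) ∂P - ∫ ω', a (D.B 0 w ω') pst ∂P))|
      ≤ |U n ω| + eighthRoot n ^ j * (κ⁻¹ * re n * (C * ‖ph n ω - pst‖)) := by
  have h2 := (negl_propensityTerm hB ha hmu hpst hF hr).eighthRoot_of_sqrt hj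
  have h3 := (negl_regressionTerm hB (hmu.measurable pst hpst) hF hr).eighthRoot_of_sqrt hj
  refine ⟨_, (hN.add h2).add h3, ?_⟩
  refine ((((hη.and hq).and hB.whp_overlap).and hF.rates).and
    (Whp.of_forall (P := P) ((eventually_gt_atTop 0).mono fun n hn ω => hn))).mono' fun n ω h => ?_
  obtain ⟨⟨⟨⟨h4, h5⟩, h6⟩, h7⟩, hn⟩ := h
  set s := D.split n ω
  set O := D.vec n ω
  set g : 𝒳 → ℝ := fun x => invProb κ w (η n s O x) with hg
  -- The inequality holds for each fixed cutoff in `S`, with an integral over a fresh observation,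
  -- so the data-dependent cutoff may be inserted.
  have hbias := abs_integral_incr_sub_le hB ha hmu hC hlip hpst (h5 ▸ (q n s O).2)
    (hF.measurable_e_apply n s O) (hr.nonneg_e n) h7.1
  have hc : ((s.fold k).card : ℝ) ≤ n := by
    have := (s.fold k).card_le_univ
    rw [Fintype.card_fin] at this
    exact_mod_cast this
  have hn0 : (0 : ℝ) < n := by exact_mod_cast hn
  have he := eighthRoot_pos hn
  have hterm : ∀ i ∈ s.fold k,
      drScore w (D.W i ω) (η n s O (D.X i ω)) (m n s O (D.X i ω)) (a (D.bid i ω) (ph n ω))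
          - drScore w (D.W i ω) (R.e (D.X i ω)) (mu (D.X i ω) pst) (a (D.B i w ω) pst)
      = (incr w a pst g (ph n ω) (O i) - ∫ o, incr w a pst g (ph n ω) o ∂(D.law P))
        + ∫ o, incr w a pst g (ph n ω) o ∂(D.law P)
        + propensityTerm κ w R.e (η n s O) (fun x => mu x pst) (fun b => a b pst) (D.obs i ω)
        + regressionTerm κ w (η n s O) (m n s O) (fun x => mu x pst) (D.obs i ω) := by
    intro i hi
    have := drScore_sub (a := a) (pst := pst) (p := ph n ω) (R := R) (m := m n s O)
      (mu0 := fun x => mu x pst) (o := D.obs i ω) (h4 i hi) (h6 i)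
    rw [bidOf_obs, subOf_obs] at this
    rw [sub_add_cancel]
    exact this
  have hsum : ∑ i ∈ s.fold k,
      (drScore w (D.W i ω) (η n s O (D.X i ω)) (m n s O (D.X i ω)) (a (D.bid i ω) (ph n ω))
          - drScore w (D.W i ω) (R.e (D.X i ω)) (mu (D.X i ω) pst) (a (D.B i w ω) pst))
      = foldFluct D P S w a pst k (fun n s O x => invProb κ w (η n s O x)) q n s O
        + (s.fold k).card * ∫ o, incr w a pst g (ph n ω) o ∂(D.law P)
        + ∑ i ∈ s.fold k, propensityTerm κ w R.e (η n s O) (fun x => mu x pst) (fun b => a b pst) (D.obs i ω)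
        + ∑ i ∈ s.fold k, regressionTerm κ w (η n s O) (m n s O) (fun x => mu x pst) (D.obs i ω) := by
    rw [Finset.sum_congr rfl hterm, Finset.sum_add_distrib, Finset.sum_add_distrib,
      Finset.sum_add_distrib, Finset.sum_const, nsmul_eq_mul]
    simp only [foldFluct, foldSum, h5, hg]
  rw [hsum]
  set I := ∫ o, incr w a pst g (ph n ω) o ∂(D.law P)
  set Δ := ∫ ω', a (D.B 0 w ω') (ph n ω) ∂P - ∫ ω', a (D.B 0 w ω') pst ∂P
  set F := foldFluct D P S w a pst k (fun n s O x => invProb κ w (η n s O x)) q n s O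
  set A := ∑ i ∈ s.fold k, propensityTerm κ w R.e (η n s O) (fun x => mu x pst) (fun b => a b pst) (D.obs i ω)
  set B := ∑ i ∈ s.fold k, regressionTerm κ w (η n s O) (m n s O) (fun x => mu x pst) (D.obs i ω)
  -- The bias `I - Δ` enters with the share of the fold in the sample, which is at most one.
  have e : eighthRoot n ^ j / n * (F + (s.fold k).card * I + A + B - (s.fold k).card * Δ)
      = (eighthRoot n ^ j / n * F + eighthRoot n ^ j / n * A + eighthRoot n ^ j / n * B)
        + eighthRoot n ^ j * ((s.fold k).card / n * (I - Δ)) := by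
    field_simp; ring
  rw [e]
  refine (abs_add_le _ _).trans (add_le_add le_rfl ?_)
  rw [abs_mul, abs_of_nonneg (by positivity : 0 ≤ eighthRoot n ^ j), abs_mul]
  refine mul_le_mul_of_nonneg_left ?_ (by positivity)
  refine (mul_le_of_le_one_left (abs_nonneg _) ?_).trans hbias
  rw [abs_of_nonneg (by positivity)]
  exact div_le_one_of_le₀ hc hn0.le

end FoldExpansion

/-! ### Expansion over the full sample, at clipped second-step cutoffs. -/

section ScoreExpansion

variable {Ω 𝒳 𝓑 : Type*} {J : ℕ} [MeasurableSpace Ω] [MeasurableSpace 𝒳] [MeasurableSpace 𝓑]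
  {P : Measure Ω} [IsProbabilityMeasure P] {D : Sample Ω 𝒳 𝓑} {M : Mechanism 𝓑 J}
  {R : Regressions 𝒳 J} {S : Set (Vec J)} {a : 𝓑 → Vec J → ℝ} {mu : 𝒳 → Vec J → ℝ} {c' κ : ℝ}
  {w : Bool} {pst : Vec J} {η m : Fin 3 → ∀ n, Split n → (Fin n → Obs 𝒳 𝓑) → 𝒳 → ℝ}
  {re rm : ℕ → ℝ}

lemma sum_fold {n : ℕ} (s : Split n) (f : Fin 3 → Fin n → ℝ) :
    ∑ i, f (s i).1 i = ∑ k, ∑ i ∈ s.fold k, f k i := by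
  rw [← Finset.sum_fiberwise (s := Finset.univ) (g := fun i => (s i).1)]
  refine Finset.sum_congr rfl fun k _ => Finset.sum_congr rfl fun i hi => ?_
  rw [(Finset.mem_filter.1 hi).2]

/-- The error of the average estimated score of treatment `w` at the cutoffs `p`. -/
noncomputable def scoreError (D : Sample Ω 𝒳 𝓑) (P : Measure Ω) (e : 𝒳 → ℝ) (w : Bool)
    (a : 𝓑 → Vec J → ℝ) (mu0 : 𝒳 → ℝ) (pst : Vec J)
    (η m : Fin 3 → ∀ n, Split n → (Fin n → Obs 𝒳 𝓑) → 𝒳 → ℝ) (n : ℕ) (ω : Ω) (p : Vec J) : ℝ :=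
  1 / (n : ℝ) * ∑ i : Fin n, drScore w (D.W i ω)
      (η (D.split n ω i).1 n (D.split n ω) (D.vec n ω) (D.X i ω))
      (m (D.split n ω i).1 n (D.split n ω) (D.vec n ω) (D.X i ω)) (a (D.bid i ω) p)
    - 1 / (n : ℝ) * ∑ i : Fin n, drScore w (D.W i ω) (e (D.X i ω)) (mu0 (D.X i ω)) (a (D.B i w ω) pst)
    - (∫ ω', a (D.B 0 w ω') p ∂P - ∫ ω', a (D.B 0 w ω') pst ∂P)

/-- The remainder after scaling by `n^{j/8}` consists of a negligible part and a second-order bias. -/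
theorem score_expansion (hB : BoundedDesign D M P R κ w) (ha : RegularResponse D P S a)
    (hmu : ResponseRegression D P S w a mu c') {C : ℝ} (hC : 0 ≤ C)
    (hlip : ∀ p ∈ S, ∀ᵐ ω ∂P, |mu (D.X 0 ω) p - mu (D.X 0 ω) pst| ≤ C * ‖p - pst‖)
    (hpst : pst ∈ S) (hF : ∀ k, CrossFit D P R.e (fun x => mu x pst) k (η k) (m k) re rm)
    (hr : VanishingRates re rm)
    (hη : Whp P fun n ω => ∀ i : Fin n,
      κ ≤ armProb w (η (D.split n ω i).1 n (D.split n ω) (D.vec n ω) (D.X i ω)))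
    {ph : ℕ → Ω → Vec J} {q : ∀ n, Split n → (Fin n → Obs 𝒳 𝓑) → S}
    (hq : Whp P fun n ω => (q n (D.split n ω) (D.vec n ω) : Vec J) = ph n ω) {j : ℕ} (hj : j ≤ 4)
    (hN : ∀ k, Negl P fun n ω => eighthRoot n ^ j / n * foldFluct D P S w a pst k
      (fun n s O x => invProb κ w (η k n s O x)) q n (D.split n ω) (D.vec n ω)) :
    ∃ U, Negl P U ∧ Whp P fun n ω =>
      |eighthRoot n ^ j * scoreError D P R.e w a (fun x => mu x pst) pst η m n ω (ph n ω)|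
      ≤ |U n ω| + 3 * κ⁻¹ * C * re n * (eighthRoot n ^ j * ‖ph n ω - pst‖) := by
  have hη' : ∀ k, Whp P fun n ω => ∀ i ∈ (D.split n ω).fold k,
      κ ≤ armProb w (η k n (D.split n ω) (D.vec n ω) (D.X i ω)) := fun k =>
    hη.mono' fun n ω h i hi => by
      have := h i
      rwa [(Finset.mem_filter.1 hi).2] at this
  choose U hU hUle using fun k => fold_expansion hB ha hmu hC hlip hpst (hF k) hr (hη' k) hq hj (hN k)
  refine ⟨fun n ω => ∑ k, |U k n ω|, Negl.sum _ fun k _ => (hU k).abs, ?_⟩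
  refine ((Whp.all hUle).and
    (Whp.of_forall (P := P) ((eventually_gt_atTop 0).mono fun n hn ω => hn))).mono' fun n ω h => ?_
  obtain ⟨h, hn⟩ := h
  have hn0 : (n : ℝ) ≠ 0 := by exact_mod_cast hn.ne'
  set s := D.split n ω
  set O := D.vec n ω
  set Δ := ∫ ω', a (D.B 0 w ω') (ph n ω) ∂P - ∫ ω', a (D.B 0 w ω') pst ∂P with hΔ
  have hcard : (n : ℝ) = ∑ k, ((s.fold k).card : ℝ) := by
    have := sum_fold s fun _ _ => (1 : ℝ)
    simpa using this
  have e : eighthRoot n ^ j * scoreError D P R.e w a (fun x => mu x pst) pst η m n ω (ph n ω)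
      = ∑ k, eighthRoot n ^ j / n * (∑ i ∈ s.fold k,
        (drScore w (D.W i ω) (η k n s O (D.X i ω)) (m k n s O (D.X i ω)) (a (D.bid i ω) (ph n ω))
          - drScore w (D.W i ω) (R.e (D.X i ω)) (mu (D.X i ω) pst) (a (D.B i w ω) pst))
        - (s.fold k).card * Δ) := by
    rw [← Finset.mul_sum, Finset.sum_sub_distrib, ← Finset.sum_mul, ← hcard,
      ← sum_fold s fun k i => drScore w (D.W i ω) (η k n s O (D.X i ω)) (m k n s O (D.X i ω))
        (a (D.bid i ω) (ph n ω))
          - drScore w (D.W i ω) (R.e (D.X i ω)) (mu (D.X i ω) pst) (a (D.B i w ω) pst),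
      Finset.sum_sub_distrib, scoreError, ← hΔ]
    field_simp
    rfl
  rw [e]
  refine (Finset.abs_sum_le_sum_abs _ _).trans ((Finset.sum_le_sum fun k _ => h k).trans (le_of_eq ?_))
  rw [Finset.sum_add_distrib, abs_of_nonneg (Finset.sum_nonneg fun k _ => abs_nonneg (U k n ω))]
  simp only [Finset.sum_const, Finset.card_univ, Fintype.card_fin, nsmul_eq_mul]
  push_cast
  ring

section Selected

variable {L : Learners 𝒳 J} {π : 𝒳 → ℝ}

/-- The second step cutoffs where they belong to `T n`, and `pst` elsewhere. -/
noncomputable def clippedCutoff (M : Mechanism 𝓑 J) (L : Learners 𝒳 J) (π : 𝒳 → ℝ)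
    {T : ℕ → Set (Vec J)} (hTS : ∀ n, T n ⊆ S) (hpT : ∀ n, pst ∈ T n) (n : ℕ) (s : Split n)
    (O : Fin n → Obs 𝒳 𝓑) : S :=
  Set.inclusion (hTS n) (clip (hpT n) (pHatF M L π s) O)

lemma measurable_clippedCutoff (hM : MeasurableMechanism M) (hL : MeasurableLearners L)
    (hπ : Measurable π) {T : ℕ → Set (Vec J)} (hT : ∀ n, MeasurableSet (T n)) (hTS : ∀ n, T n ⊆ S)
    (hpT : ∀ n, pst ∈ T n) (n : ℕ) (s : Split n) :
    Measurable (clippedCutoff (𝒳 := 𝒳) M L π hTS hpT n s) :=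
  (measurable_inclusion (hTS n)).comp (measurable_clip (hpT n) (measurable_pHatF s hM hL hπ)
    (measurable_pHatF s hM hL hπ (hT n)))

lemma clippedCutoff_eq {T : ℕ → Set (Vec J)} (hTS : ∀ n, T n ⊆ S) (hpT : ∀ n, pst ∈ T n) {n : ℕ} {ω : Ω}
    (h : pHat D M L π n ω ∈ T n) :
    (clippedCutoff (𝒳 := 𝒳) M L π hTS hpT n (D.split n ω) (D.vec n ω) : Vec J) = pHat D M L π n ω := by
  rw [pHat_eq] at h ⊢
  exact clip_of_mem (hpT n) _ h

lemma CrossFit.measurable_invProb {e mu0 : 𝒳 → ℝ} {k : Fin 3}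
    (hF : CrossFit D P e mu0 k (η k) (m k) re rm) (n : ℕ) (s : Split n) :
    Measurable fun z : (Fin n → Obs 𝒳 𝓑) × 𝒳 => invProb κ w (η k n s z.1 z.2) :=
  (CutoffMarket.measurable_invProb κ w).comp (hF.measurable_e n s)

/-- First pass, at scale `n^{1/4}`: only membership of the cutoff in `S` is used. -/
theorem score_expansion_crude (hB : BoundedDesign D M P R κ w) (ha : RegularResponse D P S a)
    (hmu : ResponseRegression D P S w a mu c') {C : ℝ} (hC : 0 ≤ C)
    (hlip : ∀ p ∈ S, ∀ᵐ ω ∂P, |mu (D.X 0 ω) p - mu (D.X 0 ω) pst| ≤ C * ‖p - pst‖)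
    (hpst : pst ∈ S) (hF : ∀ k, CrossFit D P R.e (fun x => mu x pst) k (η k) (m k) re rm)
    (hr : VanishingRates re rm)
    (hη : Whp P fun n ω => ∀ i : Fin n,
      κ ≤ armProb w (η (D.split n ω i).1 n (D.split n ω) (D.vec n ω) (D.X i ω)))
    (hM : MeasurableMechanism M) (hL : MeasurableLearners L) (hπ : Measurable π)
    (hS : IsClosed S) (hph : Whp P fun n ω => pHat D M L π n ω ∈ S) :
    ∃ U, Negl P U ∧ Whp P fun n ω => |eighthRoot n ^ 2 *
        scoreError D P R.e w a (fun x => mu x pst) pst η m n ω (pHat D M L π n ω)|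
      ≤ |U n ω| + 3 * κ⁻¹ * C * re n * (eighthRoot n ^ 2 * ‖pHat D M L π n ω - pst‖) := by
  have hκ := hB.pos
  have hTS : ∀ _ : ℕ, S ⊆ S := fun _ => le_rfl
  have hpT : ∀ _ : ℕ, pst ∈ S := fun _ => hpst
  refine score_expansion hB ha hmu hC hlip hpst hF hr hη
    (q := clippedCutoff M L π hTS hpT) (hph.mono' fun n ω h => clippedCutoff_eq hTS hpT h)
    (by norm_num) fun k => ?_
  exact ha.negl_foldFluct_crude hB.iid hpst (fun n s => (hF k).measurable_invProb n s)
    (fun n s O O' h => by simp only [(hF k).invariant_e n s O O' h])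
    (fun n s O x => abs_invProb_le hκ) (by positivity)
    (measurable_clippedCutoff hM hL hπ (fun _ => hS.measurableSet) hTS hpT)

/-- Second pass, at scale `√n`: the rate `o_p(n^{-1/4})` puts the cutoff in the shrinking ball with
high probability, where clipping to the ball is inactive. -/
theorem score_expansion_fine (hB : BoundedDesign D M P R κ w) (ha : RegularResponse D P S a)
    (hmu : ResponseRegression D P S w a mu c') {C : ℝ} (hC : 0 ≤ C)
    (hlip : ∀ p ∈ S, ∀ᵐ ω ∂P, |mu (D.X 0 ω) p - mu (D.X 0 ω) pst| ≤ C * ‖p - pst‖)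
    (hpst : pst ∈ S) (hF : ∀ k, CrossFit D P R.e (fun x => mu x pst) k (η k) (m k) re rm)
    (hr : VanishingRates re rm)
    (hη : Whp P fun n ω => ∀ i : Fin n,
      κ ≤ armProb w (η (D.split n ω i).1 n (D.split n ω) (D.vec n ω) (D.X i ω)))
    (hM : MeasurableMechanism M) (hL : MeasurableLearners L) (hπ : Measurable π)
    (hS : IsClosed S) (hph : Whp P fun n ω => pHat D M L π n ω ∈ S)
    (hrate : Negl P fun n ω => eighthRoot n ^ 2 * ‖pHat D M L π n ω - pst‖) :
    ∃ U, Negl P U ∧ Whp P fun n ω => |eighthRoot n ^ 4 *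
        scoreError D P R.e w a (fun x => mu x pst) pst η m n ω (pHat D M L π n ω)|
      ≤ |U n ω| + 3 * κ⁻¹ * C * re n * (eighthRoot n ^ 4 * ‖pHat D M L π n ω - pst‖) := by
  have hκ := hB.pos
  set T : ℕ → Set (Vec J) := fun n => S ∩ {p | ‖p - pst‖ ≤ (eighthRoot n)⁻¹ ^ 2} with hT
  have hTS : ∀ n, T n ⊆ S := fun _ => Set.inter_subset_left
  have hpT : ∀ n, pst ∈ T n := fun n => ⟨hpst, by
    have := eighthRoot_nonneg n
    simp only [Set.mem_ofPred_eq, sub_self, norm_zero]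
    positivity⟩
  have hTm : ∀ n, MeasurableSet (T n) := fun n =>
    hS.measurableSet.inter (measurableSet_le (by fun_prop) measurable_const)
  have hphT : Whp P fun n ω => pHat D M L π n ω ∈ T n := by
    refine ((hph.and (hrate 1 one_pos)).and
      (Whp.of_forall (P := P) ((eventually_gt_atTop 0).mono fun n hn ω => hn))).mono' fun n ω h => ?_
    obtain ⟨⟨h1, h2⟩, hn⟩ := h
    refine ⟨h1, ?_⟩
    have h0 := eighthRoot_pos hn
    rw [abs_of_nonneg (by positivity)] at h2
    simp only [Set.mem_ofPred_eq]
    rw [inv_pow, ← one_div, le_div_iff₀ (by positivity), mul_comm]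
    exact h2.le
  refine score_expansion hB ha hmu hC hlip hpst hF hr hη
    (q := clippedCutoff M L π hTS hpT) (hphT.mono' fun n ω h => clippedCutoff_eq hTS hpT h)
    le_rfl fun k => ?_
  exact ha.negl_foldFluct_fine hB.iid hpst (fun n s => (hF k).measurable_invProb n s)
    (fun n s O O' h => by simp only [(hF k).invariant_e n s O O' h])
    (fun n s O x => abs_invProb_le hκ) (by positivity)
    (measurable_clippedCutoff hM hL hπ hTm hTS hpT)
    (fun n s O => (clip (hpT n) (pHatF M L π s) O).2.2)

end Selected
end ScoreExpansion

/-! ### From test-point assumptions to the members of the sample. -/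

section Nuisances

variable {Ω 𝒳 𝓑 : Type*} {J : ℕ} [MeasurableSpace Ω] [MeasurableSpace 𝒳] [MeasurableSpace 𝓑]
  {P : Measure Ω} [IsProbabilityMeasure P] {D : Sample Ω 𝒳 𝓑} {M : Mechanism 𝓑 J}
  {L : Learners 𝒳 J} {R : Regressions 𝒳 J} {Rules : Set (𝒳 → ℝ)} {pstar : (𝒳 → ℝ) → Vec J}
  {c' c₃ c₄ κ : ℝ} {w : Bool} {π : 𝒳 → ℝ}

/-- The hypothesis concerns an independent test point. For `i` in fold `k`, `X_i` is such a point,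
because the fit for fold `k` does not use it; the bad event then has the same null integral, split
by split. -/
lemma ae_eHatAt_mem (hD : IIDSample D P) (hL : MeasurableLearners L) {I : Set ℝ}
    (hI : MeasurableSet I)
    (h : ∀ᵐ ω ∂P, ∀ n k, ∀ᵐ x ∂(P.map (D.X 0)), eHat D L n k ω x ∈ I) (n : ℕ) :
    ∀ᵐ ω ∂P, ∀ i : Fin n, eHatAt D L n ω i ∈ I := by
  have := hD.isProbabilityMeasure_law
  rw [ae_all_iff]
  intro i
  have key : ∀ k, ∀ᵐ ω ∂P, (D.split n ω i).1 = k → eHat D L n k ω (D.X i ω) ∈ I := by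
    intro k
    set B : Split n → (Fin n → Obs 𝒳 𝓑) → Obs 𝒳 𝓑 → ℝ≥0∞ := fun s O o =>
      Iᶜ.indicator 1 (eHatF L s k O o.1) with hB
    have hBm : ∀ s, Measurable fun z : (Fin n → Obs 𝒳 𝓑) × Obs 𝒳 𝓑 => B s z.1 z.2 := fun s =>
      (measurable_one.indicator hI.compl).comp ((measurable_eHatF s k hL).comp
        (measurable_fst.prodMk (measurable_fst.comp measurable_snd)))
    have hBI : ∀ s : Split n, InvariantOn (s.fold k) (B s) := fun s O O' hO => by
      simp only [hB, invariantOn_eHatF L s k O O' hO]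
    have hBm' : ∀ s, Measurable fun O : Fin n → Obs 𝒳 𝓑 => ∫⁻ o, B s O o ∂(D.law P) := fun s =>
      (hBm s).lintegral_prod_right'
    have hBi : ∀ s, Measurable fun O : Fin n → Obs 𝒳 𝓑 => if i ∈ s.fold k then B s O (O i) else 0 := by
      intro s
      split_ifs
      · exact (hBm s).comp (measurable_id.prodMk (measurable_pi_apply i))
      · exact measurable_const
    have h0 : ∫⁻ ω, ∫⁻ o, B (D.split n ω) (D.vec n ω) o ∂(D.law P) ∂P = 0 := by
      rw [lintegral_eq_zero_iff (hD.measurable_comp hBm')]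
      filter_upwards [h] with ω hω
      have h1 := hD.ae_law_fst (hω n k)
      simp only [Pi.zero_apply]
      refine lintegral_eq_zero_of_ae_eq_zero ?_
      filter_upwards [h1] with o ho
      rw [eHat_eq] at ho
      simp [hB, ho]
    have h2 : ∫⁻ ω, (if i ∈ (D.split n ω).fold k then B (D.split n ω) (D.vec n ω) (D.vec n ω i) else 0) ∂P
        = 0 := by
      rw [hD.lintegral_comp (F := fun s O => if i ∈ s.fold k then B s O (O i) else 0) hBi]
      rw [hD.lintegral_comp hBm', Finset.sum_eq_zero_iff] at h0
      refine Finset.sum_eq_zero fun s hs => ?_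
      by_cases hi : i ∈ s.fold k
      · simp only [hi, if_true]
        rw [lintegral_eval_of_invariantOn (D.law P) hi (hBm s) (hBI s)]
        exact h0 s hs
      · simp [hi]
    rw [lintegral_eq_zero_iff (hD.measurable_comp hBi)] at h2
    filter_upwards [h2] with ω hω hk
    have hi : i ∈ (D.split n ω).fold k := by simp [Split.fold, hk]
    simp only [hi, if_true, Pi.zero_apply, hB] at hω
    by_contra hcon
    rw [eHat_eq] at hcon
    rw [Set.indicator_of_mem (show eHatF L (D.split n ω) k (D.vec n ω) (D.vec n ω i).1 ∈ Iᶜ from hcon)] at hω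
    simp at hω
  filter_upwards [ae_all_iff.2 key] with ω hω using hω _ rfl

lemma whp_overlap_eHat (hD : IIDSample D P) (hL : MeasurableLearners L)
    (h : ∀ᵐ ω ∂P, ∀ n k, ∀ᵐ x ∂(P.map (D.X 0)), eHat D L n k ω x ∈ Set.Ioo κ (1 - κ)) (w : Bool) :
    Whp P fun n ω => ∀ i : Fin n, κ ≤ armProb w (eHatF L (D.split n ω) (D.split n ω i).1 (D.vec n ω) (D.X i ω)) := by
  refine Whp.of_ae fun n => ?_
  filter_upwards [ae_eHatAt_mem hD hL measurableSet_Ioo h n] with ω hω i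
  have := hω i
  rw [eHatAt, eHat_eq] at this
  cases w
  · simp only [armProb, Bool.false_eq_true, if_false]; linarith [this.2]
  · simp only [armProb, if_true]; exact this.1.le

/-- The regression is fitted at the first-step cutoff but is needed as an estimate at `p*`. The gap
costs `C` times the error of that cutoff, which is how `rth` joins the regression rate. Through
`hle`, the outcome and each coordinate of demand inherit the joint error bound. -/
lemma crossFit_of_rates {S : Set (Vec J)} {a : 𝓑 → Vec J → ℝ} {mu : 𝒳 → Vec J → ℝ} {k : Fin 3}
    {m : ∀ n, Split n → (Fin n → Obs 𝒳 𝓑) → 𝒳 → ℝ} {rmu re rth : ℕ → ℝ}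
    (hD : IIDSample D P) (hL : MeasurableLearners L)
    (hmu : ResponseRegression D P S w a mu c') {C : ℝ} (hC : 0 ≤ C)
    (hlip : ∀ p ∈ S, ∀ᵐ ω ∂P, |mu (D.X 0 ω) p - mu (D.X 0 ω) (pstar π)| ≤ C * ‖p - pstar π‖)
    (hpst : pstar π ∈ S)
    (hmm : ∀ n s, Measurable fun z : (Fin n → Obs 𝒳 𝓑) × 𝒳 => m n s z.1 z.2)
    (hmI : ∀ n (s : Split n), InvariantOn (s.fold k) (m n s))
    (hr0 : ∀ n, 0 ≤ rmu n)
    (hrates : Whp P fun n ω => RatesHold D M L P R pstar (rmu n) (re n) (rth n) π n k ω)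
    (hS : Whp P fun n ω => pFirst D M L π n k ω ∈ S)
    (hle : ∀ n ω x, |m n (D.split n ω) (D.vec n ω) x - mu x (pFirst D M L π n k ω)| ≤
      √((muYHat D M L n k ω w x (pFirst D M L π n k ω) - R.muY w x (pFirst D M L π n k ω)) ^ 2
        + ‖muDHat D M L n k ω w x (pFirst D M L π n k ω)
            - R.muD w x (pFirst D M L π n k ω)‖ ^ 2)) :
    CrossFit D P R.e (fun x => mu x (pstar π)) k (fun _ s O => eHatF L s k O) m re
      (fun n => rmu n + C * rth n) where
  measurable_e _ s := measurable_eHatF s k hL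
  measurable_mu := hmm
  invariant_e _ s := invariantOn_eHatF L s k
  invariant_mu := hmI
  rates := by
    refine (hrates.and hS).mono' fun n ω h => ⟨h.1.2.1, ?_⟩
    obtain ⟨⟨h1, -, h3⟩, hp⟩ := h
    set p := pFirst D M L π n k ω
    have hPX : IsProbabilityMeasure (P.map (D.X 0)) :=
      Measure.isProbabilityMeasure_map (hD.measurable_X 0).aemeasurable
    have hm0 : Measurable (m n (D.split n ω) (D.vec n ω)) :=
      (hmm n _).comp (measurable_const.prodMk measurable_id)
    have hmp := hmu.measurable p hp
    have hms := hmu.measurable _ hpst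
    have e : (fun x => m n (D.split n ω) (D.vec n ω) x - mu x (pstar π))
        = (fun x => m n (D.split n ω) (D.vec n ω) x - mu x p) + fun x => mu x p - mu x (pstar π) := by
      ext x; simp
    have hth : 0 ≤ rth n := (norm_nonneg _).trans h3
    rw [e, ENNReal.ofReal_add (hr0 n) (by positivity)]
    refine (eLpNorm_add_le (hm0.sub hmp).aestronglyMeasurable (hmp.sub hms).aestronglyMeasurable
      (by norm_num)).trans (add_le_add ?_ ?_)
    · refine le_trans (eLpNorm_mono fun x => ?_) (h1 w)
      rw [Real.norm_eq_abs, Real.norm_eq_abs, abs_of_nonneg (Real.sqrt_nonneg _)]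
      exact hle n ω x
    · refine (eLpNorm_le_of_ae_bound (C := C * rth n) ?_).trans (by simp)
      refine (ae_map_iff (hD.measurable_X 0).aemeasurable
        (measurableSet_le (hmp.sub hms).norm measurable_const)).2 ?_
      filter_upwards [hlip p hp] with ω' hω'
      exact hω'.trans (by gcongr)

end Nuisances

/-! ### Root-`n` rate of the cutoffs and elimination of them from the value. -/

section Linearization

variable {Ω : Type*} [MeasurableSpace Ω] {P : Measure Ω} {J : ℕ}

/-- `X` is negligible up to an error of smaller order than `Δ`. -/
def NeglUpTo (P : Measure Ω) (r : ℕ → ℝ) (Δ X : ℕ → Ω → ℝ) : Prop :=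
  ∃ (U : ℕ → Ω → ℝ) (C : ℝ), Negl P U ∧ Whp P fun n ω => |X n ω| ≤ |U n ω| + C * r n * Δ n ω

lemma NeglUpTo.negl {r : ℕ → ℝ} {Δ X : ℕ → Ω → ℝ} (h : NeglUpTo P r Δ X)
    (hr : Tendsto r atTop (𝓝 0)) (hΔ : Tight P Δ) : Negl P X := by
  obtain ⟨U, C, hU, hle⟩ := h
  have h1 : Negl P fun n (_ : Ω) => C * r n := Negl.of_tendsto (by simpa using hr.const_mul C)
  refine (hU.abs.add (h1.mul_tight hΔ)).of_whp_le (hle.mono' fun n ω h => ?_)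
  exact h.trans (le_abs_self _)

/-- Since `r` tends to zero, the bias `(∑ C_j) r Δ` is eventually at most `(c / 2) Δ` and moves to
the left side, at the price of the factor `2 / c`. -/
lemma exists_le_of_absorb {r : ℕ → ℝ} {Δ : ℕ → Ω → ℝ} {V X : Fin J → ℕ → Ω → ℝ} {c : ℝ} (hc : 0 < c)
    (hr : Tendsto r atTop (𝓝 0)) (hΔ : ∀ n ω, 0 ≤ Δ n ω) (hX : ∀ j, NeglUpTo P r Δ (X j))
    (hle : Whp P fun n ω => c * Δ n ω ≤ ∑ j, (|V j n ω| + |X j n ω|)) :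
    ∃ U, Negl P U ∧ Whp P fun n ω => Δ n ω ≤ 2 / c * (∑ j, |V j n ω| + U n ω) := by
  choose U C hU hXle using hX
  refine ⟨fun n ω => ∑ j, |U j n ω|, Negl.sum _ fun j _ => (hU j).abs, ?_⟩
  have h1 : ∀ᶠ n in atTop, (∑ j, C j) * r n ≤ c / 2 := by
    have : Tendsto (fun n => (∑ j, C j) * r n) atTop (𝓝 0) := by simpa using hr.const_mul (∑ j, C j)
    exact this.eventually_le_const (by positivity)
  refine (((Whp.all hXle).and hle).and (Whp.of_forall (P := P) (h1.mono fun n h _ => h))).mono'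
    fun n ω h => ?_
  obtain ⟨⟨h2, h3⟩, h4⟩ := h
  have h5 : ∑ j, |X j n ω| ≤ ∑ j, |U j n ω| + (∑ j, C j) * r n * Δ n ω := by
    refine (Finset.sum_le_sum fun j _ => h2 j).trans (le_of_eq ?_)
    rw [Finset.sum_add_distrib, Finset.sum_mul, Finset.sum_mul]
  have h6 := mul_le_mul_of_nonneg_right h4 (hΔ n ω)
  rw [Finset.sum_add_distrib] at h3
  rw [div_mul_eq_mul_div, le_div_iff₀ hc]
  linarith

lemma norm_le_sum_abs (v : Vec J) : ‖v‖ ≤ ∑ j, |v j| := by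
  rw [EuclideanSpace.norm_eq]
  refine (Real.sqrt_le_sqrt (Finset.sum_sq_le_sq_sum_of_nonneg fun j _ => norm_nonneg _)).trans ?_
  rw [Real.sqrt_sq (Finset.sum_nonneg fun j _ => norm_nonneg _)]
  exact le_rfl

lemma Negl.tendsto_small {ph : ℕ → Ω → Vec J} {pst : Vec J}
    (h : Negl P fun n ω => eighthRoot n ^ 2 * ‖ph n ω - pst‖) {δ : ℝ} (hδ : 0 < δ) :
    Whp P fun n ω => ‖ph n ω - pst‖ < δ := by
  refine ((h δ hδ).and
    (Whp.of_forall (P := P) ((eventually_gt_atTop 0).mono fun n hn ω => hn))).mono' fun n ω h => ?_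
  obtain ⟨h1, hn⟩ := h
  have h2 := one_le_eighthRoot hn
  refine lt_of_le_of_lt ?_ h1
  rw [abs_mul, abs_norm]
  refine le_mul_of_one_le_left (norm_nonneg _) ?_
  rw [abs_of_nonneg (by positivity)]
  exact one_le_pow₀ h2

/-- If the moment conditions `z` are solved up to `o(n^{-1/2})` by `ph`, then the value at `ph` is
asymptotically linear. -/
theorem negl_linearization {y : Vec J → ℝ} {z : Vec J → Vec J} {ν : Vec J →L[ℝ] ℝ} {pst : Vec J}
    {S : Set (Vec J)} (hz : z pst = 0)
    (hζ : HasFDerivAt (fun p => y p - ν (z p)) (0 : Vec J →L[ℝ] ℝ) pst) {c : ℝ} (hc : 0 < c)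
    (hgrowth : ∀ p ∈ S, c * ‖p - pst‖ ≤ ‖z p‖)
    {ph Zh T : ℕ → Ω → Vec J} {Yh Y : ℕ → Ω → ℝ} {r rg : ℕ → ℝ} (hr : Tendsto r atTop (𝓝 0))
    (hrg : Tendsto (fun n : ℕ => √n * rg n) atTop (𝓝 0))
    (hph : Whp P fun n ω => ph n ω ∈ S) (hZh : Whp P fun n ω => ‖Zh n ω‖ ≤ rg n)
    (hT : ∀ j, Tight P fun n ω => eighthRoot n ^ 4 * T n ω j)
    (hcrude : ∀ j, NeglUpTo P r (fun n ω => eighthRoot n ^ 2 * ‖ph n ω - pst‖)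
      fun n ω => eighthRoot n ^ 2 * (Zh n ω j - T n ω j - z (ph n ω) j))
    (hfine : Negl P (fun n ω => eighthRoot n ^ 2 * ‖ph n ω - pst‖) →
      ∀ j, NeglUpTo P r (fun n ω => eighthRoot n ^ 4 * ‖ph n ω - pst‖)
        fun n ω => eighthRoot n ^ 4 * (Zh n ω j - T n ω j - z (ph n ω) j))
    (hfineY : Negl P (fun n ω => eighthRoot n ^ 2 * ‖ph n ω - pst‖) →
      NeglUpTo P r (fun n ω => eighthRoot n ^ 4 * ‖ph n ω - pst‖)
        fun n ω => eighthRoot n ^ 4 * (Yh n ω - Y n ω - (y (ph n ω) - y pst))) :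
    Negl P fun n ω => √n * (Yh n ω - (Y n ω - ν (T n ω))) := by
  have hΔ0 : ∀ (e n : ℕ) ω, 0 ≤ eighthRoot n ^ e * ‖ph n ω - pst‖ := fun e n ω => by
    have := eighthRoot_nonneg n
    positivity
  -- `z(ph)` equals the nearly solved equation `Zh` minus the sampling error `T` minus the
  -- remainder; linear growth turns this into a bound on the distance, at any scale.
  have hbound : ∀ e : ℕ, Whp P fun n ω => c * (eighthRoot n ^ e * ‖ph n ω - pst‖) ≤
      ∑ j, (|eighthRoot n ^ e * (|T n ω j| + |rg n|)|
        + |eighthRoot n ^ e * (Zh n ω j - T n ω j - z (ph n ω) j)|) := fun e => by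
    refine (hph.and hZh).mono' fun n ω h => ?_
    have h0 := eighthRoot_nonneg n
    have h1 := hgrowth _ h.1
    have h2 : ∀ j, |z (ph n ω) j| ≤ |T n ω j| + |rg n| + |Zh n ω j - T n ω j - z (ph n ω) j| := fun j => by
      have h3 : |Zh n ω j| ≤ |rg n| := (PiLp.norm_apply_le (Zh n ω) j).trans (h.2.trans (le_abs_self _))
      have h4 : z (ph n ω) j = Zh n ω j - T n ω j - (Zh n ω j - T n ω j - z (ph n ω) j) := by ring
      have h5 := abs_sub (Zh n ω j - T n ω j) (Zh n ω j - T n ω j - z (ph n ω) j)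
      have h6 := abs_sub (Zh n ω j) (T n ω j)
      rw [← h4] at h5
      linarith
    calc c * (eighthRoot n ^ e * ‖ph n ω - pst‖) = eighthRoot n ^ e * (c * ‖ph n ω - pst‖) := by ring
      _ ≤ eighthRoot n ^ e * ∑ j, |z (ph n ω) j| := by
          gcongr
          exact h1.trans (norm_le_sum_abs _)
      _ ≤ eighthRoot n ^ e * ∑ j, (|T n ω j| + |rg n| + |Zh n ω j - T n ω j - z (ph n ω) j|) := by
          gcongr with j
          exact h2 j
      _ = _ := by
          rw [Finset.mul_sum]
          refine Finset.sum_congr rfl fun j _ => ?_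
          rw [abs_mul, abs_mul, abs_of_nonneg (by positivity : 0 ≤ eighthRoot n ^ e),
            abs_of_nonneg (by positivity : 0 ≤ |T n ω j| + |rg n|)]
          ring
  have hrg4 : Negl P fun n (_ : Ω) => eighthRoot n ^ 4 * |rg n| := by
    refine Negl.of_tendsto ?_
    have := hrg.abs
    rw [abs_zero] at this
    refine this.congr fun n => ?_
    rw [abs_mul, abs_of_nonneg (Real.sqrt_nonneg _), sqrt_eq_eighthRoot]
  have hV4 : ∀ j, Tight P fun n ω => eighthRoot n ^ 4 * (|T n ω j| + |rg n|) := fun j => by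
    have h1 : Tight P fun n ω => |eighthRoot n ^ 4 * T n ω j| :=
      (hT j).of_whp_le (Whp.of_forall (Eventually.of_forall fun n ω => by rw [abs_abs]))
    refine (h1.add hrg4.tight).of_whp_le (Whp.of_forall (Eventually.of_forall fun n ω => ?_))
    rw [abs_mul (eighthRoot n ^ 4) (T n ω j), abs_of_nonneg (by positivity : 0 ≤ eighthRoot n ^ 4), mul_add]
  have hV2 : ∀ j, Negl P fun n ω => eighthRoot n ^ 2 * (|T n ω j| + |rg n|) := fun j => by
    have h1 : Negl P fun n (_ : Ω) => (eighthRoot n)⁻¹ ^ 2 :=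
      Negl.of_tendsto (by simpa using tendsto_inv_eighthRoot.pow 2)
    refine (h1.mul_tight (hV4 j)).of_le fun n ω => le_of_eq ?_
    congr 1
    rcases eq_or_ne (eighthRoot n) 0 with h | h
    · simp [h]
    · field_simp
  -- First pass: `T` is `O_p(n^{-1/2})`, so at scale `n^{1/4}` everything but the absorbed bias
  -- vanishes.
  have hrate : Negl P fun n ω => eighthRoot n ^ 2 * ‖ph n ω - pst‖ := by
    obtain ⟨U, hU, hle⟩ := exists_le_of_absorb hc hr (hΔ0 2) hcrude (hbound 2)
    refine (((Negl.sum Finset.univ fun j _ => (hV2 j).abs).add hU).const_mul (2 / c)).of_whp_le ?_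
    exact hle.mono' fun n ω h => by
      rw [abs_of_nonneg (hΔ0 2 n ω)]
      exact h.trans (le_abs_self _)
  -- Second pass: localization makes the fine expansion available, and the distance is of order
  -- `n^{-1/2}`.
  have htight : Tight P fun n ω => eighthRoot n ^ 4 * ‖ph n ω - pst‖ := by
    obtain ⟨U, hU, hle⟩ := exists_le_of_absorb hc hr (hΔ0 4) (hfine hrate) (hbound 4)
    have hs : Tight P fun n ω => ∑ j, |eighthRoot n ^ 4 * (|T n ω j| + |rg n|)| :=
      Tight.sum _ fun j _ => (hV4 j).of_whp_le (Whp.of_forall (Eventually.of_forall fun n ω => by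
        rw [abs_abs]))
    refine ((hs.add hU.tight).const_mul (2 / c)).of_whp_le ?_
    exact hle.mono' fun n ω h => by
      rw [abs_of_nonneg (hΔ0 4 n ω)]
      exact h.trans (le_abs_self _)
  have hEd : ∀ j, Negl P fun n ω => eighthRoot n ^ 4 * (Zh n ω j - T n ω j - z (ph n ω) j) := fun j =>
    (hfine hrate j).negl hr htight
  have hEy := (hfineY hrate).negl hr htight
  -- Since `y - ν z` has derivative zero at `pst`, its change is `o(‖ph - pst‖)`, which is
  -- `o_p(n^{-1/2})` by tightness.
  have hTaylor : Negl P fun n ω => eighthRoot n ^ 4 *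
      ((y (ph n ω) - ν (z (ph n ω))) - (y pst - ν (z pst))) := by
    have hsmall : ∀ ε > 0, Whp P fun n ω =>
        |(y (ph n ω) - ν (z (ph n ω))) - (y pst - ν (z pst))| ≤ ε * ‖ph n ω - pst‖ := fun ε hε => by
      obtain ⟨δ, hδ, hl⟩ := Metric.eventually_nhds_iff.1 (hζ.isLittleO.def hε)
      refine (Negl.tendsto_small hrate hδ).mono' fun n ω h => ?_
      have := hl (by rwa [dist_eq_norm] : dist (ph n ω) pst < δ)
      simpa using this
    intro ε hε
    refine ENNReal.tendsto_nhds_zero.2 fun δ hδ => ?_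
    obtain ⟨B, hB⟩ := htight (δ / 2) (ENNReal.half_pos hδ.ne')
    have h1 := ENNReal.tendsto_nhds_zero.1 (hsmall (ε / (|B| + 1)) (by positivity)) (δ / 2)
      (ENNReal.half_pos hδ.ne')
    filter_upwards [hB, h1] with n h2 h3
    rw [← ENNReal.add_halves δ]
    refine le_trans (measure_mono fun ω hω => ?_) ((measure_union_le _ _).trans (add_le_add h2 h3))
    by_contra hcon
    simp only [Set.mem_union, Set.mem_ofPred_eq, not_or, not_not] at hcon hω
    apply hω
    have h0 := eighthRoot_nonneg n
    rw [abs_of_nonneg (hΔ0 4 n ω)] at hcon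
    rw [abs_mul, abs_of_nonneg (by positivity)]
    calc _ ≤ eighthRoot n ^ 4 * (ε / (|B| + 1) * ‖ph n ω - pst‖) := by gcongr; exact hcon.2
      _ = ε / (|B| + 1) * (eighthRoot n ^ 4 * ‖ph n ω - pst‖) := by ring
      _ ≤ ε / (|B| + 1) * |B| := by gcongr; exact hcon.1.trans (le_abs_self _)
      _ < ε := by
        rw [div_mul_eq_mul_div, div_lt_iff₀ (by positivity)]
        nlinarith
  have hbig : Negl P fun n ω => ‖ν‖ * (∑ j, |eighthRoot n ^ 4 * (Zh n ω j - T n ω j - z (ph n ω) j)|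
      + eighthRoot n ^ 4 * |rg n|) :=
    ((Negl.sum _ fun j _ => (hEd j).abs).add hrg4).const_mul _
  refine ((hEy.add hTaylor).abs.add hbig).of_whp_le (hZh.mono' fun n ω h => ?_)
  have h0 := eighthRoot_nonneg n
  -- Adding and subtracting `ν (Zh)` cancels `y(ph)` and `z(ph)`: what is left is the two
  -- remainders, the Taylor term and the nearly zero `ν (Zh)`.
  have e : √n * (Yh n ω - (Y n ω - ν (T n ω)))
      = (eighthRoot n ^ 4 * (Yh n ω - Y n ω - (y (ph n ω) - y pst)) + eighthRoot n ^ 4 *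
      ((y (ph n ω) - ν (z (ph n ω))) - (y pst - ν (z pst))))
      + eighthRoot n ^ 4 * (ν (Zh n ω) - ν (Zh n ω - T n ω - z (ph n ω))) := by
    rw [sqrt_eq_eighthRoot, hz]
    simp only [map_sub, map_zero]
    ring
  rw [e]
  refine (abs_add_le _ _).trans (le_trans (add_le_add le_rfl ?_) (le_abs_self _))
  rw [abs_mul, abs_of_nonneg (by positivity : 0 ≤ eighthRoot n ^ 4)]
  have h1 : |ν (Zh n ω) - ν (Zh n ω - T n ω - z (ph n ω))|
      ≤ ‖ν‖ * (|rg n| + ∑ j, |Zh n ω j - T n ω j - z (ph n ω) j|) := by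
    refine (abs_sub _ _).trans ?_
    rw [mul_add]
    refine add_le_add ((ν.le_opNorm _).trans ?_) ((ν.le_opNorm _).trans ?_)
    · gcongr
      exact h.trans (le_abs_self _)
    · gcongr
      exact norm_le_sum_abs _
  refine (mul_le_mul_of_nonneg_left h1 (by positivity)).trans (le_of_eq ?_)
  have h2 : ∑ j, |eighthRoot n ^ 4 * (Zh n ω j - T n ω j - z (ph n ω) j)|
      = eighthRoot n ^ 4 * ∑ j, |Zh n ω j - T n ω j - z (ph n ω) j| := by
    rw [Finset.mul_sum]
    refine Finset.sum_congr rfl fun j _ => ?_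
    rw [abs_mul, abs_of_nonneg (by positivity : 0 ≤ eighthRoot n ^ 4)]
  rw [h2]
  ring

end Linearization

/-! ### Moments of the scores with population nuisance functions. -/

section PopulationScores

variable {Ω 𝒳 𝓑 : Type*} {J : ℕ} [MeasurableSpace Ω] [MeasurableSpace 𝒳] [MeasurableSpace 𝓑]
  {P : Measure Ω} [IsProbabilityMeasure P] {D : Sample Ω 𝒳 𝓑} {M : Mechanism 𝓑 J}
  {R : Regressions 𝒳 J} {S : Set (Vec J)} {a : 𝓑 → Vec J → ℝ} {mu : 𝒳 → Vec J → ℝ} {c' κ : ℝ}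
  {w : Bool} {pst : Vec J}

/-- The doubly-robust score of one participant with the population nuisance functions. -/
noncomputable def starScore (w : Bool) (e mu0 : 𝒳 → ℝ) (v : 𝓑 → ℝ) (o : Obs 𝒳 𝓑) : ℝ :=
  drScore w o.2.2.2 (e o.1) (mu0 o.1) (v (subOf w o))

lemma starScore_eq (w : Bool) (e mu0 : 𝒳 → ℝ) (v : 𝓑 → ℝ) (o : Obs 𝒳 𝓑) :
    starScore w e mu0 v o = mu0 o.1 + if o.2.2.2 = w then
      (armProb w (e o.1))⁻¹ * (v (subOf w o) - mu0 o.1) else 0 := by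
  rw [starScore, drScore]
  change _ + (_ / armProb w (e o.1)) • _ = _
  split_ifs <;> simp

lemma measurable_starScore (hR : IsRegressions D M P R) (ha : RegularResponse D P S a)
    (hmu : ResponseRegression D P S w a mu c') (hp : pst ∈ S) :
    Measurable (starScore (𝓑 := 𝓑) w R.e (fun x => mu x pst) fun b => a b pst) :=
  measurable_drScore w (by fun_prop) (hR.measurable_e.comp measurable_fst)
    ((hmu.measurable pst hp).comp measurable_fst) (ha.measurable_sub pst w)

/-- Uniform overlap makes the score almost surely bounded, by `K + 2K / κ`. -/
lemma memLp_starScore (hB : BoundedDesign D M P R κ w) (ha : RegularResponse D P S a)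
    (hmu : ResponseRegression D P S w a mu c') (hp : pst ∈ S) :
    MemLp (starScore (𝓑 := 𝓑) w R.e (fun x => mu x pst) fun b => a b pst) 2 (D.law P) := by
  have := hB.iid.isProbabilityMeasure_law
  have hκ := hB.pos
  obtain ⟨K, hK0, hK⟩ := ha.bounded
  refine MemLp.of_bound (measurable_starScore hB.regr ha hmu hp).aestronglyMeasurable
    (K + κ⁻¹ * (2 * K)) ?_
  filter_upwards [hB.iid.ae_law_fst hB.overlap,
    hB.iid.ae_law_fst' (measurableSet_le (hmu.measurable pst hp).abs measurable_const)
      (hmu.ae_abs_le hK hp)] with o h1 h2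
  rw [starScore_eq]
  refine (norm_add_le _ _).trans (add_le_add h2 ?_)
  have h0 : 0 < armProb w (R.e o.1) := hκ.trans_le h1
  split_ifs
  · rw [norm_mul, norm_inv, Real.norm_eq_abs, Real.norm_eq_abs, abs_of_pos h0]
    have h3 : |a (subOf w o) pst - mu o.1 pst| ≤ 2 * K :=
      (abs_sub _ _).trans (by have := hK (subOf w o) pst hp; linarith)
    gcongr
  · simp; positivity

/-- Integrating out the treatment cancels the inverse propensity, and the conditional mean then
drops out. -/
lemma integral_starScore (hB : BoundedDesign D M P R κ w) (ha : RegularResponse D P S a)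
    (hmu : ResponseRegression D P S w a mu c') (hp : pst ∈ S) :
    ∫ o, starScore w R.e (fun x => mu x pst) (fun b => a b pst) o ∂(D.law P)
      = ∫ ω, a (D.B 0 w ω) pst ∂P := by
  have := hB.iid.isProbabilityMeasure_law
  obtain ⟨K, hK0, hK⟩ := ha.bounded
  have hmm := hmu.measurable pst hp
  have ia : Integrable (fun o : Obs 𝒳 𝓑 => a (subOf w o) pst) (D.law P) :=
    Integrable.of_bound (ha.measurable_sub pst w).aestronglyMeasurable K (ae_of_all _ fun o => hK _ _ hp)
  have im : Integrable (fun o : Obs 𝒳 𝓑 => mu o.1 pst) (D.law P) :=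
    Integrable.of_bound (hmm.comp measurable_fst).aestronglyMeasurable K
      (hB.iid.ae_law_fst' (measurableSet_le hmm.abs measurable_const) (hmu.ae_abs_le hK hp))
  have is := (memLp_starScore hB ha hmu hp).integrable (by norm_num)
  have it : Integrable (fun o : Obs 𝒳 𝓑 => if o.2.2.2 = w then
      (armProb w (R.e o.1))⁻¹ * (a (subOf w o) pst - mu o.1 pst) else 0) (D.law P) := by
    refine (is.sub im).congr (ae_of_all _ fun o => ?_)
    simp only [Pi.sub_apply, starScore_eq, add_sub_cancel_left]
  simp_rw [starScore_eq]
  rw [integral_add im it, integral_trt_law hB.iid hB.regr hB.ident w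
    (G := fun x b => (armProb w (R.e x))⁻¹ * (a b pst - mu x pst)) (by
      have h1 : Measurable fun z : 𝒳 × 𝓑 => a z.2 pst :=
        ha.measurable.comp (measurable_snd.prodMk measurable_const)
      have h2 : Measurable fun z : 𝒳 × 𝓑 => (armProb w (R.e z.1))⁻¹ := by
        have := hB.regr.measurable_e
        fun_prop
      exact h2.mul (h1.sub (hmm.comp measurable_fst)))]
  have e1 : ∀ o : Obs 𝒳 𝓑, armProb w (R.e o.1) *
      ((armProb w (R.e o.1))⁻¹ * (a (subOf w o) pst - mu o.1 pst)) = a (subOf w o) pst - mu o.1 pst :=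
    fun o => by rw [mul_inv_cancel_left₀ (hB.ident.armProb_pos w _).ne']
  simp_rw [e1]
  rw [integral_sub ia im, add_sub_cancel, integral_law hB.iid (ha.measurable_sub pst w)]
  simp_rw [subOf_obs]

/-- The variance of the normalized sum is bounded by the second moment of `f` uniformly in `n`, and
Chebyshev's inequality applies. -/
lemma tight_sum_sub_integral (hD : IIDSample D P) {f : Obs 𝒳 𝓑 → ℝ} (hf : Measurable f)
    (hL : MemLp f 2 (D.law P)) :
    Tight P fun n ω => √n / n * ∑ i : Fin n, (f (D.obs i ω) - ∫ o, f o ∂(D.law P)) := by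
  have := hD.isProbabilityMeasure_law
  set b := ∫ o, f o ^ 2 ∂(D.law P) with hb
  have hb0 : 0 ≤ b := integral_nonneg fun o => sq_nonneg _
  have hfb : ∫⁻ o, ENNReal.ofReal (f o ^ 2) ∂(D.law P) ≤ ENNReal.ofReal b := by
    rw [hb, ofReal_integral_eq_lintegral_ofReal hL.integrable_sq (ae_of_all _ fun o => sq_nonneg _)]
  have hGm : ∀ n (_ : Split n), Measurable fun O : Fin n → Obs 𝒳 𝓑 =>
      √n / n * ∑ i : Fin n, (f (O i) - ∫ o, f o ∂(D.law P)) := fun n _ =>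
    (Finset.measurable_fun_sum _ fun i _ => (hf.comp (measurable_pi_apply i)).sub_const _).const_mul _
  refine Tight.of_lintegral_sq (b := b) (fun n => hD.measurable_comp (hGm n)) fun n => ?_
  refine hD.lintegral_comp_le (F := fun _ O =>
    ENNReal.ofReal ((√n / n * ∑ i : Fin n, (f (O i) - ∫ o, f o ∂(D.law P))) ^ 2))
    (fun s => ENNReal.measurable_ofReal.comp ((hGm n s).pow_const 2)) fun s => ?_
  have h2 := lintegral_sq_sum_invariantOn_le (ι := Fin n) (D.law P) (I := Finset.univ)
    (ψ := fun _ => f) (hf.comp measurable_snd) (fun _ _ _ => rfl) hb0 fun _ => hfb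
  rcases Nat.eq_zero_or_pos n with rfl | hn
  · simp
  have hn0 : (0 : ℝ) < n := by exact_mod_cast hn
  have e : ∀ O : Fin n → Obs 𝒳 𝓑,
      ENNReal.ofReal ((√n / n * ∑ i : Fin n, (f (O i) - ∫ o, f o ∂(D.law P))) ^ 2)
        = ENNReal.ofReal (n : ℝ)⁻¹ *
        ENNReal.ofReal ((∑ i : Fin n, (f (O i) - ∫ o, f o ∂(D.law P))) ^ 2) := fun O => by
    rw [← ENNReal.ofReal_mul (by positivity)]
    congr 1
    rw [mul_pow, div_pow, Real.sq_sqrt hn0.le]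
    field_simp
  simp_rw [e]
  rw [lintegral_const_mul' _ _ ENNReal.ofReal_ne_top]
  refine (mul_le_mul_right h2 _).trans ?_
  rw [← ENNReal.ofReal_mul (by positivity), Finset.card_univ, Fintype.card_fin,
    inv_mul_cancel_left₀ hn0.ne']

end PopulationScores

/-! ### Asymptotic linearity of the estimated value of a uniform rule. -/

section Value

variable {Ω 𝒳 𝓑 : Type*} {J : ℕ} [MeasurableSpace Ω] [MeasurableSpace 𝒳] [MeasurableSpace 𝓑]
  {P : Measure Ω} [IsProbabilityMeasure P] {D : Sample Ω 𝒳 𝓑} {M : Mechanism 𝓑 J}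
  {L : Learners 𝒳 J} {R : Regressions 𝒳 J} {Rules : Set (𝒳 → ℝ)} {pstar : (𝒳 → ℝ) → Vec J}
  {c' c₃ c₄ κ : ℝ} {w : Bool}

lemma drScore_apply (w W : Bool) (e : ℝ) (mu v : Vec J) (j : Fin J) :
    drScore w W e mu v j = drScore w W e (mu j) (v j) := by
  simp [drScore]

lemma NeglUpTo.congr {r : ℕ → ℝ} {Δ X Y : ℕ → Ω → ℝ} (h : NeglUpTo P r Δ Y)
    (hXY : Whp P fun n ω => X n ω = Y n ω) : NeglUpTo P r Δ X := by
  obtain ⟨U, C, hU, hle⟩ := h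
  exact ⟨U, C, hU, (hle.and hXY).mono' fun n ω h => by rw [h.2]; exact h.1⟩

lemma valueHat_uniformRule (w : Bool) (n : ℕ) (ω : Ω) :
    valueHat D M L (uniformRule 𝒳 w) n ω = 1 / (n : ℝ) * ∑ i : Fin n,
      scoreYHat D M L (uniformRule 𝒳 w) n ω w i (pHat D M L (uniformRule 𝒳 w) n ω) := by
  cases w <;> simp [valueHat, uniformRule]

lemma mem_clearingSetHat_uniformRule {w : Bool} {n : ℕ} {ω : Ω} {r : ℝ} {p : Vec J}
    (h : p ∈ clearingSetHat D M L (uniformRule 𝒳 w) r n ω) :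
    p ∈ M.S ∧ ‖(1 / (n : ℝ)) • ∑ i : Fin n, scoreDHat D M L (uniformRule 𝒳 w) n ω w i p - M.cap‖ ≤ r := by
  refine ⟨h.1, ?_⟩
  have := h.2
  cases w <;> simpa [uniformRule] using this

/-- The estimated value of uniform treatment `w` is asymptotically linear, with the scores
`Γ^{*q}_{w i}(p*_w)`. -/
theorem negl_valueHat_sub (hc' : 0 < c') (hc₃ : 0 < c₃) (hD : IIDSample D P)
    (hM : MeasurableMechanism M) (hL : MeasurableLearners L) (hR : IsRegressions D M P R)
    (hB : BoundedDesign D M P R κ w)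
    (hov : ∀ᵐ ω ∂P, ∀ n k, ∀ᵐ x ∂(P.map (D.X 0)), eHat D L n k ω x ∈ Set.Ioo κ (1 - κ))
    (hOut : RegularOutcomes D M P R Rules pstar c' c₃ c₄)
    (hEq : RegularEquilibrium D M P Rules pstar c' c₃)
    (hNui : NuisanceAssumption D M L P R Rules pstar) (hw : uniformRule 𝒳 w ∈ Rules) :
    Negl P fun n ω => √n * (valueHat D M L (uniformRule 𝒳 w) n ω
      - 1 / (n : ℝ) * ∑ i : Fin n, qScore D M R P pstar w i (pstar (uniformRule 𝒳 w)) ω) := by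
  set π := uniformRule 𝒳 w with hπ
  set pst := pstar π with hpst
  have hπm : Measurable π := measurable_const
  have hArm : RegularArm D M P w pst := regularArm hD hM hR hc' hc₃ hOut hEq hw
  obtain ⟨c₁, hc₁, hball⟩ := hEq.ball
  have hball := hball π hw
  obtain ⟨rmu, re, rth, h0, hre, hrmu, hm1, hm2, hrates⟩ := hNui.rates
  obtain ⟨rg, hrg, hclear⟩ := hNui.clears
  have hrates : ∀ k, Whp P fun n ω => RatesHold D M L P R pstar (rmu n) (re n) (rth n) π n k ω :=
    hrates π hw
  have hclear : Whp P fun n ω => pHat D M L π n ω ∈ clearingSetHat D M L π (rg n) n ω := hclear π hw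
  have hrmu0 : Tendsto rmu atTop (𝓝 0) :=
    squeeze_zero (fun n => (h0 n).1) (fun n => le_add_of_nonneg_right (h0 n).2.2) hrmu
  have hrth0 : Tendsto rth atTop (𝓝 0) :=
    squeeze_zero (fun n => (h0 n).2.2) (fun n => le_add_of_nonneg_left (h0 n).1) hrmu
  have hvan : ∀ C : ℝ, 0 ≤ C → VanishingRates re fun n => rmu n + C * rth n := fun C hC =>
    { nonneg_e := fun n => (h0 n).2.1
      nonneg_mu := fun n => add_nonneg (h0 n).1 (mul_nonneg hC (h0 n).2.2)
      tendsto_e := hre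
      tendsto_mu := by simpa using hrmu0.add (hrth0.const_mul C)
      tendsto_mul := by
        have := hm1.add (hm2.const_mul C)
        rw [mul_zero, add_zero] at this
        exact this.congr fun n => by ring }
  -- Once `rth` is below the radius of the ball in `S` around `p*`, consistency places the
  -- first-step cutoffs in `S`, where the conditional means are controlled.
  have hfirst : ∀ k, Whp P fun n ω => pFirst D M L π n k ω ∈ M.S := fun k => by
    refine ((hrates k).and (Whp.of_forall (P := P)
      ((hrth0.eventually_lt_const hc₁).mono fun n hn ω => hn))).mono' fun n ω h => hball ?_
    rw [Metric.mem_ball, dist_eq_norm]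
    exact h.1.2.2.trans_lt h.2
  have hph : Whp P fun n ω => pHat D M L π n ω ∈ M.S := hclear.mono' fun n ω h => h.1
  have hηov := whp_overlap_eHat hD hL hov w
  have hmemS := hArm.mem
  -- the response `y`
  have hay := hOut.response_y (P := P) (D := D) hM
  have hmuy := hOut.regression_y hR w
  obtain ⟨Cy, hCy, hlipy⟩ := hmuy.exists_lipschitz hay hc'.le hc₁ hball
  have hFy : ∀ k, CrossFit D P R.e (fun x => R.muY w x pst) k (fun _ s O => eHatF L s k O)
      (fun _ s O => muYHatF M L π s k w O) re (fun n => rmu n + Cy * rth n) := fun k =>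
    crossFit_of_rates hD hL hmuy hCy hlipy hmemS (fun n s => measurable_muYHatF s k hM hL hπm w)
      (fun n s => invariantOn_muYHatF M L π s k w) (fun n => (h0 n).1) (hrates k) (hfirst k)
      fun n ω x => by
        rw [← muYHat_eq]
        exact Real.abs_le_sqrt (le_add_of_nonneg_right (sq_nonneg _))
  have hay_err : ∀ (n : ℕ) ω, 1 / (n : ℝ) * ∑ i : Fin n, scoreYHat D M L π n ω w i (pHat D M L π n ω)
      - 1 / (n : ℝ) * ∑ i : Fin n, drScore w (D.W i ω) (R.e (D.X i ω)) (R.muY w (D.X i ω) pst)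
          (M.y (D.B i w ω) pst)
      - (yPop D M P π (pHat D M L π n ω) - yPop D M P π pst)
      = scoreError D P R.e w M.y (fun x => R.muY w x pst) pst (fun k _ s O => eHatF L s k O)
        (fun k _ s O => muYHatF M L π s k w O) n ω (pHat D M L π n ω) := fun n ω => by
    simp only [scoreError, scoreYHat, muYHatAt, muYHat_eq, eHatAt, eHat_eq, hπ, yPop_uniformRule]
  -- the responses `d_j`
  have had := fun j => hOut.response_d (P := P) (D := D) hM j
  have hmud := fun j => hOut.regression_d hR hM hD w j
  choose Cd hCd hlipd using fun j => (hmud j).exists_lipschitz (had j) hc'.le hc₁ hball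
  have hFd : ∀ j k, CrossFit D P R.e (fun x => R.muD w x pst j) k (fun _ s O => eHatF L s k O)
      (fun _ s O x => muDHatF M L π s k w O x j) re (fun n => rmu n + Cd j * rth n) := fun j k =>
    crossFit_of_rates hD hL (hmud j) (hCd j) (hlipd j) hmemS
      (fun n s => (EuclideanSpace.proj (𝕜 := ℝ) j).continuous.measurable.comp
        (measurable_muDHatF s k hM hL hπm w))
      (fun n s O O' h => by simp only [invariantOn_muDHatF M L π s k w O O' h])
      (fun n => (h0 n).1) (hrates k) (hfirst k)
      fun n ω x => by
        rw [← muDHat_eq]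
        refine Real.abs_le_sqrt (le_trans ?_ (le_add_of_nonneg_left (sq_nonneg _)))
        rw [← sq_abs]
        gcongr
        exact PiLp.norm_apply_le (muDHat D M L n k ω w x (pFirst D M L π n k ω)
          - R.muD w x (pFirst D M L π n k ω)) j
  -- Market clearing says that the demand scores at `p*` have mean `s*`. Hence `T` below is a
  -- centred average, tight after scaling by `√n`.
  have hcap : ∀ j, ∫ ω, M.d (D.B 0 w ω) pst j ∂P = M.cap j := fun j => by
    have h1 := zPop_uniformRule_apply (R := R) hOut hM hD hmemS w j
    rw [hArm.clears] at h1
    simp only [PiLp.zero_apply] at h1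
    linarith
  set T : ℕ → Ω → Vec J := fun n ω => (1 / (n : ℝ)) • ∑ i : Fin n, drScore w (D.W i ω)
    (R.e (D.X i ω)) (R.muD w (D.X i ω) pst) (M.d (D.B i w ω) pst) - M.cap with hT
  set Zh : ℕ → Ω → Vec J := fun n ω => (1 / (n : ℝ)) • ∑ i : Fin n,
    scoreDHat D M L π n ω w i (pHat D M L π n ω) - M.cap with hZh
  have had_err : ∀ j, Whp P fun n ω => Zh n ω j - T n ω j - zPop D M P π (pHat D M L π n ω) j
      = scoreError D P R.e w (fun b p => M.d b p j) (fun x => R.muD w x pst j) pst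
        (fun k _ s O => eHatF L s k O) (fun k _ s O x => muDHatF M L π s k w O x j) n ω
        (pHat D M L π n ω) := fun j => hph.mono' fun n ω h => by
    rw [hπ, zPop_uniformRule_apply (R := R) hOut hM hD h w j, ← hπ]
    simp only [hZh, hT, PiLp.sub_apply, PiLp.smul_apply, WithLp.ofLp_sum, Finset.sum_apply,
      smul_eq_mul, scoreError, hcap, scoreDHat, drScore_apply, muDHatAt, muDHat_eq, eHatAt, eHat_eq]
    ring
  have hTt : ∀ j, Tight P fun n ω => eighthRoot n ^ 4 * T n ω j := fun j => by
    refine (tight_sum_sub_integral hD (measurable_starScore hR (had j) (hmud j) hmemS)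
      (memLp_starScore hB (had j) (hmud j) hmemS)).of_whp_le (Whp.of_forall
        ((eventually_gt_atTop 0).mono fun n hn ω => le_of_eq ?_))
    congr 1
    have hn0 : (n : ℝ) ≠ 0 := by exact_mod_cast hn.ne'
    rw [integral_starScore hB (had j) (hmud j) hmemS, hcap j, ← sqrt_eq_eighthRoot]
    simp only [hT, PiLp.sub_apply, PiLp.smul_apply, WithLp.ofLp_sum, Finset.sum_apply,
      smul_eq_mul, drScore_apply, Finset.sum_sub_distrib, Finset.sum_const, Finset.card_univ,
      Fintype.card_fin, nsmul_eq_mul, starScore, subOf_obs]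
    simp only [Sample.obs]
    field_simp
  obtain ⟨c, hc, hgrowth⟩ := hArm.growth
  have hmain := negl_linearization (P := P) (y := yPop D M P π) (z := zPop D M P π)
    (ν := nu D M P π pst) (S := M.S) hArm.clears hArm.score hc hgrowth
    (ph := fun n ω => pHat D M L π n ω) (Zh := Zh) (T := T)
    (Yh := fun n ω => 1 / (n : ℝ) * ∑ i : Fin n, scoreYHat D M L π n ω w i (pHat D M L π n ω))
    (Y := fun n ω => 1 / (n : ℝ) * ∑ i : Fin n, drScore w (D.W i ω) (R.e (D.X i ω))
      (R.muY w (D.X i ω) pst) (M.y (D.B i w ω) pst))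
    (r := re) (rg := rg) hre hrg hph
    (hclear.mono' fun n ω h => (mem_clearingSetHat_uniformRule h).2) hTt
    (fun j => by
      obtain ⟨U, hU, hle⟩ := score_expansion_crude (L := L) (π := π) hB (had j) (hmud j) (hCd j)
        (hlipd j) hmemS (hFd j) (hvan _ (hCd j)) hηov hM hL hπm hEq.compact.isClosed hph
      exact NeglUpTo.congr ⟨U, _, hU, hle⟩ ((had_err j).mono' fun n ω h => by rw [h]))
    (fun hrate j => by
      obtain ⟨U, hU, hle⟩ := score_expansion_fine (L := L) (π := π) hB (had j) (hmud j) (hCd j)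
        (hlipd j) hmemS (hFd j) (hvan _ (hCd j)) hηov hM hL hπm hEq.compact.isClosed hph hrate
      exact NeglUpTo.congr ⟨U, _, hU, hle⟩ ((had_err j).mono' fun n ω h => by rw [h]))
    (fun hrate => by
      obtain ⟨U, hU, hle⟩ := score_expansion_fine (L := L) (π := π) hB hay hmuy hCy
        hlipy hmemS hFy (hvan _ hCy) hηov hM hL hπm hEq.compact.isClosed hph hrate
      exact NeglUpTo.congr ⟨U, _, hU, hle⟩
        (Whp.of_forall (Eventually.of_forall fun n ω => by rw [hay_err])))
  refine hmain.congr (Whp.of_forall ((eventually_gt_atTop 0).mono fun n hn ω => ?_))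
  have hn0 : (n : ℝ) ≠ 0 := by exact_mod_cast hn.ne'
  rw [hπ, valueHat_uniformRule, ← hπ]
  congr 2
  simp only [qScore, hT, ← hπ, ← hpst, map_sub, map_smul, map_sum, smul_eq_mul,
    Finset.sum_sub_distrib, Finset.sum_const, Finset.card_univ, Fintype.card_fin, nsmul_eq_mul]
  field_simp

end Value

/-! ### The influence function as a function of one participant's data. -/

section Limit

variable {Ω 𝒳 𝓑 : Type*} {J : ℕ} [MeasurableSpace Ω] [MeasurableSpace 𝒳] [MeasurableSpace 𝓑]
  {P : Measure Ω} [IsProbabilityMeasure P] {D : Sample Ω 𝒳 𝓑} {M : Mechanism 𝓑 J}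
  {L : Learners 𝒳 J} {R : Regressions 𝒳 J} {Rules : Set (𝒳 → ℝ)} {pstar : (𝒳 → ℝ) → Vec J}
  {c' c₃ c₄ κ : ℝ} {w : Bool} {pst : Vec J}

lemma ContinuousLinearMap.apply_eq_sum (ν : Vec J →L[ℝ] ℝ) (v : Vec J) :
    ν v = ∑ j, ν (EuclideanSpace.single j (1 : ℝ)) * v j := by
  have hv : v = ∑ j, v j • EuclideanSpace.single j (1 : ℝ) := by
    have := (EuclideanSpace.basisFun (Fin J) ℝ).sum_repr v
    simpa using this.symm
  conv_lhs => rw [hv]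
  simp [mul_comm]

/-- The score of uniform treatment `w` as a function of the data of one participant. -/
noncomputable def qFun (M : Mechanism 𝓑 J) (R : Regressions 𝒳 J) (ν : Vec J →L[ℝ] ℝ) (w : Bool)
    (pst : Vec J) (o : Obs 𝒳 𝓑) : ℝ :=
  starScore w R.e (fun x => R.muY w x pst) (fun b => M.y b pst) o
    - ∑ j, ν (EuclideanSpace.single j (1 : ℝ)) *
      (starScore w R.e (fun x => R.muD w x pst j) (fun b => M.d b pst j) o - M.cap j)

/-- Expanding `ν` in coordinates reduces the score to scalar ones and shows it as a fixed function
of one observation, so scores of different participants are i.i.d. -/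
lemma qScore_eq (w : Bool) (i : ℕ) (ω : Ω) :
    qScore D M R P pstar w i (pstar (uniformRule 𝒳 w)) ω
      = qFun M R (nu D M P (uniformRule 𝒳 w) (pstar (uniformRule 𝒳 w))) w (pstar (uniformRule 𝒳 w))
        (D.obs i ω) := by
  rw [qScore, ContinuousLinearMap.apply_eq_sum, qFun]
  simp only [starScore, subOf_obs, PiLp.sub_apply, drScore_apply]
  rfl


lemma measurable_qFun (hB : BoundedDesign D M P R κ w) (hM : MeasurableMechanism M)
    (hOut : RegularOutcomes D M P R Rules pstar c' c₃ c₄) (hp : pst ∈ M.S) (ν : Vec J →L[ℝ] ℝ) :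
    Measurable (qFun (𝒳 := 𝒳) M R ν w pst) :=
  (measurable_starScore hB.regr (hOut.response_y hM) (hOut.regression_y hB.regr w) hp).sub
    (Finset.measurable_fun_sum _ fun j _ => ((measurable_starScore hB.regr (hOut.response_d hM j)
      (hOut.regression_d hB.regr hM hB.iid w j) hp).sub_const _).const_mul _)

lemma memLp_qFun (hB : BoundedDesign D M P R κ w) (hM : MeasurableMechanism M)
    (hOut : RegularOutcomes D M P R Rules pstar c' c₃ c₄) (hp : pst ∈ M.S) (ν : Vec J →L[ℝ] ℝ) :
    MemLp (qFun M R ν w pst) 2 (D.law P) := by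
  have := hB.iid.isProbabilityMeasure_law
  exact (memLp_starScore hB (hOut.response_y hM) (hOut.regression_y hB.regr w) hp).sub
    (memLp_finsetSum _ fun j _ => ((memLp_starScore hB (hOut.response_d hM j)
      (hOut.regression_d hB.regr hM hB.iid w j) hp).sub (memLp_const _)).const_mul _)

/-- The demand part is centred because the market clears at `pst`, so the correction by `ν` leaves
the mean unchanged. -/
lemma integral_qFun (hB : BoundedDesign D M P R κ w) (hM : MeasurableMechanism M)
    (hOut : RegularOutcomes D M P R Rules pstar c' c₃ c₄) (hp : pst ∈ M.S)
    (hz : zPop D M P (uniformRule 𝒳 w) pst = 0) (ν : Vec J →L[ℝ] ℝ) :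
    ∫ o, qFun M R ν w pst o ∂(D.law P) = ∫ ω, M.y (D.B 0 w ω) pst ∂P := by
  have := hB.iid.isProbabilityMeasure_law
  have hy := memLp_starScore hB (hOut.response_y hM) (hOut.regression_y hB.regr w) hp
  have hd := fun j => memLp_starScore hB (hOut.response_d hM j)
    (hOut.regression_d hB.regr hM hB.iid w j) hp
  have hdi := fun j => (hd j).integrable (by norm_num : (1 : ℝ≥0∞) ≤ 2)
  have hi : ∀ j, Integrable (fun o => ν (EuclideanSpace.single j (1 : ℝ)) *
      (starScore w R.e (fun x => R.muD w x pst j) (fun b => M.d b pst j) o - M.cap j)) (D.law P) :=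
    fun j => ((hdi j).sub (integrable_const _)).const_mul _
  have h0 : ∀ j, ∫ o, ν (EuclideanSpace.single j (1 : ℝ)) *
      (starScore w R.e (fun x => R.muD w x pst j) (fun b => M.d b pst j) o - M.cap j) ∂(D.law P) = 0 := by
    intro j
    have h1 := zPop_uniformRule_apply (R := R) hOut hM hB.iid hp w j
    rw [hz] at h1
    rw [integral_const_mul, integral_sub (hdi j) (integrable_const _), integral_starScore hB
      (hOut.response_d hM j) (hOut.regression_d hB.regr hM hB.iid w j) hp]
    simp only [PiLp.zero_apply] at h1
    simp [← h1]
  simp only [qFun]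
  rw [integral_sub (hy.integrable (by norm_num)) (integrable_finsetSum _ fun j _ => hi j),
    integral_finsetSum _ fun j _ => hi j, Finset.sum_eq_zero fun j _ => h0 j, sub_zero,
    integral_starScore hB (hOut.response_y hM) (hOut.regression_y hB.regr w) hp]

lemma measurable_tauHat (hD : IIDSample D P) (hM : MeasurableMechanism M)
    (hL : MeasurableLearners L) (n : ℕ) : Measurable (tauHat D M L n) := by
  have hv : ∀ w, Measurable (valueHat D M L (uniformRule 𝒳 w) n) := fun w => by
    have hπ : Measurable (uniformRule 𝒳 w) := measurable_const
    have h := hD.measurable_comp (n := n) (F := fun s O => 1 / (n : ℝ) * ∑ i : Fin n,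
        scoreYHatF M L (uniformRule 𝒳 w) s w i O (pHatF M L (uniformRule 𝒳 w) s O)) fun s =>
      (Finset.measurable_fun_sum _ fun i _ =>
        measurable_scoreYHatF_pHatF s hM hL hπ w i).const_mul _
    refine (congrArg Measurable (funext fun ω => ?_)).mp h
    rw [valueHat_uniformRule, pHat_eq]
    simp only [scoreYHat_eq]
  exact (hv true).sub (hv false)

end Limit

end CutoffMarket

/-! ### The main theorem: both arms combined, and the central limit theorem. -/

theorem mainTheorem3 {Ω 𝒳 𝓑 : Type*} [MeasurableSpace Ω] [MeasurableSpace 𝒳] [MeasurableSpace 𝓑]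
    (P : Measure Ω) [IsProbabilityMeasure P] (J : ℕ) (hJ : 0 < J)
    (D : CutoffMarket.Sample Ω 𝒳 𝓑) (M : CutoffMarket.Mechanism 𝓑 J)
    (L : CutoffMarket.Learners 𝒳 J) (R : CutoffMarket.Regressions 𝒳 J)
    (Rules : Set (𝒳 → ℝ)) (pstar : (𝒳 → ℝ) → CutoffMarket.Vec J) (c' c₃ c₄ : ℝ)
    (hc' : 0 < c') (hc₃ : 0 < c₃)
    (hRules : ∀ π ∈ Rules, Measurable π ∧ ∀ x, π x ∈ Set.Icc (0 : ℝ) 1)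
    (hUniform : ∀ w, CutoffMarket.uniformRule 𝒳 w ∈ Rules)
    (hD : CutoffMarket.IIDSample D P)
    (hM : CutoffMarket.MeasurableMechanism M)
    (hL : CutoffMarket.MeasurableLearners L)
    (hR : CutoffMarket.IsRegressions D M P R)
    (hId : CutoffMarket.Identification D P R)
    (hCut : CutoffMarket.CutoffAssumption D M P)
    (hOut : CutoffMarket.RegularOutcomes D M P R Rules pstar c' c₃ c₄)
    (hEq : CutoffMarket.RegularEquilibrium D M P Rules pstar c' c₃)
    (hNui : CutoffMarket.NuisanceAssumption D M L P R Rules pstar) :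
    TendstoInMeasure P
      (fun (n : ℕ) ω => √n * ((CutoffMarket.tauHat D M L n ω - CutoffMarket.tauStar D M P pstar)
        - (1 / (n : ℝ)) * ∑ i ∈ Finset.range n,
            (CutoffMarket.gteScore D M R P pstar i ω - CutoffMarket.tauStar D M P pstar)))
      atTop (fun _ => 0) ∧
    MemLp (CutoffMarket.gteScore D M R P pstar 0) 2 P ∧
    variance (CutoffMarket.gteScore D M R P pstar 0) P = CutoffMarket.sigmaSq D M R P pstar ∧
    TendstoInDistribution
      (fun (n : ℕ) ω => √n * (CutoffMarket.tauHat D M L n ω - CutoffMarket.tauStar D M P pstar))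
      atTop id (fun _ => P)
      (gaussianReal 0 (CutoffMarket.sigmaSq D M R P pstar).toNNReal) := by

  obtain ⟨κ, hκ, -, heκ, hov⟩ :=
    CutoffMarket.armProb_mem_of_limit hD hL hR hNui ⟨_, hUniform true⟩
  have hB : ∀ w, CutoffMarket.BoundedDesign D M P R κ w := fun w =>
    { iid := hD, regr := hR, ident := hId, pos := hκ
      overlap := heκ.mono fun x hx => by
        cases w
        · simp only [CutoffMarket.armProb, Bool.false_eq_true, if_false]; linarith [hx.2]
        · exact hx.1 }
  have hArm := fun w => CutoffMarket.regularArm hD hM hR hc' hc₃ hOut hEq (hUniform w)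
  have hprob := hD.isProbabilityMeasure_law
  set f : CutoffMarket.Obs 𝒳 𝓑 → ℝ := fun o =>
    CutoffMarket.qFun M R (CutoffMarket.nu D M P (CutoffMarket.uniformRule 𝒳 true)
      (pstar (CutoffMarket.uniformRule 𝒳 true))) true (pstar (CutoffMarket.uniformRule 𝒳 true)) o
    - CutoffMarket.qFun M R (CutoffMarket.nu D M P (CutoffMarket.uniformRule 𝒳 false)
      (pstar (CutoffMarket.uniformRule 𝒳 false))) false (pstar (CutoffMarket.uniformRule 𝒳 false)) o
    with hf
  have hgf : ∀ i, CutoffMarket.gteScore D M R P pstar i = fun ω => f (D.obs i ω) := fun i => by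
    ext ω
    simp only [CutoffMarket.gteScore, CutoffMarket.qScore_eq, hf]
  have hfm : Measurable f :=
    (CutoffMarket.measurable_qFun (hB true) hM hOut (hArm true).mem _).sub
      (CutoffMarket.measurable_qFun (hB false) hM hOut (hArm false).mem _)
  have hq := fun w => CutoffMarket.memLp_qFun (hB w) hM hOut (hArm w).mem
    (CutoffMarket.nu D M P (CutoffMarket.uniformRule 𝒳 w) (pstar (CutoffMarket.uniformRule 𝒳 w)))
  have hfL : MemLp f 2 (D.law P) := (hq true).sub (hq false)
  have hgL : MemLp (CutoffMarket.gteScore D M R P pstar 0) 2 P := by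
    rw [hgf]
    exact hfL.comp_of_map (hD.measurable_obs 0).aemeasurable
  have hmean : ∫ ω, CutoffMarket.gteScore D M R P pstar 0 ω ∂P = CutoffMarket.tauStar D M P pstar := by
    rw [hgf, ← CutoffMarket.integral_law hD hfm, hf,
      integral_sub ((hq true).integrable (by norm_num)) ((hq false).integrable (by norm_num)),
      CutoffMarket.integral_qFun (hB true) hM hOut (hArm true).mem (hArm true).clears,
      CutoffMarket.integral_qFun (hB false) hM hOut (hArm false).mem (hArm false).clears]
    rfl
  have hvar : variance (CutoffMarket.gteScore D M R P pstar 0) P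
      = CutoffMarket.sigmaSq D M R P pstar := by
    rw [variance_eq_integral hgL.aestronglyMeasurable.aemeasurable, hmean]
    rfl
  have hval := fun w => CutoffMarket.negl_valueHat_sub hc' hc₃ hD hM hL hR (hB w) hov hOut hEq hNui
    (hUniform w)
  -- The expansions of the two arms are subtracted; `τ*` cancels between the estimation error and
  -- the centred average, which requires `n > 0`.
  have hlin : CutoffMarket.Negl P fun (n : ℕ) ω => √n * ((CutoffMarket.tauHat D M L n ω
      - CutoffMarket.tauStar D M P pstar) - (1 / (n : ℝ)) * ∑ i ∈ Finset.range n,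
        (CutoffMarket.gteScore D M R P pstar i ω - CutoffMarket.tauStar D M P pstar)) := by
    refine ((hval true).sub (hval false)).congr (CutoffMarket.Whp.of_forall
      ((eventually_gt_atTop 0).mono fun n hn ω => ?_))
    have hn0 : (n : ℝ) ≠ 0 := by exact_mod_cast hn.ne'
    rw [Finset.sum_range]
    simp only [CutoffMarket.gteScore, CutoffMarket.tauHat, Finset.sum_sub_distrib, Finset.sum_const,
      Finset.card_univ, Fintype.card_fin, nsmul_eq_mul]
    field_simp
    ring
  have hlin' := CutoffMarket.tendstoInMeasure_of_negl hlin
  refine ⟨hlin', hgL, hvar, ?_⟩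
  have hlaw : HasLaw id (gaussianReal 0
      (variance (CutoffMarket.gteScore D M R P pstar 0) P).toNNReal)
      (gaussianReal 0 (CutoffMarket.sigmaSq D M R P pstar).toNNReal) := by
    rw [hvar]; exact HasLaw.id
  have hind : iIndepFun (fun i => CutoffMarket.gteScore D M R P pstar i) P := by
    have := hD.indep.comp (fun _ => f) fun _ => hfm
    refine (congrArg (fun X => iIndepFun X P) (funext fun i => ?_)).mp this
    exact (hgf i).symm
  have hid : ∀ i, IdentDistrib (CutoffMarket.gteScore D M R P pstar i)
      (CutoffMarket.gteScore D M R P pstar 0) P P := fun i => by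
    rw [hgf, hgf]
    exact (hD.ident i).comp hfm
  have hclt := tendstoInDistribution_inv_sqrt_mul_sum_sub hlaw hgL hind hid
  -- Slutsky's lemma: the normalized error differs from the normalized i.i.d. sum by a term that
  -- vanishes in probability.
  refine tendstoInDistribution_of_tendstoInMeasure_sub _ _ hclt ?_ fun n =>
    (((CutoffMarket.measurable_tauHat hD hM hL n).sub_const _).const_mul _).aemeasurable
  refine hlin'.congr_left fun n => ae_of_all _ fun ω => ?_
  rw [hmean]
  simp only [Pi.sub_apply, Finset.sum_sub_distrib, Finset.sum_const, Finset.card_range, nsmul_eq_mul]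
  -- For `n = 0` both sides vanish, as `√0 = 0` and the sums are empty; otherwise `1 / √n = √n / n`
  -- matches the two normalizations.
  rcases Nat.eq_zero_or_pos n with rfl | hn
  · simp
  have hn0 : (0 : ℝ) < n := by exact_mod_cast hn
  have hs : (√(n : ℝ))⁻¹ = √n * (1 / n) := by
    have := Real.mul_self_sqrt hn0.le
    have h2 : √(n : ℝ) ≠ 0 := (Real.sqrt_pos.2 hn0).ne'
    field_simp
    rw [sq, this]
  rw [hs]
  field_simp
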